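/- Let $k$ be a field of characteristic zero and let $\mathfrak g=\bigoplus_{i\in\mathbb Z}\mathfrak g^i$ be a differential $\mathbb Z$-graded Lie algebra over $k$, with differential $d$ of degree $+1$. Assume that $\mathfrak g$ is proper, i.e. that $\bigoplus_i H^i(\mathfrak g)$ is finite-dimensional ($\mathfrak g$ itself may be infinite-dimensional). Let $|\mathfrak g|$ be the integer $$|\mathfrak g|=\sum_{i\ \mathrm{even}}(1-i)\dim H^i(\mathfrak g)+\sum_{i\ \mathrm{odd}} i\,\dim H^i(\mathfrak g);$$ in other words, if $e_1,\dots,e_n,\varepsilon_1,\dots,\varepsilon_m$ is a homogeneous basis of $H^\bullet(\mathfrak g)$ with the $e_i$ of even and the $\varepsilon_j$ of odd degree, then $|\mathfrak g|=n-\sum_i|e_i|+\sum_j|\varepsilon_j|$. Let $U(\mathfrak g)$ be the universal enveloping dg algebra of $\mathfrak g$, and let $\mathrm{CE}_\bullet(\mathfrak g)$ be the Chevalley--Eilenberg dg coalgebra of $\mathfrak g$: the graded symmetric coalgebra $S(\mathfrak g[1])$, where $\mathfrak g[1]^i=\mathfrak g^{i+1}$, with the coderivation $d_1+d_2$ induced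 by $x[1]\mapsto -(dx)[1]$ and $x[1]\,y[1]\mapsto(-1)^{|x|}[x,y][1]$. The dualizing complex $\mathrm{CE}^\bullet(\mathfrak g,U(\mathfrak g))\cong\hat S(\mathfrak g^*[-1])\hat\otimes U(\mathfrak g)$ is the complex whose component of degree $n$ consists of the $k$-linear maps $f:\mathrm{CE}_\bullet(\mathfrak g)\to U(\mathfrak g)$ of degree $n$, with differential $$Df=d_{U(\mathfrak g)}\circ f-(-1)^n f\circ(d_1+d_2)+\tau*f,$$ where, for homogeneous $x_1,\dots,x_r\in\mathfrak g$, $$(\tau*f)(x_1[1]\cdots x_r[1])=\sum_i\pm(-1)^{n(|x_i|-1)}\,x_i\,f(x_1[1]\cdots\widehat{x_i[1]}\cdots x_r[1]),$$ and $\pm$ is the Koszul sign of moving $x_i[1]$ to the front of the product $x_1[1]\cdots x_r[1]$. Then the cohomology of $\mathrm{CE}^\bullet(\mathfrak g,U(\mathfrak g))$ is one-dimensional and concentrated in degree $|\mathfrak g|$: $\dim_k H^{|\mathfrak g|}\big(\mathrm{CE}^\bullet(\mathfrak g,U(\mathfrak g))\big)=1$ and $H^n\big(\mathrm{CE}^\bullet(\mathfrak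 g,U(\mathfrak g))\big)=0$ for every integer $n\neq|\mathfrak g|$. -/

import Mathlib

open scoped TensorProduct DirectSum

universe u v

set_option maxSynthPendingDepth 3

noncomputable section

/-- A differential `ℤ`-graded Lie algebra over a field `k` (cohomological grading) with underlying
vector space `L = ⨁ i, deg i`. -/
structure DGLieAlgebra (k : Type u) (L : Type v) [Field k] [AddCommGroup L] [Module k L] where
  /-- the component of degree `i` -/
  deg : ℤ → Submodule k L
  isInternal : DirectSum.IsInternal deg
  /-- the differential -/
  d : L →ₗ[k] L
  d_mem : ∀ {i : ℤ} {x : L}, x ∈ deg i → d x ∈ deg (i + 1)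
  d_d : ∀ x : L, d (d x) = 0
  /-- the Lie bracket -/
  bracket : L →ₗ[k] L →ₗ[k] L
  bracket_mem : ∀ {i j : ℤ} {x y : L}, x ∈ deg i → y ∈ deg j → bracket x y ∈ deg (i + j)
  bracket_skew : ∀ {i j : ℤ} {x y : L}, x ∈ deg i → y ∈ deg j →
    bracket x y = -((i * j).negOnePow • bracket y x)
  jacobi : ∀ {i j l : ℤ} {x y z : L}, x ∈ deg i → y ∈ deg j → z ∈ deg l →
    bracket x (bracket y z) =
      bracket (bracket x y) z + (i * j).negOnePow • bracket y (bracket x z)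
  leibniz : ∀ {i j : ℤ} {x y : L}, x ∈ deg i → y ∈ deg j →
    d (bracket x y) = bracket (d x) y + i.negOnePow • bracket x (d y)

set_option linter.unusedSimpArgs false

namespace DGLieAlgebra

variable {k : Type u} {L : Type v} [Field k] [AddCommGroup L] [Module k L]
variable (g : DGLieAlgebra k L)

/-! ### Cohomology of the dg Lie algebra -/

/-- The cocycles of degree `i` of `g`. -/
def cocycles (i : ℤ) : Submodule k L := g.deg i ⊓ LinearMap.ker g.d

/-- The coboundaries of degree `i` of `g`. -/
def coboundaries (i : ℤ) : Submodule k L := (g.deg (i - 1)).map g.d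

theorem coboundaries_le_cocycles (i : ℤ) : g.coboundaries i ≤ g.cocycles i := by
  rintro _ ⟨x, hx, rfl⟩
  refine ⟨?_, g.d_d x⟩
  have := g.d_mem hx
  rwa [sub_add_cancel] at this

/-- The cohomology `H^i(g)`. -/
abbrev H (i : ℤ) : Type v := g.cocycles i ⧸ (g.coboundaries i).submoduleOf (g.cocycles i)

/-- `g` is proper: the total cohomology `⨁ i, H^i(g)` is finite-dimensional. -/
def IsProper : Prop := FiniteDimensional k (⨁ i : ℤ, g.H i)

/-- The integer `|g| = |H(g)|`, for `g` proper: the sum of `1 - |e|` over the even members `e` of a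
homogeneous basis of `H(g)` and of `|ε|` over its odd members `ε`. -/
def totalDegree : ℤ :=
  ∑ᶠ i : ℤ, (Module.finrank k (g.H i) : ℤ) * (if Even i then 1 - i else i)

/-! ### Linear maps given on homogeneous elements -/

theorem bijective_coe : Function.Bijective (DirectSum.coeLinearMap g.deg) := g.isInternal

/-- The linear map on `L` that is `F i` on `deg i`. -/
def homogLift {N : Type*} [AddCommGroup N] [Module k N] (F : ℤ → L →ₗ[k] N) : L →ₗ[k] N :=
  (DirectSum.toModule k ℤ N fun i => F i ∘ₗ (g.deg i).subtype) ∘ₗ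
    (LinearEquiv.ofBijective (DirectSum.coeLinearMap g.deg) g.bijective_coe).symm.toLinearMap

theorem homogLift_apply {N : Type*} [AddCommGroup N] [Module k N] (F : ℤ → L →ₗ[k] N)
    {i : ℤ} {x : L} (hx : x ∈ g.deg i) : g.homogLift F x = F i x := by
  have h : (LinearEquiv.ofBijective (DirectSum.coeLinearMap g.deg) g.bijective_coe).symm x =
      DirectSum.lof k ℤ (fun i => g.deg i) i ⟨x, hx⟩ := by
    rw [LinearEquiv.symm_apply_eq, LinearEquiv.ofBijective_apply, DirectSum.coeLinearMap_lof]
  simp [homogLift, h]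

/-- Two linear maps on `L` that agree on homogeneous elements are equal. -/
theorem hom_ext {N : Type*} [AddCommGroup N] [Module k N] {F G : L →ₗ[k] N}
    (h : ∀ (i : ℤ) (x : L), x ∈ g.deg i → F x = G x) : F = G := by
  have key : F ∘ₗ DirectSum.coeLinearMap g.deg = G ∘ₗ DirectSum.coeLinearMap g.deg := by
    ext i x
    simpa using h i x x.2
  ext x
  obtain ⟨y, rfl⟩ := g.bijective_coe.2 x
  exact LinearMap.congr_fun key y

/-- The map `x ↦ (-1)^|x| x`. -/
def parity : L →ₗ[k] L := g.homogLift fun i => i.negOnePow • LinearMap.id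

/-- The map `x ↦ (-1)^(n (|x| - 1)) x`; here `|x| - 1` is the degree of `x` in `g[1]`. -/
def shiftSign (n : ℤ) : L →ₗ[k] L :=
  g.homogLift fun i => (n * (i - 1)).negOnePow • LinearMap.id

/-! ### The universal enveloping dg algebra -/

/-- The relations `x y = (-1)^(|x||y|) y x + [x, y]`. -/
inductive URel : TensorAlgebra k L → TensorAlgebra k L → Prop
  | comm {i j : ℤ} {x y : L} (hx : x ∈ g.deg i) (hy : y ∈ g.deg j) :
      URel (TensorAlgebra.ι k x * TensorAlgebra.ι k y)
        ((i * j).negOnePow • (TensorAlgebra.ι k y * TensorAlgebra.ι k x) +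
          TensorAlgebra.ι k (g.bracket x y))

/-- The universal enveloping algebra `U(g)`. -/
def U : Type (max u v) := RingQuot g.URel

instance : Ring g.U := inferInstanceAs (Ring (RingQuot g.URel))
instance : Algebra k g.U := inferInstanceAs (Algebra k (RingQuot g.URel))

/-- The quotient map from the tensor algebra. -/
def mkU : TensorAlgebra k L →ₐ[k] g.U := RingQuot.mkAlgHom k g.URel

/-- The canonical map `g → U(g)`. -/
def ιU : L →ₗ[k] g.U := g.mkU.toLinearMap ∘ₗ TensorAlgebra.ι k

theorem mkU_ι (x : L) : g.mkU (TensorAlgebra.ι k x) = g.ιU x := rfl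

theorem mkU_surjective : Function.Surjective g.mkU := RingQuot.mkAlgHom_surjective k g.URel

/-- The component of degree `n` of `U(g)`: the span of the products `x₁ ⋯ xᵣ` of homogeneous
elements with `|x₁| + ⋯ + |xᵣ| = n`. -/
def degU (n : ℤ) : Submodule k g.U :=
  Submodule.span k {a | ∃ l : List (ℤ × L), (∀ p ∈ l, p.2 ∈ g.deg p.1) ∧
    (l.map Prod.fst).sum = n ∧ (l.map fun p => g.ιU p.2).prod = a}

theorem ιU_comm {i j : ℤ} {x y : L} (hx : x ∈ g.deg i) (hy : y ∈ g.deg j) :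
    g.ιU x * g.ιU y = (i * j).negOnePow • (g.ιU y * g.ιU x) + g.ιU (g.bracket x y) := by
  have h : g.mkU _ = g.mkU _ := RingQuot.mkAlgHom_rel k (URel.comm (g := g) hx hy)
  simp only [mkU_ι, Units.smul_def, map_add, map_mul, map_zsmul] at h
  exact h

/-- The algebra map out of `U(g)` given by a linear map that respects the relations. -/
def liftU {A : Type*} [Ring A] [Algebra k A] (f : L →ₗ[k] A)
    (hf : ∀ {i j : ℤ} {x y : L}, x ∈ g.deg i → y ∈ g.deg j →
      f x * f y = (i * j).negOnePow • (f y * f x) + f (g.bracket x y)) : g.U →ₐ[k] A :=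
  RingQuot.liftAlgHom k ⟨TensorAlgebra.lift k f, by
    rintro _ _ ⟨hx, hy⟩
    have := hf hx hy
    simpa [Units.smul_def] using this⟩

theorem liftU_ι {A : Type*} [Ring A] [Algebra k A] (f : L →ₗ[k] A) (hf) (x : L) :
    g.liftU f hf (g.ιU x) = f x := by
  change (RingQuot.liftAlgHom k _) (RingQuot.mkAlgHom k g.URel (TensorAlgebra.ι k x)) = _
  rw [RingQuot.liftAlgHom_mkAlgHom_apply, TensorAlgebra.lift_ι_apply]

theorem parity_apply {i : ℤ} {x : L} (hx : x ∈ g.deg i) : g.parity x = i.negOnePow • x := by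
  simp [parity, g.homogLift_apply _ hx]

theorem shiftSign_apply (n : ℤ) {i : ℤ} {x : L} (hx : x ∈ g.deg i) :
    g.shiftSign n x = (n * (i - 1)).negOnePow • x := by
  simp [shiftSign, g.homogLift_apply _ hx]

/-- The operator `(a, b) ↦ (x a, (dx) a + (-1)^|x| x b)` on `U(g) × U(g)`. -/
def dUAux : L →ₗ[k] Module.End k (g.U × g.U) :=
  LinearMap.mk₂ k
    (fun x p => (g.ιU x * p.1, g.ιU (g.d x) * p.1 + g.ιU (g.parity x) * p.2))
    (by intro x y p; ext <;> simp [add_mul]; abel)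
    (by intro c x p; ext <;> simp)
    (by intro c x p; ext <;> simp [mul_add]; abel)
    (by intro c x p; ext <;> simp)

theorem dUAux_apply (x : L) (p : g.U × g.U) :
    g.dUAux x p = (g.ιU x * p.1, g.ιU (g.d x) * p.1 + g.ιU (g.parity x) * p.2) := rfl

theorem negOnePow_cases (i : ℤ) :
    ((Even i ∧ ¬ Odd i) ∧ i.negOnePow = 1) ∨ ((Odd i ∧ ¬ Even i) ∧ i.negOnePow = -1) := by
  rcases Int.even_or_odd i with h | h
  · exact Or.inl ⟨⟨h, Int.not_odd_iff_even.2 h⟩, Int.negOnePow_even _ h⟩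
  · exact Or.inr ⟨⟨h, Int.not_even_iff_odd.2 h⟩, Int.negOnePow_odd _ h⟩

theorem negOnePow_mul (i j : ℤ) : (i * j).negOnePow = if Odd i then j.negOnePow else 1 := by
  split_ifs with h
  · rcases negOnePow_cases j with ⟨h', e⟩ | ⟨h', e⟩ <;> rw [e]
    · exact Int.negOnePow_even _ (h'.1.mul_left _)
    · exact Int.negOnePow_odd _ (h.mul h'.1)
  · exact Int.negOnePow_even _ ((Int.not_odd_iff_even.1 h).mul_right _)

theorem dUAux_rel {i j : ℤ} {x y : L} (hx : x ∈ g.deg i) (hy : y ∈ g.deg j) :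
    g.dUAux x * g.dUAux y =
      (i * j).negOnePow • (g.dUAux y * g.dUAux x) + g.dUAux (g.bracket x y) := by
  have h0 := g.ιU_comm hx hy
  have h1 := g.ιU_comm (g.d_mem hx) hy
  have h2 := g.ιU_comm hx (g.d_mem hy)
  have h3 := congrArg g.ιU (g.leibniz hx hy)
  refine LinearMap.ext fun p => ?_
  simp only [Module.End.mul_apply, LinearMap.add_apply, LinearMap.smul_apply, dUAux_apply,
    Prod.smul_mk, Prod.mk_add_mk, g.parity_apply hx, g.parity_apply hy,
    g.parity_apply (g.bracket_mem hx hy), h3, map_add, Units.smul_def, map_zsmul]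
  refine Prod.ext ?_ ?_
  · have := congrArg (· * p.1) h0
    simpa [Units.smul_def, add_mul, mul_assoc] using this
  · have e1 := congrArg (· * p.1) h1
    have e2 := congrArg (fun a => (i.negOnePow : ℤ) • (a * p.1)) h2
    have e3 := congrArg (fun a => (i.negOnePow : ℤ) • ((j.negOnePow : ℤ) • (a * p.2))) h0
    rcases negOnePow_cases i with ⟨hi, ei⟩ | ⟨hi, ei⟩ <;>
      rcases negOnePow_cases j with ⟨hj, ej⟩ | ⟨hj, ej⟩ <;>
      simp [negOnePow_mul, Int.negOnePow_add, hi, ei, ej, Units.smul_def,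
        add_mul, mul_add, mul_assoc] at e1 e2 e3 ⊢ <;>
      linear_combination (norm := abel) e1 + e2 + e3

/-- The differential of `U(g)`: the derivation of degree `1` that extends `d`, so that `d 1 = 0` and
`d (x a) = (dx) a + (-1)^|x| x (d a)`. -/
def dU : g.U →ₗ[k] g.U :=
  LinearMap.snd k g.U g.U ∘ₗ LinearMap.applyₗ ((1, 0) : g.U × g.U) ∘ₗ
    (g.liftU g.dUAux g.dUAux_rel).toLinearMap

theorem hom_induction {P : L → Prop} (h0 : P 0) (hadd : ∀ x y, P x → P y → P (x + y))
    (hh : ∀ (i : ℤ) (x : L), x ∈ g.deg i → P x) (x : L) : P x := by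
  obtain ⟨y, rfl⟩ := g.bijective_coe.2 x
  induction y using DirectSum.induction_on with
  | zero => simpa using h0
  | of i x => simpa using hh i _ x.2
  | add x y hx hy => simpa using hadd _ _ hx hy

theorem tensorAlgebra_induction {P : TensorAlgebra k L → Prop}
    (h1 : P 1) (hadd : ∀ a b, P a → P b → P (a + b)) (hsmul : ∀ (c : k) a, P a → P (c • a))
    (hmul : ∀ x a, P a → P (TensorAlgebra.ι k x * a)) (a : TensorAlgebra k L) : P a := by
  have key : ∀ b, P b → P (a * b) := by
    induction a using TensorAlgebra.induction with
    | algebraMap r => intro b hb; rw [← Algebra.smul_def]; exact hsmul _ _ hb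
    | ι x => exact hmul x
    | mul a b ha hb => intro c hc; rw [mul_assoc]; exact ha _ (hb _ hc)
    | add a b ha hb => intro c hc; rw [add_mul]; exact hadd _ _ (ha _ hc) (hb _ hc)
  simpa using key 1 h1

theorem U_induction {P : g.U → Prop}
    (h1 : P 1) (hadd : ∀ a b, P a → P b → P (a + b)) (hsmul : ∀ (c : k) a, P a → P (c • a))
    (hmul : ∀ (i : ℤ) (x : L), x ∈ g.deg i → ∀ a, P a → P (g.ιU x * a)) (a : g.U) : P a := by
  obtain ⟨a, rfl⟩ := g.mkU_surjective a
  induction a using tensorAlgebra_induction with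
  | h1 => rw [map_one]; exact h1
  | hadd a b ha hb => rw [map_add]; exact hadd _ _ ha hb
  | hsmul c a ha => rw [map_smul]; exact hsmul _ _ ha
  | hmul x a ha =>
    rw [map_mul, mkU_ι]
    induction x using g.hom_induction with
    | h0 => simpa only [map_zero, zero_mul, zero_smul] using hsmul 0 _ h1
    | hadd x y hx hy => rw [map_add, add_mul]; exact hadd _ _ hx hy
    | hh i x hx => exact hmul i x hx _ ha

theorem dU_one : g.dU 1 = 0 := by simp [dU]

theorem liftU_dUAux_fst (a : g.U) : (g.liftU g.dUAux g.dUAux_rel a (1, 0)).1 = a := by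
  induction a using g.U_induction with
  | h1 => simp
  | hadd a b ha hb => simp [ha, hb]
  | hsmul c a ha => simp [ha]
  | hmul i x hx a ha => simp [liftU_ι, dUAux_apply, ha]

theorem dU_mul (x : L) (a : g.U) :
    g.dU (g.ιU x * a) = g.ιU (g.d x) * a + g.ιU (g.parity x) * g.dU a := by
  simp [dU, liftU_ι, dUAux_apply, liftU_dUAux_fst]

theorem dU_dU (a : g.U) : g.dU (g.dU a) = 0 := by
  induction a using g.U_induction with
  | h1 => simp [dU_one]
  | hadd a b ha hb => simp [ha, hb]
  | hsmul c a ha => simp [ha]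
  | hmul i x hx a ha =>
    rcases negOnePow_cases i with ⟨-, e⟩ | ⟨-, e⟩ <;>
      simp [dU_mul, ha, g.d_d, g.parity_apply hx, g.parity_apply (g.d_mem hx),
        Int.negOnePow_add, Units.smul_def, e]

/-! ### The Chevalley-Eilenberg coalgebra -/

/-- The relations `X Y = (-1)^((|x| - 1)(|y| - 1)) Y X`, where `X = x[1]` and `Y = y[1]`. -/
inductive SRel : TensorAlgebra k L → TensorAlgebra k L → Prop
  | comm {i j : ℤ} {x y : L} (hx : x ∈ g.deg i) (hy : y ∈ g.deg j) :
      SRel (TensorAlgebra.ι k x * TensorAlgebra.ι k y)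
        (((i - 1) * (j - 1)).negOnePow • (TensorAlgebra.ι k y * TensorAlgebra.ι k x))

/-- The graded symmetric algebra `S(g[1])`, the graded vector space underlying the
Chevalley-Eilenberg coalgebra `CE_•(g)`. -/
def S : Type (max u v) := RingQuot g.SRel

instance : Ring g.S := inferInstanceAs (Ring (RingQuot g.SRel))
instance : Algebra k g.S := inferInstanceAs (Algebra k (RingQuot g.SRel))

/-- The quotient map from the tensor algebra. -/
def mkS : TensorAlgebra k L →ₐ[k] g.S := RingQuot.mkAlgHom k g.SRel

/-- The canonical map `x ↦ x[1]` from `g` to `S(g[1])`. -/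
def ιS : L →ₗ[k] g.S := g.mkS.toLinearMap ∘ₗ TensorAlgebra.ι k

theorem mkS_ι (x : L) : g.mkS (TensorAlgebra.ι k x) = g.ιS x := rfl

theorem mkS_surjective : Function.Surjective g.mkS := RingQuot.mkAlgHom_surjective k g.SRel

/-- The component of degree `n` of `S(g[1])`: the span of the products `x₁[1] ⋯ xᵣ[1]` of
homogeneous elements with `(|x₁| - 1) + ⋯ + (|xᵣ| - 1) = n`. -/
def degS (n : ℤ) : Submodule k g.S :=
  Submodule.span k {a | ∃ l : List (ℤ × L), (∀ p ∈ l, p.2 ∈ g.deg p.1) ∧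
    (l.map fun p => p.1 - 1).sum = n ∧ (l.map fun p => g.ιS p.2).prod = a}

theorem ιS_comm {i j : ℤ} {x y : L} (hx : x ∈ g.deg i) (hy : y ∈ g.deg j) :
    g.ιS x * g.ιS y = ((i - 1) * (j - 1)).negOnePow • (g.ιS y * g.ιS x) := by
  have h : g.mkS _ = g.mkS _ := RingQuot.mkAlgHom_rel k (SRel.comm (g := g) hx hy)
  simp only [mkS_ι, Units.smul_def, map_mul, map_zsmul] at h
  exact h

/-- The algebra map out of `S(g[1])` given by a linear map that respects the relations. -/
def liftS {A : Type*} [Ring A] [Algebra k A] (f : L →ₗ[k] A)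
    (hf : ∀ {i j : ℤ} {x y : L}, x ∈ g.deg i → y ∈ g.deg j →
      f x * f y = ((i - 1) * (j - 1)).negOnePow • (f y * f x)) : g.S →ₐ[k] A :=
  RingQuot.liftAlgHom k ⟨TensorAlgebra.lift k f, by
    rintro _ _ ⟨hx, hy⟩
    have := hf hx hy
    simpa [Units.smul_def] using this⟩

theorem liftS_ι {A : Type*} [Ring A] [Algebra k A] (f : L →ₗ[k] A) (hf) (x : L) :
    g.liftS f hf (g.ιS x) = f x := by
  change (RingQuot.liftAlgHom k _) (RingQuot.mkAlgHom k g.SRel (TensorAlgebra.ι k x)) = _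
  rw [RingQuot.liftAlgHom_mkAlgHom_apply, TensorAlgebra.lift_ι_apply]

theorem S_induction {P : g.S → Prop}
    (h1 : P 1) (hadd : ∀ a b, P a → P b → P (a + b)) (hsmul : ∀ (c : k) a, P a → P (c • a))
    (hmul : ∀ (i : ℤ) (x : L), x ∈ g.deg i → ∀ a, P a → P (g.ιS x * a)) (a : g.S) : P a := by
  obtain ⟨a, rfl⟩ := g.mkS_surjective a
  induction a using tensorAlgebra_induction with
  | h1 => rw [map_one]; exact h1
  | hadd a b ha hb => rw [map_add]; exact hadd _ _ ha hb
  | hsmul c a ha => rw [map_smul]; exact hsmul _ _ ha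
  | hmul x a ha =>
    rw [map_mul, mkS_ι]
    induction x using g.hom_induction with
    | h0 => simpa only [map_zero, zero_mul, zero_smul] using hsmul 0 _ h1
    | hadd x y hx hy => rw [map_add, add_mul]; exact hadd _ _ hx hy
    | hh i x hx => exact hmul i x hx _ ha

/-- The operator `y ⊗ b ↦ (-1)^((|x| - 1)(|y| - 1)) y ⊗ x[1] b` on `g ⊗ S(g[1])`. -/
def swapMul : L →ₗ[k] Module.End k (L ⊗[k] g.S) :=
  g.homogLift fun i =>
    TensorProduct.mapBilinear (.id k) L g.S L g.S (g.shiftSign (i - 1)) ∘ₗ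
      LinearMap.mul k g.S ∘ₗ g.ιS

theorem swapMul_tmul {i : ℤ} {x : L} (hx : x ∈ g.deg i) (y : L) (b : g.S) :
    g.swapMul x (y ⊗ₜ b) = g.shiftSign (i - 1) y ⊗ₜ (g.ιS x * b) := by
  simp [swapMul, g.homogLift_apply _ hx]

/-- The operator `(a, w) ↦ (x[1] a, x ⊗ a + swapMul x w)` on `S(g[1]) × (g ⊗ S(g[1]))`. -/
def extractAux : L →ₗ[k] Module.End k (g.S × (L ⊗[k] g.S)) :=
  LinearMap.mk₂ k (fun x p => (g.ιS x * p.1, x ⊗ₜ p.1 + g.swapMul x p.2))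
    (by intro x y p; ext <;> simp [add_mul, TensorProduct.add_tmul]; abel)
    (by intro c x p; ext <;> simp [TensorProduct.smul_tmul'])
    (by intro c x p; ext <;> simp [mul_add, TensorProduct.tmul_add]; abel)
    (by intro c x p; ext <;> simp)

theorem extractAux_apply (x : L) (p : g.S × (L ⊗[k] g.S)) :
    g.extractAux x p = (g.ιS x * p.1, x ⊗ₜ p.1 + g.swapMul x p.2) := rfl

theorem tensor_ext {N : Type*} [AddCommGroup N] [Module k N] {F G : L ⊗[k] g.S →ₗ[k] N}
    (h : ∀ (i : ℤ) (x : L), x ∈ g.deg i → ∀ b, F (x ⊗ₜ b) = G (x ⊗ₜ b)) : F = G :=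
  TensorProduct.ext <| g.hom_ext fun i x hx => LinearMap.ext fun b => h i x hx b

theorem swapMul_rel {i j : ℤ} {x y : L} (hx : x ∈ g.deg i) (hy : y ∈ g.deg j) :
    g.swapMul x * g.swapMul y = ((i - 1) * (j - 1)).negOnePow • (g.swapMul y * g.swapMul x) := by
  refine g.tensor_ext fun l z hz b => ?_
  have h := congrArg (· * b) (g.ιS_comm hx hy)
  simp only [Units.smul_def, smul_mul_assoc, mul_assoc] at h
  simp only [Module.End.mul_apply, LinearMap.smul_apply, swapMul_tmul _ hx, swapMul_tmul _ hy,
    g.shiftSign_apply _ hz, Units.smul_def, map_zsmul, h, TensorProduct.tmul_smul,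
    ← TensorProduct.smul_tmul', smul_smul]
  congr 1
  ring

theorem extractAux_rel {i j : ℤ} {x y : L} (hx : x ∈ g.deg i) (hy : y ∈ g.deg j) :
    g.extractAux x * g.extractAux y =
      ((i - 1) * (j - 1)).negOnePow • (g.extractAux y * g.extractAux x) := by
  refine LinearMap.ext fun p => ?_
  have h1 := LinearMap.congr_fun (g.swapMul_rel hx hy) p.2
  have h2 := congrArg (· * p.1) (g.ιS_comm hx hy)
  simp only [Units.smul_def, smul_mul_assoc, mul_assoc] at h2
  simp only [Module.End.mul_apply, LinearMap.smul_apply] at h1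
  have h3 : ((j - 1) * (i - 1)) = (i - 1) * (j - 1) := mul_comm _ _
  have h4 : (((i - 1) * (j - 1)).negOnePow : ℤ) * ((i - 1) * (j - 1)).negOnePow = 1 := by
    rw [← Units.val_mul, Int.units_mul_self, Units.val_one]
  refine Prod.ext ?_ ?_
  · simpa only [Module.End.mul_apply, LinearMap.smul_apply, extractAux_apply, Units.smul_def,
      Prod.smul_fst] using h2
  · simp only [Module.End.mul_apply, LinearMap.smul_apply, extractAux_apply, Prod.smul_snd,
      map_add, h1, smul_add, swapMul_tmul _ hx, swapMul_tmul _ hy, g.shiftSign_apply _ hx,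
      g.shiftSign_apply _ hy, Units.smul_def, h3, ← TensorProduct.smul_tmul', smul_smul, h4, one_smul]
    abel

/-- The map `S(g[1]) → g ⊗ S(g[1])`,
`x₁[1] ⋯ xᵣ[1] ↦ ∑ᵢ ± xᵢ ⊗ x₁[1] ⋯ (omit xᵢ[1]) ⋯ xᵣ[1]`, with the Koszul sign of moving `xᵢ[1]` to
the front: the component of the comultiplication of `CE_•(g)` in `g[1] ⊗ CE_•(g)`. -/
def extract : g.S →ₗ[k] L ⊗[k] g.S :=
  LinearMap.snd k g.S (L ⊗[k] g.S) ∘ₗ LinearMap.applyₗ ((1, 0) : g.S × (L ⊗[k] g.S)) ∘ₗ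
    (g.liftS g.extractAux g.extractAux_rel).toLinearMap

theorem extract_one : g.extract 1 = 0 := by simp [extract]

theorem liftS_extractAux_fst (a : g.S) :
    (g.liftS g.extractAux g.extractAux_rel a (1, 0)).1 = a := by
  induction a using g.S_induction with
  | h1 => simp
  | hadd a b ha hb => simp [ha, hb]
  | hsmul c a ha => simp [ha]
  | hmul i x hx a ha => simp [liftS_ι, extractAux_apply, ha]

theorem extract_mul (x : L) (a : g.S) :
    g.extract (g.ιS x * a) = x ⊗ₜ a + g.swapMul x (g.extract a) := by
  simp [extract, liftS_ι, extractAux_apply, liftS_extractAux_fst]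

/-- The map `x₁[1] ⋯ xᵣ[1] ↦ ∑ᵢ ± φ(xᵢ, x₁[1] ⋯ (omit xᵢ[1]) ⋯ xᵣ[1])`. -/
def contract {N : Type*} [AddCommGroup N] [Module k N] :
    (L →ₗ[k] g.S →ₗ[k] N) →ₗ[k] (g.S →ₗ[k] N) :=
  LinearMap.lcomp k N g.extract ∘ₗ TensorProduct.uncurry (.id k) L g.S N

theorem contract_apply {N : Type*} [AddCommGroup N] [Module k N] (φ : L →ₗ[k] g.S →ₗ[k] N)
    (a : g.S) : g.contract φ a = TensorProduct.lift φ (g.extract a) := rfl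

/-- The codifferential `d₁` of `S(g[1])`: the coderivation induced by the map `x[1] ↦ -(dx)[1]`,
`d₁ (x₁[1] ⋯ xᵣ[1]) = - ∑ᵢ ± (dxᵢ)[1] x₁[1] ⋯ (omit xᵢ[1]) ⋯ xᵣ[1]`. -/
def dS₁ : g.S →ₗ[k] g.S := -g.contract (LinearMap.mul k g.S ∘ₗ g.ιS ∘ₗ g.d)

/-- The operator
`x₁[1] ⋯ xᵣ[1] ↦ ∑ᵢ ± (-1)^|x| [x, xᵢ][1] x₁[1] ⋯ (omit xᵢ[1]) ⋯ xᵣ[1]` on `S(g[1])`. -/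
def adS : L →ₗ[k] g.S →ₗ[k] g.S where
  toFun x := g.contract (LinearMap.mul k g.S ∘ₗ g.ιS ∘ₗ g.bracket (g.parity x))
  map_add' x y := by simp [LinearMap.comp_add]
  map_smul' c x := by simp [LinearMap.comp_smul]

/-- The codifferential `d₂` of `S(g[1])`: the coderivation induced by the map
`x[1] y[1] ↦ (-1)^|x| [x, y][1]`, so that `d₂ (x₁[1] ⋯ xᵣ[1])` is the sum over `i < j` of
`± (-1)^|xᵢ| [xᵢ, xⱼ][1] x₁[1] ⋯ (omit xᵢ[1], xⱼ[1]) ⋯ xᵣ[1]`; the contraction with `adS` is the sum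
over all `i ≠ j` and counts each pair twice. -/
def dS₂ : g.S →ₗ[k] g.S := (2⁻¹ : k) • g.contract g.adS

/-- The codifferential `d₁ + d₂` of `CE_•(g)`. -/
def dS : g.S →ₗ[k] g.S := g.dS₁ + g.dS₂

/-! ### The Chevalley-Eilenberg complex with coefficients in `U(g)` -/

/-- All linear maps `CE_•(g) → U(g)`. -/
abbrev Hom : Type (max u v) := g.S →ₗ[k] g.U

/-- The graded component of degree `n` of `CE^•(g, U(g)) = Hom(CE_•(g), U(g))`, i.e. of
`Ŝ(g^*[-1]) ⊗̂ U(g)`: the linear maps `CE_•(g) → U(g)` of degree `n`. -/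
def cochains (n : ℤ) : Submodule k g.Hom where
  carrier := {f | ∀ (i : ℤ) (a : g.S), a ∈ g.degS i → f a ∈ g.degU (i + n)}
  zero_mem' := fun _ _ _ => zero_mem _
  add_mem' := fun hf hf' i a ha => add_mem (hf i a ha) (hf' i a ha)
  smul_mem' := fun c _ hf i a ha => Submodule.smul_mem _ c (hf i a ha)

/-- The term of the differential of a cochain `f` of degree `n` that involves the action of `g` on
`U(g)` by left multiplication:
`x₁[1] ⋯ xᵣ[1] ↦ ∑ᵢ ± (-1)^(n(|xᵢ| - 1)) xᵢ f(x₁[1] ⋯ (omit xᵢ[1]) ⋯ xᵣ[1])`. -/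
def twist (n : ℤ) : g.Hom →ₗ[k] g.Hom where
  toFun f := g.contract ((LinearMap.mul k g.U ∘ₗ g.ιU ∘ₗ g.shiftSign n).compl₂ f)
  map_add' f f' := by
    rw [← map_add]; congr 1; ext; simp [mul_add]
  map_smul' c f := by
    rw [RingHom.id_apply, ← map_smul]; congr 1; ext; simp

/-- The differential `f ↦ d_U ∘ f - (-1)^n f ∘ d_CE + τ * f` on cochains `f` of degree `n`, where
`τ * f` is the convolution product with the twisting cochain `τ : x[1] ↦ x`. -/
def dCE (n : ℤ) : g.Hom →ₗ[k] g.Hom :=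
  LinearMap.compRight k g.dU - n.negOnePow • LinearMap.lcomp k g.U g.dS + g.twist n

/-! ### The differential squares to zero -/

theorem dCE_apply (n : ℤ) (f : g.Hom) (a : g.S) :
    g.dCE n f a = g.dU (f a) - n.negOnePow • f (g.dS a) + g.twist n f a := by
  simp only [dCE, LinearMap.add_apply, LinearMap.sub_apply, LinearMap.smul_apply]
  rfl

theorem contract_one {N : Type*} [AddCommGroup N] [Module k N] (φ : L →ₗ[k] g.S →ₗ[k] N) :
    g.contract φ 1 = 0 := by simp [contract_apply, extract_one]

theorem contract_mul {N : Type*} [AddCommGroup N] [Module k N] (φ : L →ₗ[k] g.S →ₗ[k] N)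
    (x : L) (a : g.S) :
    g.contract φ (g.ιS x * a) =
      φ x a + (TensorProduct.lift φ ∘ₗ g.swapMul x) (g.extract a) := by
  simp [contract_apply, extract_mul]

theorem adS_apply (x : L) (a : g.S) :
    g.adS x a = TensorProduct.lift
      (LinearMap.mul k g.S ∘ₗ g.ιS ∘ₗ g.bracket (g.parity x)) (g.extract a) := rfl

theorem adS_one (x : L) : g.adS x 1 = 0 := g.contract_one _

theorem dS_one : g.dS 1 = 0 := by simp [dS, dS₁, dS₂, contract_one]

theorem twist_one (n : ℤ) (f : g.Hom) : g.twist n f 1 = 0 := g.contract_one _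

theorem adS_mul {i j : ℤ} {x y : L} (hx : x ∈ g.deg i) (hy : y ∈ g.deg j) (a : g.S) :
    g.adS x (g.ιS y * a) = i.negOnePow • (g.ιS (g.bracket x y) * a) +
      (i * (j - 1)).negOnePow • (g.ιS y * g.adS x a) := by
  refine (g.contract_mul _ y a).trans ?_
  have key : TensorProduct.lift (LinearMap.mul k g.S ∘ₗ g.ιS ∘ₗ g.bracket (g.parity x)) ∘ₗ
      g.swapMul y = (i * (j - 1)).negOnePow • (LinearMap.mulLeft k (g.ιS y) ∘ₗ
        TensorProduct.lift (LinearMap.mul k g.S ∘ₗ g.ιS ∘ₗ g.bracket (g.parity x))) := by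
    refine g.tensor_ext fun l z hz b => ?_
    have h := congrArg (· * b) (g.ιS_comm (g.bracket_mem hx hz) hy)
    rcases negOnePow_cases i with ⟨hi, ei⟩ | ⟨hi, ei⟩ <;>
      rcases negOnePow_cases j with ⟨hj, ej⟩ | ⟨hj, ej⟩ <;>
      rcases negOnePow_cases l with ⟨hl, el⟩ | ⟨hl, el⟩ <;>
      simp [swapMul_tmul _ hy, g.shiftSign_apply _ hz, g.parity_apply hx, Units.smul_def,
        negOnePow_mul, Int.negOnePow_add, Int.negOnePow_sub, Int.odd_sub, Int.odd_add,
        Int.even_sub, Int.even_add, hi, ei, hj,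
        ej, hl, el, mul_assoc] at h ⊢ <;>
      try simp [h]
  rw [key]
  simp only [g.parity_apply hx, Units.smul_def, LinearMap.comp_apply, LinearMap.smul_apply,
    map_zsmul, LinearMap.mul_apply', LinearMap.mulLeft_apply, smul_mul_assoc]
  rw [adS_apply, g.parity_apply hx, Units.smul_def, map_zsmul]

theorem dS₁_mul {i : ℤ} {x : L} (hx : x ∈ g.deg i) (a : g.S) :
    g.dS₁ (g.ιS x * a) = -(g.ιS (g.d x) * a) + (i - 1).negOnePow • (g.ιS x * g.dS₁ a) := by
  have key : TensorProduct.lift (LinearMap.mul k g.S ∘ₗ g.ιS ∘ₗ g.d) ∘ₗ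
      g.swapMul x = (i - 1).negOnePow • (LinearMap.mulLeft k (g.ιS x) ∘ₗ
        TensorProduct.lift (LinearMap.mul k g.S ∘ₗ g.ιS ∘ₗ g.d)) := by
    refine g.tensor_ext fun l z hz b => ?_
    have h := congrArg (· * b) (g.ιS_comm (g.d_mem hz) hx)
    rcases negOnePow_cases i with ⟨hi, ei⟩ | ⟨hi, ei⟩ <;>
      rcases negOnePow_cases l with ⟨hl, el⟩ | ⟨hl, el⟩ <;>
      simp [swapMul_tmul _ hx, g.shiftSign_apply _ hz, Units.smul_def,
        negOnePow_mul, Int.negOnePow_add, Int.negOnePow_sub, Int.odd_sub, Int.odd_add,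
        Int.even_sub, Int.even_add, hi, ei,
        hl, el, mul_assoc] at h ⊢ <;>
      try simp [h]
  rw [dS₁, LinearMap.neg_apply, contract_mul, key]
  simp [Units.smul_def, contract_apply]
  abel

theorem dS₂_mul [CharZero k] {i : ℤ} {x : L} (hx : x ∈ g.deg i) (a : g.S) :
    g.dS₂ (g.ιS x * a) = g.adS x a + (i - 1).negOnePow • (g.ιS x * g.dS₂ a) := by
  have key : TensorProduct.lift g.adS ∘ₗ g.swapMul x =
      TensorProduct.lift (LinearMap.mul k g.S ∘ₗ g.ιS ∘ₗ g.bracket (g.parity x)) +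
        (i - 1).negOnePow • (LinearMap.mulLeft k (g.ιS x) ∘ₗ TensorProduct.lift g.adS) := by
    refine g.tensor_ext fun l z hz b => ?_
    have h := congrArg g.ιS (g.bracket_skew hx hz)
    rcases negOnePow_cases i with ⟨hi, ei⟩ | ⟨hi, ei⟩ <;>
      rcases negOnePow_cases l with ⟨hl, el⟩ | ⟨hl, el⟩ <;>
      simp [swapMul_tmul _ hx, g.shiftSign_apply _ hz, g.parity_apply hx, g.adS_mul hz hx,
        Units.smul_def, negOnePow_mul, Int.negOnePow_add, Int.negOnePow_sub, Int.odd_sub,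
        Int.odd_add, hi, ei, hl, el] at h ⊢ <;>
      first
        | (simp [h]; done)
        | (simp [h]; abel)
  have h2 : (2⁻¹ : k) • (g.adS x a + g.adS x a) = g.adS x a := by
    rw [← two_smul k, smul_smul, inv_mul_cancel₀ two_ne_zero, one_smul]
  rw [dS₂, LinearMap.smul_apply, contract_mul, key]
  simp only [LinearMap.add_apply, ← contract_apply]
  change (2⁻¹ : k) • (g.adS x a + (g.adS x a + _)) = _
  rw [← add_assoc, smul_add, h2]
  simp [Units.smul_def, contract_apply]

theorem dS_mul [CharZero k] {i : ℤ} {x : L} (hx : x ∈ g.deg i) (a : g.S) :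
    g.dS (g.ιS x * a) =
      -(g.ιS (g.d x) * a) + g.adS x a + (i - 1).negOnePow • (g.ιS x * g.dS a) := by
  simp only [dS, LinearMap.add_apply, g.dS₁_mul hx, g.dS₂_mul hx, mul_add, smul_add]
  abel

theorem adS_bracket {i j : ℤ} {x y : L} (hx : x ∈ g.deg i) (hy : y ∈ g.deg j) (a : g.S) :
    g.adS x (g.adS y a) =
      g.adS (g.bracket x y) a + (i * j).negOnePow • g.adS y (g.adS x a) := by
  induction a using g.S_induction with
  | h1 => simp [adS_one, Units.smul_def]
  | hadd a b ha hb => simp only [map_add, ha, hb, smul_add]; abel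
  | hsmul c a ha => simp only [map_smul, ha, smul_add, Units.smul_def, smul_comm c]
  | hmul l z hz a ha =>
    have h := congrArg (fun w => g.ιS w * a) (g.jacobi hx hy hz)
    have h' := congrArg (fun w => g.ιS z * w) ha
    rcases negOnePow_cases i with ⟨hi, ei⟩ | ⟨hi, ei⟩ <;>
      rcases negOnePow_cases j with ⟨hj, ej⟩ | ⟨hj, ej⟩ <;>
      rcases negOnePow_cases l with ⟨hl, el⟩ | ⟨hl, el⟩ <;>
      simp [g.adS_mul hx hz, g.adS_mul hy hz, g.adS_mul hx (g.bracket_mem hy hz),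
        g.adS_mul hy (g.bracket_mem hx hz), g.adS_mul (g.bracket_mem hx hy) hz,
        Units.smul_def, negOnePow_mul, Int.negOnePow_add, Int.negOnePow_sub, Int.odd_sub,
        Int.odd_add, hi, ei, hj, ej, hl, el, mul_add, add_mul] at h h' ⊢ <;>
      simp only [h, h'] <;> abel

/-- The operator `f ↦ f(x[1] · -)` on cochains. -/
def ins : L →ₗ[k] g.Hom →ₗ[k] g.Hom :=
  LinearMap.mk₂ k (fun x f => f ∘ₗ LinearMap.mulLeft k (g.ιS x))
    (by intro x y f; ext; simp [add_mul])
    (by intro c x f; ext; simp)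
    (by intro x f f'; ext; simp)
    (by intro c x f; ext; simp)

theorem ins_apply (x : L) (f : g.Hom) (a : g.S) : g.ins x f a = f (g.ιS x * a) := rfl

/-- The Lie derivative along `x`, of degree `i`, of cochains of degree `n`. -/
def lieD (i n : ℤ) (x : L) : g.Hom →ₗ[k] g.Hom :=
  (n * (i - 1)).negOnePow • LinearMap.compRight k (LinearMap.mulLeft k (g.ιU x)) -
    n.negOnePow • LinearMap.lcomp k g.U (g.adS x)

theorem lieD_apply (i n : ℤ) (x : L) (f : g.Hom) (a : g.S) :
    g.lieD i n x f a =
      (n * (i - 1)).negOnePow • (g.ιU x * f a) - n.negOnePow • f (g.adS x a) := rfl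

theorem ins_dCE [CharZero k] {i : ℤ} {x : L} (hx : x ∈ g.deg i) (n : ℤ) (f : g.Hom) :
    g.ins x (g.dCE n f) = g.dCE (n + i - 1) (g.ins x f) + n.negOnePow • g.ins (g.d x) f +
      g.lieD i n x f := by
  have key : TensorProduct.lift ((LinearMap.mul k g.U ∘ₗ g.ιU ∘ₗ g.shiftSign n).compl₂ f) ∘ₗ
      g.swapMul x = TensorProduct.lift
        ((LinearMap.mul k g.U ∘ₗ g.ιU ∘ₗ g.shiftSign (n + i - 1)).compl₂ (g.ins x f)) := by
    refine g.tensor_ext fun l z hz b => ?_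
    rcases negOnePow_cases i with ⟨hi, ei⟩ | ⟨hi, ei⟩ <;>
      rcases negOnePow_cases l with ⟨hl, el⟩ | ⟨hl, el⟩ <;>
      rcases negOnePow_cases n with ⟨hn, en⟩ | ⟨hn, en⟩ <;>
      simp [swapMul_tmul _ hx, g.shiftSign_apply _ hz, ins_apply, Units.smul_def,
        negOnePow_mul, Int.negOnePow_add, Int.negOnePow_sub, Int.odd_sub, Int.odd_add,
        Int.even_sub, Int.even_add, hi, ei, hl, el, hn, en]
  have key' : ∀ a, g.twist n f (g.ιS x * a) =
      (n * (i - 1)).negOnePow • (g.ιU x * f a) + g.twist (n + i - 1) (g.ins x f) a := by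
    intro a
    refine (g.contract_mul _ x a).trans ?_
    rw [key]
    simp [g.shiftSign_apply _ hx, Units.smul_def, mul_assoc]
    rfl
  refine LinearMap.ext fun a => ?_
  simp only [ins_apply, dCE_apply, LinearMap.add_apply, LinearMap.smul_apply, lieD_apply, key',
    g.dS_mul hx, map_add, map_neg, smul_add, smul_neg, Units.smul_def, map_zsmul,
    Int.negOnePow_add, Int.negOnePow_sub, Units.val_mul, mul_smul]
  abel

theorem ins_lieD {i j : ℤ} {x y : L} (hx : x ∈ g.deg i) (hy : y ∈ g.deg j) (n : ℤ) (f : g.Hom) :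
    g.ins y (g.lieD i n x f) = ((i - 1) * (j - 1)).negOnePow • g.lieD i (n + j - 1) x (g.ins y f) -
      (n + i).negOnePow • g.ins (g.bracket x y) f := by
  refine LinearMap.ext fun a => ?_
  rcases negOnePow_cases i with ⟨hi, ei⟩ | ⟨hi, ei⟩ <;>
    rcases negOnePow_cases j with ⟨hj, ej⟩ | ⟨hj, ej⟩ <;>
    rcases negOnePow_cases n with ⟨hn, en⟩ | ⟨hn, en⟩ <;>
    simp [ins_apply, lieD_apply, g.adS_mul hx hy, Units.smul_def, negOnePow_mul,
      Int.negOnePow_add, Int.negOnePow_sub, Int.odd_sub, Int.odd_add, Int.even_sub, Int.even_add,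
      hi, ei, hj, ej, hn, en] <;>
    abel

theorem lieD_lieD {i j : ℤ} {x y : L} (hx : x ∈ g.deg i) (hy : y ∈ g.deg j) (n : ℤ) (f : g.Hom) :
    g.lieD j (n + i) y (g.lieD i n x f) =
      (i + j + i * j).negOnePow • g.lieD i (n + j) x (g.lieD j n y f) -
        (n + i).negOnePow • g.lieD (i + j) n (g.bracket x y) f := by
  refine LinearMap.ext fun a => ?_
  have h := congrArg (· * f a) (g.ιU_comm hx hy)
  have h' := congrArg f (g.adS_bracket hx hy a)
  rcases negOnePow_cases i with ⟨hi, ei⟩ | ⟨hi, ei⟩ <;>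
    rcases negOnePow_cases j with ⟨hj, ej⟩ | ⟨hj, ej⟩ <;>
    rcases negOnePow_cases n with ⟨hn, en⟩ | ⟨hn, en⟩ <;>
    simp [lieD_apply, Units.smul_def, negOnePow_mul, Int.negOnePow_add, Int.negOnePow_sub,
      Int.odd_sub, Int.odd_add, Int.even_sub, Int.even_add, hi, ei, hj, ej, hn, en, mul_sub,
      mul_add, add_mul, mul_assoc] at h h' ⊢ <;>
    simp only [h, h'] <;> abel

theorem dCE_lieD [CharZero k] {i : ℤ} {x : L} (hx : x ∈ g.deg i) (n : ℤ) (f : g.Hom) (a : g.S) :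
    g.dCE (n + i) (g.lieD i n x f) a + g.lieD i (n + 1) x (g.dCE n f) a =
      n.negOnePow • g.lieD (i + 1) n (g.d x) f a := by
  induction a using g.S_induction generalizing n f with
  | h1 =>
    rcases negOnePow_cases i with ⟨hi, ei⟩ | ⟨hi, ei⟩ <;>
      rcases negOnePow_cases n with ⟨hn, en⟩ | ⟨hn, en⟩ <;>
      simp [dCE_apply, lieD_apply, dS_one, twist_one, adS_one, Units.smul_def, dU_mul,
        g.parity_apply hx, negOnePow_mul, Int.negOnePow_add, Int.negOnePow_sub, Int.odd_sub,
        Int.odd_add, Int.even_sub, Int.even_add, hi, ei, hn, en]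
  | hadd a b ha hb =>
    have h1 := ha n f
    have h2 := hb n f
    simp only [map_add, smul_add, ← h1, ← h2]
    abel
  | hsmul c a ha =>
    have h1 := ha n f
    simp only [map_smul, ← smul_add, h1, Units.smul_def, smul_comm c]
  | hmul j y hy a ha =>
    have i1 : n + i + j - 1 = n + j - 1 + i := by ring
    have i2 : n + 1 + j - 1 = n + j - 1 + 1 := by ring
    have i3 : n + (j + 1) - 1 = n + j - 1 + 1 := by ring
    have i4 : n + j = n + j - 1 + 1 := by ring
    have i5 : n + (i + j) - 1 = n + j - 1 + i := by ring
    have ih := ha (n + j - 1) (g.ins y f)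
    have e1 := LinearMap.congr_fun (g.ins_dCE hy (n + i) (g.lieD i n x f)) a
    have e2 := LinearMap.congr_fun (g.ins_lieD hx hy (n + 1) (g.dCE n f)) a
    have e3 := LinearMap.congr_fun (g.ins_lieD (g.d_mem hx) hy n f) a
    have e4 := LinearMap.congr_fun (g.lieD_lieD hx hy n f) a
    have e6 := LinearMap.congr_fun (g.ins_dCE (g.bracket_mem hx hy) n f) a
    have e7 := congrArg (fun w => g.ins w f a) (g.leibniz hx hy)
    rw [g.ins_lieD hx hy, g.ins_lieD hx (g.d_mem hy), i1, i3] at e1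
    rw [g.ins_dCE hy, i2] at e2
    rw [i4] at e4
    rw [i5] at e6
    have em : (n + j - 1).negOnePow = -(n.negOnePow * j.negOnePow) := by
      simp [Int.negOnePow_sub, Int.negOnePow_add]
    generalize n + j - 1 = m at *
    simp only [← ins_apply]
    rcases negOnePow_cases i with ⟨hi, ei⟩ | ⟨hi, ei⟩ <;>
      rcases negOnePow_cases j with ⟨hj, ej⟩ | ⟨hj, ej⟩ <;>
      rcases negOnePow_cases n with ⟨hn, en⟩ | ⟨hn, en⟩ <;>
      simp [Units.smul_def, negOnePow_mul, Int.negOnePow_add, Int.negOnePow_sub, Int.odd_sub,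
        Int.odd_add, Int.even_sub, Int.even_add, hi, ei, hj, ej, hn, en, em]
        at ih e1 e2 e3 e4 e6 e7 ⊢ <;>
      simp only [e1, e2, e3, e4, e6, e7, eq_sub_of_add_eq ih] <;> abel

theorem dCE_dCE_apply [CharZero k] (n : ℤ) (f : g.Hom) (a : g.S) :
    g.dCE (n + 1) (g.dCE n f) a = 0 := by
  induction a using g.S_induction generalizing n f with
  | h1 => simp [dCE_apply, dS_one, twist_one, dU_dU]
  | hadd a b ha hb => rw [map_add, ha, hb, add_zero]
  | hsmul c a ha => rw [map_smul, ha, smul_zero]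
  | hmul i x hx a ha =>
    have i1 : n + 1 + i - 1 = n + i - 1 + 1 := by ring
    have i2 : n + (i + 1) - 1 = n + i := by ring
    have i3 : n + i - 1 + 1 = n + i := by ring
    have ih := ha (n + i - 1) (g.ins x f)
    have e1 := LinearMap.congr_fun (g.ins_dCE hx (n + 1) (g.dCE n f)) a
    have e2 := LinearMap.congr_fun (g.ins_dCE (g.d_mem hx) n f) a
    have e3 := g.dCE_lieD hx n f a
    rw [i1] at e1
    rw [i2] at e2
    rw [i3] at e1 ih
    rw [← ins_apply, e1, g.ins_dCE hx]
    simp only [map_add, LinearMap.add_apply, LinearMap.smul_apply, Units.smul_def, map_zsmul, ih,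
      e2, eq_sub_of_add_eq e3, smul_add, Int.negOnePow_succ, Units.val_neg, neg_smul, g.d_d,
      map_zero, LinearMap.zero_apply, LinearMap.neg_apply, smul_zero]
    abel

theorem dCE_dCE [CharZero k] (n : ℤ) (f : g.Hom) : g.dCE (n + 1) (g.dCE n f) = 0 :=
  LinearMap.ext (g.dCE_dCE_apply n f)

/-! ### The differential has degree one -/

theorem degU_induction {P : ℤ → g.U → Prop} (h0 : ∀ n, P n 0) (h1 : P 0 1)
    (hadd : ∀ n a b, P n a → P n b → P n (a + b)) (hsmul : ∀ n (c : k) a, P n a → P n (c • a))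
    (hmul : ∀ i n x a, x ∈ g.deg i → P n a → P (i + n) (g.ιU x * a))
    {n : ℤ} {a : g.U} (ha : a ∈ g.degU n) : P n a := by
  induction ha using Submodule.span_induction with
  | mem a ha =>
    obtain ⟨l, hl, rfl, rfl⟩ := ha
    induction l with
    | nil => simpa using h1
    | cons p l ih =>
      simp only [List.map_cons, List.sum_cons, List.prod_cons]
      exact hmul _ _ _ _ (hl p (by simp)) (ih fun q hq => hl q (by simp [hq]))
  | zero => exact h0 n
  | add a b _ _ ha hb => exact hadd _ _ _ ha hb
  | smul c a _ ha => exact hsmul _ _ _ ha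

theorem degS_induction {P : ℤ → g.S → Prop} (h0 : ∀ n, P n 0) (h1 : P 0 1)
    (hadd : ∀ n a b, P n a → P n b → P n (a + b)) (hsmul : ∀ n (c : k) a, P n a → P n (c • a))
    (hmul : ∀ i n x a, x ∈ g.deg i → P n a → P (i - 1 + n) (g.ιS x * a))
    {n : ℤ} {a : g.S} (ha : a ∈ g.degS n) : P n a := by
  induction ha using Submodule.span_induction with
  | mem a ha =>
    obtain ⟨l, hl, rfl, rfl⟩ := ha
    induction l with
    | nil => simpa using h1
    | cons p l ih =>
      simp only [List.map_cons, List.sum_cons, List.prod_cons]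
      exact hmul _ _ _ _ (hl p (by simp)) (ih fun q hq => hl q (by simp [hq]))
  | zero => exact h0 n
  | add a b _ _ ha hb => exact hadd _ _ _ ha hb
  | smul c a _ ha => exact hsmul _ _ _ ha

theorem ιU_mul_mem {i n : ℤ} {x : L} {a : g.U} (hx : x ∈ g.deg i) (ha : a ∈ g.degU n) :
    g.ιU x * a ∈ g.degU (i + n) := by
  induction ha using Submodule.span_induction with
  | mem a ha =>
    obtain ⟨l, hl, rfl, rfl⟩ := ha
    refine Submodule.subset_span ⟨(i, x) :: l, ?_, by simp, by simp⟩
    simpa [hx] using hl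
  | zero => simp
  | add a b _ _ ha hb => rw [mul_add]; exact add_mem ha hb
  | smul c a _ ha => rw [mul_smul_comm]; exact Submodule.smul_mem _ c ha

theorem ιS_mul_mem {i n : ℤ} {x : L} {a : g.S} (hx : x ∈ g.deg i) (ha : a ∈ g.degS n) :
    g.ιS x * a ∈ g.degS (i - 1 + n) := by
  induction ha using Submodule.span_induction with
  | mem a ha =>
    obtain ⟨l, hl, rfl, rfl⟩ := ha
    refine Submodule.subset_span ⟨(i, x) :: l, ?_, by simp, by simp⟩
    simpa [hx] using hl
  | zero => simp
  | add a b _ _ ha hb => rw [mul_add]; exact add_mem ha hb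
  | smul c a _ ha => rw [mul_smul_comm]; exact Submodule.smul_mem _ c ha

theorem dU_mem {n : ℤ} {a : g.U} (ha : a ∈ g.degU n) : g.dU a ∈ g.degU (n + 1) := by
  refine g.degU_induction (P := fun n a => a ∈ g.degU n ∧ g.dU a ∈ g.degU (n + 1))
    ?_ ?_ ?_ ?_ ?_ ha |>.2
  · simp
  · exact ⟨Submodule.subset_span ⟨[], by simp⟩, by simp [dU_one]⟩
  · intro n a b ha hb
    rw [map_add]
    exact ⟨add_mem ha.1 hb.1, add_mem ha.2 hb.2⟩
  · intro n c a ha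
    rw [map_smul]
    exact ⟨Submodule.smul_mem _ _ ha.1, Submodule.smul_mem _ _ ha.2⟩
  · intro i n x a hx ha
    have h1 := g.ιU_mul_mem (g.d_mem hx) ha.1
    have h2 := g.ιU_mul_mem hx ha.2
    rw [show i + 1 + n = i + n + 1 by ring] at h1
    rw [← add_assoc] at h2
    refine ⟨g.ιU_mul_mem hx ha.1, ?_⟩
    rw [dU_mul, g.parity_apply hx, Units.smul_def, map_zsmul, smul_mul_assoc]
    exact add_mem h1 (zsmul_mem h2 _)

theorem adS_mem {i n : ℤ} {x : L} {a : g.S} (hx : x ∈ g.deg i) (ha : a ∈ g.degS n) :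
    g.adS x a ∈ g.degS (n + i) := by
  refine g.degS_induction (P := fun n a => a ∈ g.degS n ∧ g.adS x a ∈ g.degS (n + i))
    ?_ ?_ ?_ ?_ ?_ ha |>.2
  · simp
  · exact ⟨Submodule.subset_span ⟨[], by simp⟩, by simp [adS_one]⟩
  · intro n a b ha hb
    rw [map_add]
    exact ⟨add_mem ha.1 hb.1, add_mem ha.2 hb.2⟩
  · intro n c a ha
    rw [map_smul]
    exact ⟨Submodule.smul_mem _ _ ha.1, Submodule.smul_mem _ _ ha.2⟩
  · intro j n y a hy ha
    have h1 := g.ιS_mul_mem (g.bracket_mem hx hy) ha.1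
    have h2 := g.ιS_mul_mem hy ha.2
    rw [show i + j - 1 + n = j - 1 + n + i by ring] at h1
    rw [← add_assoc] at h2
    refine ⟨g.ιS_mul_mem hy ha.1, ?_⟩
    rw [g.adS_mul hx hy, Units.smul_def, Units.smul_def]
    exact add_mem (zsmul_mem h1 _) (zsmul_mem h2 _)

theorem ins_mem {i n : ℤ} {x : L} {f : g.Hom} (hx : x ∈ g.deg i) (hf : f ∈ g.cochains n) :
    g.ins x f ∈ g.cochains (n + i - 1) := by
  intro j a ha
  have := hf _ _ (g.ιS_mul_mem hx ha)
  rwa [show i - 1 + j + n = j + (n + i - 1) by ring] at this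

theorem lieD_mem {i n : ℤ} {x : L} {f : g.Hom} (hx : x ∈ g.deg i) (hf : f ∈ g.cochains n) :
    g.lieD i n x f ∈ g.cochains (n + i) := by
  intro j a ha
  have h1 := g.ιU_mul_mem hx (hf _ _ ha)
  have h2 := hf _ _ (g.adS_mem hx ha)
  rw [show i + (j + n) = j + (n + i) by ring] at h1
  rw [show j + i + n = j + (n + i) by ring] at h2
  rw [lieD_apply, Units.smul_def, Units.smul_def]
  exact sub_mem (zsmul_mem h1 _) (zsmul_mem h2 _)

theorem dCE_mem [CharZero k] {n : ℤ} {f : g.Hom} (hf : f ∈ g.cochains n) :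
    g.dCE n f ∈ g.cochains (n + 1) := by
  intro i a ha
  refine g.degS_induction (P := fun i a => a ∈ g.degS i ∧ ∀ (n : ℤ) (f : g.Hom),
    f ∈ g.cochains n → g.dCE n f a ∈ g.degU (i + (n + 1))) ?_ ?_ ?_ ?_ ?_ ha |>.2 n f hf
  · simp
  · have h : (1 : g.S) ∈ g.degS 0 := Submodule.subset_span ⟨[], by simp⟩
    refine ⟨h, fun n f hf => ?_⟩
    have := g.dU_mem (hf _ _ h)
    simpa [dCE_apply, dS_one, twist_one] using this
  · intro i a b ha hb
    refine ⟨add_mem ha.1 hb.1, fun n f hf => ?_⟩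
    rw [map_add]
    exact add_mem (ha.2 n f hf) (hb.2 n f hf)
  · intro i c a ha
    refine ⟨Submodule.smul_mem _ _ ha.1, fun n f hf => ?_⟩
    rw [map_smul]
    exact Submodule.smul_mem _ _ (ha.2 n f hf)
  · intro i j x a hx ha
    refine ⟨g.ιS_mul_mem hx ha.1, fun n f hf => ?_⟩
    have h1 := ha.2 _ _ (g.ins_mem hx hf)
    have h2 := g.ins_mem (g.d_mem hx) hf _ _ ha.1
    have h3 := g.lieD_mem hx hf _ _ ha.1
    rw [show j + (n + i - 1 + 1) = i - 1 + j + (n + 1) by ring] at h1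
    rw [show j + (n + (i + 1) - 1) = i - 1 + j + (n + 1) by ring] at h2
    rw [show j + (n + i) = i - 1 + j + (n + 1) by ring] at h3
    rw [← ins_apply, g.ins_dCE hx, LinearMap.add_apply, LinearMap.add_apply, Units.smul_def]
    exact add_mem (add_mem h1 (zsmul_mem h2 _)) h3

/-- The cocycles of degree `n` of `CE^•(g, U(g))`. -/
def cocyclesCE (n : ℤ) : Submodule k g.Hom := g.cochains n ⊓ LinearMap.ker (g.dCE n)

/-- The coboundaries of degree `n` of `CE^•(g, U(g))`. -/
def coboundariesCE (n : ℤ) : Submodule k g.Hom := (g.cochains (n - 1)).map (g.dCE (n - 1))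

theorem coboundariesCE_le_cocyclesCE [CharZero k] (n : ℤ) :
    g.coboundariesCE n ≤ g.cocyclesCE n := by
  rintro _ ⟨f, hf, rfl⟩
  have h1 := g.dCE_mem hf
  have h2 := g.dCE_dCE (n - 1) f
  rw [sub_add_cancel] at h1 h2
  exact ⟨h1, h2⟩

/-- The cohomology `H^n(CE^•(g, U(g)))`. -/
abbrev HCE (n : ℤ) : Type (max u v) :=
  g.cocyclesCE n ⧸ (g.coboundariesCE n).submoduleOf (g.cocyclesCE n)

end DGLieAlgebra
end

set_option linter.unusedSectionVars false
set_option linter.unusedSimpArgs false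

/-! By the Poincaré–Birkhoff–Witt theorem, symmetrization (`symmEquiv`) turns cochains with values
in U(g) into linear maps S(g[1]) → S(g). The transported differential is `dX = dLin + dUp`. The part
`dLin` comes from the differential of g and preserves the weight, i.e. the number of arguments;
`dUp` raises it by one. When S(g) is filtered by the number of factors, the leading term of `dUp` is
the Koszul differential `kap`, convolution with x[1] ↦ x for the commutative product. The
noncommutativity of U(g) and the bracket in `dS₂` contribute only terms that do not raise the
filtration of the values (`dUp_sub_kap_mem`).

Fix a deformation retraction of g onto the span H of finitely many cocycles `e j` representing a
basis of the cohomology (`exists_retract`). It induces a homotopy `hX` that contracts `dLin` onto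
the maps S(H[1]) → S(H), the image of `PX` (`dLin_hX`). On these, the contraction `tX` with the dual
bases satisfies the Koszul homotopy formula `tX_kap`: the anticommutator of `tX` and `kap` is the
number operator `nX`, which counts bosonic factors and missing fermionic factors, in the argument
and in the value. Its eigenvalues are natural numbers, and the eigenvalue 0 occurs only on the line
of `wX`, which sends the product of all fermionic generators of S(H[1]) to the product of all
fermionic generators of S(H). The former come from the even classes and the latter from the odd
ones, so `wX` has degree |g|.

Gauge fixing replaces a spectral sequence. Call x gauge-fixed if `hX x = 0` and `tX (PX x) = 0`.
Every cochain becomes gauge-fixed after subtracting a coboundary (`exists_correction`). If x and its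
differential are both gauge-fixed and the coefficient `psi x` of the top form vanishes, then x = 0
(`eq_zero_of_hX_tX`). Since `psi` vanishes outside degree |g|, the cohomology follows formally.

Convergence has two sources. A cochain is an arbitrary family of weight components, so equations may
be solved weight by weight. A component of fixed weight that lives on H is determined by its values
on finitely many words, so its values have bounded filtration and the corrections to `kap` are
removed by a finite induction. This is where properness enters. -/

noncomputable section

/-! ### Diagonalizable operators with natural eigenvalues: functional calculus, filtration, fixed
points -/

namespace Module.End

variable {k V V' N : Type*} [Field k] [CharZero k] [AddCommGroup V] [Module k V]
  [AddCommGroup V'] [Module k V'] [AddCommGroup N] [Module k N]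

/-- `E` is diagonalizable, with eigenvalues in `ℕ`. -/
def IsNatDiag (E : Module.End k V) : Prop := ⨆ n : ℕ, E.eigenspace (n : k) = ⊤

namespace IsNatDiag

variable {E : Module.End k V} (hE : E.IsNatDiag) {E' : Module.End k V'} (hE' : E'.IsNatDiag)

include hE in
-- Eigenspaces of distinct eigenvalues are independent, and distinct natural numbers stay distinct
-- in `k` because the characteristic is zero.
theorem bijective_coe :
    Function.Bijective (DirectSum.coeLinearMap fun n : ℕ => E.eigenspace (n : k)) :=
  DirectSum.isInternal_submodule_of_iSupIndep_of_iSup_eq_top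
    (E.eigenspaces_iSupIndep.comp Nat.cast_injective) hE

include hE in
theorem induction {P : V → Prop} (h0 : P 0) (hadd : ∀ x y, P x → P y → P (x + y))
    (hh : ∀ (n : ℕ) (x : V), E x = (n : k) • x → P x) (x : V) : P x := by
  have hx : x ∈ ⨆ n : ℕ, E.eigenspace (n : k) := by rw [hE]; trivial
  induction hx using Submodule.iSup_induction' with
  | mem n x hx => exact hh n x (Module.End.mem_eigenspace_iff.1 hx)
  | zero => exact h0
  | add x y _ _ hx hy => exact hadd _ _ hx hy

include hE in
theorem hom_ext {F G : V →ₗ[k] N} (h : ∀ (n : ℕ) (x : V), E x = (n : k) • x → F x = G x) :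
    F = G :=
  LinearMap.ext fun x => hE.induction (P := fun x => F x = G x) (by simp)
    (fun x y hx hy => by rw [map_add, map_add, hx, hy]) h x

/-- The linear map that is `F n` on the eigenspace of `n`. -/
def lift (F : ℕ → V →ₗ[k] N) : V →ₗ[k] N :=
  (DirectSum.toModule k ℕ N fun n => F n ∘ₗ (E.eigenspace (n : k)).subtype) ∘ₗ
    (LinearEquiv.ofBijective (DirectSum.coeLinearMap _) hE.bijective_coe).symm.toLinearMap

theorem lift_apply (F : ℕ → V →ₗ[k] N) {n : ℕ} {x : V} (hx : E x = (n : k) • x) :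
    hE.lift F x = F n x := by
  have h : (LinearEquiv.ofBijective (DirectSum.coeLinearMap _) hE.bijective_coe).symm x =
      DirectSum.lof k ℕ (fun n => E.eigenspace (n : k)) n
        ⟨x, Module.End.mem_eigenspace_iff.2 hx⟩ := by
    rw [LinearEquiv.symm_apply_eq, LinearEquiv.ofBijective_apply, DirectSum.coeLinearMap_lof]
  simp [lift, h]

/-- The operator `c(E)`. -/
def fc (c : ℕ → k) : Module.End k V := hE.lift fun n => c n • LinearMap.id

theorem fc_apply (c : ℕ → k) {n : ℕ} {x : V} (hx : E x = (n : k) • x) :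
    hE.fc c x = c n • x := by
  simp [fc, hE.lift_apply _ hx]

/-- Used with `τ = id` for operators that commute with the gradings, and with `τ = (· + 1)` for
multiplication by a generator. -/
theorem fc_comm_shift (T : V →ₗ[k] V') {τ : ℕ → ℕ} {c c' : ℕ → k}
    (hT : ∀ (n : ℕ) (x : V), E x = (n : k) • x → T x ≠ 0 → E' (T x) = (τ n : k) • T x ∧ c' (τ n) = c n)
    (x : V) : hE'.fc c' (T x) = T (hE.fc c x) := by
  refine LinearMap.congr_fun (hE.hom_ext (F := hE'.fc c' ∘ₗ T) (G := T ∘ₗ hE.fc c)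
    fun n x hx => ?_) x
  by_cases h0 : T x = 0
  · simp [hE.fc_apply _ hx, h0]
  · obtain ⟨h1, h2⟩ := hT n x hx h0
    simp [hE.fc_apply _ hx, hE'.fc_apply _ h1, h2]

theorem fc_comm (T : V →ₗ[k] V') (hT : ∀ x, E' (T x) = T (E x)) (c : ℕ → k) (x : V) :
    hE'.fc c (T x) = T (hE.fc c x) :=
  hE.fc_comm_shift hE' T (τ := id) (fun n x hx _ => by simp [hT, hx]) x

theorem fc_self (c : ℕ → k) (x : V) : E (hE.fc c x) = hE.fc c (E x) :=
  (hE.fc_comm hE E (fun _ => rfl) c x).symm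

theorem fc_fc (c c' : ℕ → k) (x : V) : hE.fc c (hE.fc c' x) = hE.fc (fun n => c n * c' n) x := by
  refine LinearMap.congr_fun (hE.hom_ext (F := hE.fc c ∘ₗ hE.fc c')
    (G := hE.fc fun n => c n * c' n) fun n x hx => ?_) x
  simp [hE.fc_apply _ hx, mul_smul, smul_comm (c n)]

theorem fc_cast (x : V) : hE.fc (fun n => (n : k)) x = E x := by
  refine LinearMap.congr_fun (hE.hom_ext (F := hE.fc fun n => (n : k)) (G := E)
    fun n x hx => ?_) x
  simp [hE.fc_apply _ hx, hx]

theorem fc_add (c c' : ℕ → k) (x : V) :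
    hE.fc c x + hE.fc c' x = hE.fc (fun n => c n + c' n) x := by
  refine LinearMap.congr_fun (hE.hom_ext (F := hE.fc c + hE.fc c')
    (G := hE.fc fun n => c n + c' n) fun n x hx => ?_) x
  simp [hE.fc_apply _ hx, add_smul]

theorem fc_one (x : V) : hE.fc (fun _ => 1) x = x := by
  refine LinearMap.congr_fun (hE.hom_ext (F := hE.fc fun _ => 1) (G := LinearMap.id)
    fun n x hx => ?_) x
  simp [hE.fc_apply _ hx]

theorem fc_eq_zero {c : ℕ → k} (hc : ∀ n, c n = 0) (x : V) : hE.fc c x = 0 := by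
  refine LinearMap.congr_fun (hE.hom_ext (F := hE.fc c) (G := 0) fun n x hx => ?_) x
  simp [hE.fc_apply _ hx, hc]

/-- The projection onto the eigenspace of `n`. -/
def pr (n : ℕ) : Module.End k V := hE.fc fun m => if m = n then 1 else 0

theorem pr_self {n : ℕ} {x : V} (hx : E x = (n : k) • x) : hE.pr n x = x := by
  simp [pr, hE.fc_apply _ hx]

theorem pr_of_ne {m n : ℕ} (h : m ≠ n) {x : V} (hx : E x = (m : k) • x) : hE.pr n x = 0 := by
  simp [pr, hE.fc_apply _ hx, h]

theorem apply_pr (n : ℕ) (x : V) : E (hE.pr n x) = (n : k) • hE.pr n x := by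
  refine LinearMap.congr_fun (hE.hom_ext (F := E ∘ₗ hE.pr n) (G := (n : k) • hE.pr n)
    fun m x hx => ?_) x
  by_cases h : m = n
  · subst h; simp [hE.pr_self hx, hx]
  · simp [hE.pr_of_ne h hx]

theorem pr_pr (n : ℕ) (x : V) : hE.pr n (hE.pr n x) = hE.pr n x := hE.pr_self (hE.apply_pr n x)

include hE in
theorem hom_ext_pr {F G : V →ₗ[k] N} (h : ∀ n x, F (hE.pr n x) = G (hE.pr n x)) : F = G :=
  hE.hom_ext fun n x hx => by simpa only [hE.pr_self hx] using h n x

theorem lift_pr (F : ℕ → V →ₗ[k] N) (n : ℕ) (x : V) :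
    hE.lift F (hE.pr n x) = F n (hE.pr n x) := hE.lift_apply F (hE.apply_pr n x)

end IsNatDiag

/-- The sum of the eigenspaces of the natural numbers less than `n`. -/
def fil (E : Module.End k V) (n : ℕ) : Submodule k V :=
  ⨆ m : {m : ℕ // m < n}, E.eigenspace ((m : ℕ) : k)

theorem mem_fil {E : Module.End k V} {m n : ℕ} (h : m < n) {x : V} (hx : E x = (m : k) • x) :
    x ∈ E.fil n :=
  Submodule.mem_iSup_of_mem (p := fun m : {m : ℕ // m < n} => E.eigenspace ((m : ℕ) : k)) ⟨m, h⟩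
    (Module.End.mem_eigenspace_iff.2 hx)

theorem fil_le {E : Module.End k V} {n : ℕ} {W : Submodule k V}
    (h : ∀ m < n, ∀ x, E x = (m : k) • x → x ∈ W) : E.fil n ≤ W :=
  iSup_le fun m => fun x hx => h m m.2 x (Module.End.mem_eigenspace_iff.1 hx)

theorem fil_mono (E : Module.End k V) {m n : ℕ} (h : m ≤ n) : E.fil m ≤ E.fil n :=
  fil_le fun _ hm _ hx => mem_fil (hm.trans_le h) hx

/-- The strict inequality in `fil` makes the bottom step trivial, so that inductions on the
filtration start with nothing to prove. -/
theorem fil_zero (E : Module.End k V) : E.fil 0 = ⊥ :=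
  le_bot_iff.1 (fil_le fun m hm => absurd hm (Nat.not_lt_zero m))

namespace IsNatDiag

variable {E : Module.End k V} (hE : E.IsNatDiag)

include hE in
theorem exists_mem_fil (x : V) : ∃ n, x ∈ E.fil n := by
  refine hE.induction (P := fun x => ∃ n, x ∈ E.fil n) ⟨0, zero_mem _⟩ ?_ ?_ x
  · rintro x y ⟨m, hx⟩ ⟨n, hy⟩
    exact ⟨max m n, add_mem (E.fil_mono (le_max_left _ _) hx) (E.fil_mono (le_max_right _ _) hy)⟩
  · exact fun n x hx => ⟨n + 1, mem_fil n.lt_succ_self hx⟩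

theorem sub_pr_mem_fil {n : ℕ} {x : V} (hx : x ∈ E.fil (n + 1)) : x - hE.pr n x ∈ E.fil n := by
  have : E.fil (n + 1) ≤ (E.fil n).comap (LinearMap.id - hE.pr n) := by
    refine fil_le fun l hl y hy => ?_
    by_cases h : l = n
    · subst h; simp [hE.pr_self hy]
    · simpa [hE.pr_of_ne h hy] using mem_fil (by omega) hy
  exact this hx

theorem fc_mem_fil (c : ℕ → k) {n : ℕ} {x : V} (hx : x ∈ E.fil n) : hE.fc c x ∈ E.fil n := by
  have : E.fil n ≤ (E.fil n).comap (hE.fc c) := by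
    refine fil_le fun l hl y hy => ?_
    simpa [hE.fc_apply _ hy] using Submodule.smul_mem _ _ (mem_fil hl hy)
  exact this hx

include hE in
/-- A contracting operation on linear maps has a fixed point. -/
theorem exists_fixed (F : (V →ₗ[k] N) → (V →ₗ[k] N)) (P : (V →ₗ[k] N) → Prop) (f₀ : V →ₗ[k] N)
    (h₀ : P f₀) (hF : ∀ f, P f → P (F f))
    (hc : ∀ f f', P f → P f' → ∀ n, (∀ x ∈ E.fil n, f x = f' x) →
      ∀ x ∈ E.fil (n + 1), F f x = F f' x)
    (hP : ∀ f, (∀ n, ∃ f', P f' ∧ ∀ x ∈ E.fil n, f x = f' x) → P f) :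
    ∃ f, P f ∧ F f = f := by
  -- Picard iteration: each application of `F` makes one more filtration step agree, so the iterates
  -- become stationary on every `fil n`.
  let s : ℕ → V →ₗ[k] N := fun n => F^[n] f₀
  have hs : ∀ n, P (s n) := by
    intro n
    induction n with
    | zero => exact h₀
    | succ n ih => simpa only [s, Function.iterate_succ_apply'] using hF _ ih
  have hss : ∀ n, s (n + 1) = F (s n) := fun n => Function.iterate_succ_apply' _ _ _
  have h1 : ∀ n, ∀ x ∈ E.fil n, s (n + 1) x = s n x := by
    intro n
    induction n with
    | zero => intro x hx; rw [fil_zero, Submodule.mem_bot] at hx; simp [hx]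
    | succ n ih => intro x hx; rw [hss (n + 1)]; nth_rw 2 [hss n]; exact hc _ _ (hs _) (hs _) n ih x hx
  have h2 : ∀ m n, m ≤ n → ∀ x ∈ E.fil m, s n x = s m x := by
    intro m n hmn
    induction n, hmn using Nat.le_induction with
    | base => exact fun _ _ => rfl
    | succ n hmn ih => exact fun x hx => (h1 n x (E.fil_mono hmn hx)).trans (ih x hx)
  -- The eigenspace of `n` lies in `fil (n + 1)`, where the iterates no longer change from stage `n
  -- + 1` on.
  let f : V →ₗ[k] N := hE.lift fun n => s (n + 1)
  have hf : ∀ n, ∀ x ∈ E.fil n, f x = s n x := by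
    intro n
    have : E.fil n ≤ LinearMap.ker (f - s n) := fil_le fun m hm x hx => by
      simp [f, hE.lift_apply _ hx, h2 (m + 1) n hm x (mem_fil m.lt_succ_self hx)]
    exact fun x hx => sub_eq_zero.1 (this hx)
  have hPf : P f := hP f fun n => ⟨s n, hs n, hf n⟩
  refine ⟨f, hPf, LinearMap.ext fun x => ?_⟩
  obtain ⟨n, hx⟩ := hE.exists_mem_fil x
  rw [hf (n + 1) x (E.fil_mono n.le_succ hx), hss]
  exact hc _ _ hPf (hs n) n (hf n) x (E.fil_mono n.le_succ hx)

end IsNatDiag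

end Module.End

/-- An exhausting family has no room to be smaller than an independent one that contains it. This
identifies subspaces spanned by monomials with eigenspaces of grading derivations without choosing a
basis of the symmetric algebra. -/
theorem Submodule.eq_of_le_of_iSupIndep {k V ι : Type*} [Field k] [AddCommGroup V] [Module k V]
    {A B : ι → Submodule k V} (hle : ∀ i, A i ≤ B i) (hB : iSupIndep B) (hA : ⨆ i, A i = ⊤)
    (i : ι) : A i = B i := by
  refine le_antisymm (hle i) fun x hx => ?_
  have hx' : x ∈ A i ⊔ ⨆ (j) (_ : j ≠ i), A j := by
    have : (⨆ j, A j) ≤ A i ⊔ ⨆ (j) (_ : j ≠ i), A j := iSup_le fun j => by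
      by_cases h : j = i
      · subst h; exact le_sup_left
      · exact le_sup_of_le_right (le_iSup₂_of_le j h le_rfl)
    exact this (by rw [hA]; trivial)
  obtain ⟨y, hy, z, hz, rfl⟩ := Submodule.mem_sup.1 hx'
  have hz1 : z ∈ B i := by simpa using sub_mem hx (hle i hy)
  have hz2 : z ∈ ⨆ (j) (_ : j ≠ i), B j := (iSup₂_mono fun j _ => hle j) hz
  have : z = 0 := (Submodule.disjoint_def.1 (hB i)) z hz1 hz2
  simpa [this] using hy

/-! ### Derivations of the symmetric algebra -/

namespace DGLieAlgebra

variable {k : Type u} {L : Type v} [Field k] [AddCommGroup L] [Module k L]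
variable (g : DGLieAlgebra k L)

/-- `α` is homogeneous of degree `r`. -/
def IsHomogMap (α : L →ₗ[k] L) (r : ℤ) : Prop := ∀ ⦃i : ℤ⦄ ⦃x : L⦄, x ∈ g.deg i → α x ∈ g.deg (i + r)

/-- The derivation of `S(g[1])` that extends `α`. -/
def derL (α : L →ₗ[k] L) : Module.End k g.S := g.contract (LinearMap.mul k g.S ∘ₗ g.ιS ∘ₗ α)

theorem derL_one (α : L →ₗ[k] L) : g.derL α 1 = 0 := g.contract_one _

theorem dS₁_eq : g.dS₁ = -g.derL g.d := rfl

theorem derL_add (α β : L →ₗ[k] L) : g.derL (α + β) = g.derL α + g.derL β := by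
  simp only [derL, LinearMap.comp_add, map_add]

theorem derL_smul (c : k) (α : L →ₗ[k] L) : g.derL (c • α) = c • g.derL α := by
  simp only [derL, LinearMap.comp_smul, map_smul]

theorem derL_zero : g.derL 0 = 0 := by simp [derL]

theorem derL_neg (α : L →ₗ[k] L) : g.derL (-α) = -g.derL α := by
  rw [← neg_one_smul k, derL_smul, neg_one_smul]

theorem derL_sum {ι : Type*} (s : Finset ι) (α : ι → L →ₗ[k] L) :
    g.derL (∑ i ∈ s, α i) = ∑ i ∈ s, g.derL (α i) :=
  map_sum (⟨⟨g.derL, g.derL_zero⟩, g.derL_add⟩ : (L →ₗ[k] L) →+ Module.End k g.S) α s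

/-- The sign is that of moving `α` past x[1]; on a term z ⊗ b of `extract a` the identity is the
commutation of (α z)[1] with x[1]. Later identities between derivations are checked on generators
through this rule. -/
theorem derL_mul {α : L →ₗ[k] L} {r : ℤ} (hα : g.IsHomogMap α r) {i : ℤ} {x : L} (hx : x ∈ g.deg i)
    (a : g.S) :
    g.derL α (g.ιS x * a) = g.ιS (α x) * a + (r * (i - 1)).negOnePow • (g.ιS x * g.derL α a) := by
  have key : TensorProduct.lift (LinearMap.mul k g.S ∘ₗ g.ιS ∘ₗ α) ∘ₗ
      g.swapMul x = (r * (i - 1)).negOnePow • (LinearMap.mulLeft k (g.ιS x) ∘ₗ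
        TensorProduct.lift (LinearMap.mul k g.S ∘ₗ g.ιS ∘ₗ α)) := by
    refine g.tensor_ext fun l z hz b => ?_
    have h := congrArg (· * b) (g.ιS_comm (hα hz) hx)
    rcases negOnePow_cases i with ⟨hi, ei⟩ | ⟨hi, ei⟩ <;>
      rcases negOnePow_cases l with ⟨hl, el⟩ | ⟨hl, el⟩ <;>
      rcases negOnePow_cases r with ⟨hr, er⟩ | ⟨hr, er⟩ <;>
      simp [swapMul_tmul _ hx, g.shiftSign_apply _ hz, Units.smul_def,
        negOnePow_mul, Int.negOnePow_add, Int.negOnePow_sub, Int.odd_sub, Int.odd_add,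
        Int.even_sub, Int.even_add, hi, ei, hr, er,
        hl, el, mul_assoc] at h ⊢ <;>
      try simp [h]
  rw [derL, contract_mul, key]
  simp [Units.smul_def, contract_apply]

theorem derL_mul_zero {φ : L →ₗ[k] L} (hφ : g.IsHomogMap φ 0) (x : L) (a : g.S) :
    g.derL φ (g.ιS x * a) = g.ιS (φ x) * a + g.ιS x * g.derL φ a := by
  induction x using g.hom_induction with
  | h0 => simp
  | hadd x y hx hy => simp only [map_add, add_mul, hx, hy]; abel
  | hh i x hx => simp [g.derL_mul hφ hx]

/-- A graded commutator of derivations is a derivation, hence determined by its restriction `γ` to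
the generators. Keeping `γ` free allows it to be supplied in simplified form. -/
theorem derL_comm {α β γ : L →ₗ[k] L} {r s : ℤ} (hα : g.IsHomogMap α r) (hβ : g.IsHomogMap β s)
    (h : ∀ i x, x ∈ g.deg i → α (β x) = (r * s).negOnePow • β (α x) + γ x) (a : g.S) :
    g.derL α (g.derL β a) = (r * s).negOnePow • g.derL β (g.derL α a) + g.derL γ a := by
  have hγ : g.IsHomogMap γ (s + r) := fun i x hx => by
    have h1 : γ x = α (β x) - (r * s).negOnePow • β (α x) := by rw [h i x hx]; abel
    have h2 := hα (hβ hx)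
    have h3 := hβ (hα hx)
    rw [add_assoc] at h2 h3
    rw [add_comm r s] at h3
    rw [h1, Units.smul_def]
    exact sub_mem h2 (zsmul_mem h3 _)
  induction a using g.S_induction with
  | h1 => simp [derL_one, Units.smul_def]
  | hadd a b ha hb => simp only [map_add, ha, hb, smul_add]; abel
  | hsmul c a ha => simp only [map_smul, ha, smul_add, Units.smul_def, smul_comm c]
  | hmul i x hx a ha =>
    have e := congrArg (fun w => g.ιS w * a) (h i x hx)
    rcases negOnePow_cases i with ⟨hi, ei⟩ | ⟨hi, ei⟩ <;>
      rcases negOnePow_cases s with ⟨hl, el⟩ | ⟨hl, el⟩ <;>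
      rcases negOnePow_cases r with ⟨hr, er⟩ | ⟨hr, er⟩ <;>
      simp [g.derL_mul hα hx, g.derL_mul hβ hx, g.derL_mul hγ hx, g.derL_mul hα (hβ hx),
        g.derL_mul hβ (hα hx), Units.smul_def,
        negOnePow_mul, Int.negOnePow_add, Int.negOnePow_sub, Int.odd_sub, Int.odd_add,
        Int.even_sub, Int.even_add, hi, ei, hr, er,
        hl, el, mul_add, add_mul] at e ha ⊢ <;>
      simp only [e, ha, mul_add, mul_neg] <;> abel

theorem isHomogMap_id : g.IsHomogMap LinearMap.id 0 := fun i x hx => by simpa using hx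

theorem derL_commute {φ ψ : L →ₗ[k] L} {r : ℤ} (hφ : g.IsHomogMap φ 0) (hψ : g.IsHomogMap ψ r)
    (h : ∀ x, φ (ψ x) = ψ (φ x)) (a : g.S) : g.derL φ (g.derL ψ a) = g.derL ψ (g.derL φ a) := by
  have := g.derL_comm (γ := 0) hφ hψ (fun i x _ => by simp [h]) a
  simpa [derL_zero] using this

/-- For an odd derivation the graded commutator with itself is twice its square, and 2 is
invertible. -/
theorem derL_sq [CharZero k] {α : L →ₗ[k] L} {r : ℤ} (hr : Odd r) (hα : g.IsHomogMap α r)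
    (h : ∀ x, α (α x) = 0) (a : g.S) : g.derL α (g.derL α a) = 0 := by
  have h1 := g.derL_comm (γ := 0) hα hα (fun i x _ => by simp [h, Units.smul_def]) a
  rw [Int.negOnePow_odd _ (hr.mul hr)] at h1
  simp only [Units.smul_def, Units.val_neg, Units.val_one, neg_smul, one_smul, derL_zero,
    LinearMap.zero_apply, add_zero] at h1
  have h2 : (2 : k) • g.derL α (g.derL α a) = 0 := by rw [two_smul]; nth_rw 1 [h1]; simp
  exact (smul_eq_zero.1 h2).resolve_left two_ne_zero

/-! ### Partial derivatives -/

/-- The partial derivative of `S(g[1])` along the functional `ξ`. -/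
def pd (ξ : L →ₗ[k] k) : Module.End k g.S := g.contract (LinearMap.lsmul k g.S ∘ₗ ξ)

theorem pd_one (ξ : L →ₗ[k] k) : g.pd ξ 1 = 0 := g.contract_one _

theorem pd_zero : g.pd 0 = 0 := by simp [pd]

theorem pd_smul (c : k) (ξ : L →ₗ[k] k) : g.pd (c • ξ) = c • g.pd ξ := by
  simp only [pd, LinearMap.comp_smul, map_smul]

/-- Concentration of `ξ` in the single degree `i₀` gives the partial derivative a definite parity;
terms z ⊗ b with z in any other degree contribute nothing. -/
theorem pd_mul {ξ : L →ₗ[k] k} {i₀ : ℤ} (hξ : ∀ j x, x ∈ g.deg j → j ≠ i₀ → ξ x = 0) {i : ℤ} {x : L}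
    (hx : x ∈ g.deg i) (a : g.S) :
    g.pd ξ (g.ιS x * a) = ξ x • a + ((i₀ - 1) * (i - 1)).negOnePow • (g.ιS x * g.pd ξ a) := by
  have key : TensorProduct.lift (LinearMap.lsmul k g.S ∘ₗ ξ) ∘ₗ
      g.swapMul x = ((i₀ - 1) * (i - 1)).negOnePow • (LinearMap.mulLeft k (g.ιS x) ∘ₗ
        TensorProduct.lift (LinearMap.lsmul k g.S ∘ₗ ξ)) := by
    refine g.tensor_ext fun l z hz b => ?_
    by_cases hl : l = i₀
    · subst hl
      simp only [LinearMap.comp_apply, LinearMap.smul_apply, swapMul_tmul _ hx,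
        g.shiftSign_apply _ hz, Units.smul_def, mul_comm (l - 1), TensorProduct.lift.tmul, map_zsmul,
        LinearMap.lsmul_apply, LinearMap.mulLeft_apply, mul_smul_comm]
    · simp [swapMul_tmul _ hx, g.shiftSign_apply _ hz, Units.smul_def, hξ l z hz hl]
  rw [pd, contract_mul, key]
  simp [Units.smul_def, contract_apply]

theorem pd_derL {ξ : L →ₗ[k] k} {i₀ : ℤ} (hξ : ∀ j x, x ∈ g.deg j → j ≠ i₀ → ξ x = 0)
    {φ : L →ₗ[k] L} (hφ : g.IsHomogMap φ 0) (a : g.S) :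
    g.pd ξ (g.derL φ a) = g.derL φ (g.pd ξ a) + g.pd (ξ ∘ₗ φ) a := by
  have hξφ : ∀ j x, x ∈ g.deg j → j ≠ i₀ → (ξ ∘ₗ φ) x = 0 := fun j x hx hj =>
    hξ (j + 0) _ (hφ hx) (by simpa using hj)
  have hφ' : ∀ {i x}, x ∈ g.deg i → φ x ∈ g.deg i := fun {i x} hx => by simpa using hφ hx
  induction a using g.S_induction with
  | h1 => simp [derL_one, pd_one]
  | hadd a b ha hb => simp only [map_add, ha, hb]; abel
  | hsmul c a ha => simp only [map_smul, ha, smul_add]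
  | hmul i x hx a ha =>
    simp only [g.derL_mul_zero hφ, map_add, g.pd_mul hξ hx, g.pd_mul hξ (hφ' hx), g.pd_mul hξφ hx,
      Units.smul_def, map_smul, map_zsmul, ha, mul_add, smul_add, LinearMap.comp_apply]
    abel

theorem pd_pd {ξ η : L →ₗ[k] k} {i₀ j₀ : ℤ} (hξ : ∀ j x, x ∈ g.deg j → j ≠ i₀ → ξ x = 0)
    (hη : ∀ j x, x ∈ g.deg j → j ≠ j₀ → η x = 0) (a : g.S) :
    g.pd ξ (g.pd η a) = ((i₀ - 1) * (j₀ - 1)).negOnePow • g.pd η (g.pd ξ a) := by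
  induction a using g.S_induction with
  | h1 => simp [pd_one, Units.smul_def]
  | hadd a b ha hb => simp only [map_add, ha, hb, smul_add]
  | hsmul c a ha => simp only [map_smul, ha, Units.smul_def, smul_comm c]
  | hmul i x hx a ha =>
    by_cases h1 : i = i₀ <;> by_cases h2 : i = j₀
    all_goals
      rcases negOnePow_cases i with ⟨hi, ei⟩ | ⟨hi, ei⟩ <;>
      rcases negOnePow_cases i₀ with ⟨hl, el⟩ | ⟨hl, el⟩ <;>
      rcases negOnePow_cases j₀ with ⟨hr, er⟩ | ⟨hr, er⟩ <;>
      simp [g.pd_mul hξ hx, g.pd_mul hη hx, Units.smul_def,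
        negOnePow_mul, Int.negOnePow_add, Int.negOnePow_sub, Int.odd_sub, Int.odd_add,
        Int.even_sub, Int.even_add, hi, ei, hr, er,
        hl, el, mul_add, add_mul] at ha ⊢ <;>
      first
      | (simp only [ha, mul_neg, neg_add_rev, neg_neg]; abel; done)
      | (subst h1; simp_all; done)
      | (subst h2; simp_all; done)
      | (simp_all [hξ i x hx h1, hη i x hx h2])
      | (simp_all [hξ i x hx h1])
      | (simp_all [hη i x hx h2])

/-- Signed sums of these rank one Euler derivations over dual bases are the number operators; this
is how they arise in `tX_kap`. -/
theorem ιS_mul_pd (ξ : L →ₗ[k] k) (e : L) (a : g.S) :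
    g.ιS e * g.pd ξ a = g.derL (ξ.smulRight e) a := by
  have : LinearMap.mulLeft k (g.ιS e) ∘ₗ TensorProduct.lift (LinearMap.lsmul k g.S ∘ₗ ξ) =
      TensorProduct.lift (LinearMap.mul k g.S ∘ₗ g.ιS ∘ₗ ξ.smulRight e) :=
    TensorProduct.ext' fun z b => by simp
  exact LinearMap.congr_fun this (g.extract a)

/-! ### Gradings -/

/-- Induction on products of elements of a spanning set. -/
theorem S_induction_of_span {G : Set L} (hG : Submodule.span k G = ⊤) {P : g.S → Prop}
    (h1 : P 1) (hadd : ∀ a b, P a → P b → P (a + b)) (hsmul : ∀ (c : k) a, P a → P (c • a))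
    (hmul : ∀ x ∈ G, ∀ a, P a → P (g.ιS x * a)) (a : g.S) : P a := by
  induction a using g.S_induction with
  | h1 => exact h1
  | hadd a b ha hb => exact hadd a b ha hb
  | hsmul c a ha => exact hsmul c a ha
  | hmul i x hi a ha =>
    clear hi
    have hx : x ∈ Submodule.span k G := by rw [hG]; trivial
    induction hx using Submodule.span_induction with
    | mem x hx => exact hmul x hx a ha
    | zero => simpa using hsmul 0 a ha
    | add x y _ _ hx hy => rw [map_add, add_mul]; exact hadd _ _ hx hy
    | smul c x _ hx => rw [map_smul, smul_mul_assoc]; exact hsmul _ _ hx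

/-- A product of eigenvectors of `φ` is an eigenvector of the derivation, with the sum of the
eigenvalues, and such products span. -/
theorem derL_isNatDiag {φ : L →ₗ[k] L} (hφ : g.IsHomogMap φ 0) {G : Set L}
    (hG : Submodule.span k G = ⊤) (h : ∀ x ∈ G, ∃ m : ℕ, φ x = (m : k) • x) :
    (g.derL φ).IsNatDiag := by
  refine (Submodule.eq_top_iff').2 fun a => ?_
  induction a using g.S_induction_of_span hG with
  | h1 => exact Submodule.mem_iSup_of_mem 0 (Module.End.mem_eigenspace_iff.2 (by simp [derL_one]))
  | hadd a b ha hb => exact add_mem ha hb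
  | hsmul c a ha => exact Submodule.smul_mem _ _ ha
  | hmul x hx a ha =>
    obtain ⟨m, hm⟩ := h x hx
    induction ha using Submodule.iSup_induction' with
    | mem n a ha =>
      refine Submodule.mem_iSup_of_mem (m + n) (Module.End.mem_eigenspace_iff.2 ?_)
      rw [g.derL_mul_zero hφ, hm, Module.End.mem_eigenspace_iff.1 ha]
      simp [add_smul]
    | zero => simp
    | add a b _ _ ha hb => rw [mul_add]; exact add_mem ha hb

/-- The derivation that multiplies the products of `n` elements of `g[1]` by `n`. -/
def wtE : Module.End k g.S := g.derL LinearMap.id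

theorem wtE_mul (x : L) (a : g.S) : g.wtE (g.ιS x * a) = g.ιS x * a + g.ιS x * g.wtE a :=
  g.derL_mul_zero g.isHomogMap_id x a

theorem wtE_one : g.wtE 1 = 0 := g.derL_one _

theorem wtE_isNatDiag : g.wtE.IsNatDiag :=
  g.derL_isNatDiag g.isHomogMap_id (G := Set.univ) Submodule.span_univ fun x _ => ⟨1, by simp⟩

theorem wtE_derL {α : L →ₗ[k] L} {r : ℤ} (hα : g.IsHomogMap α r) (a : g.S) :
    g.wtE (g.derL α a) = g.derL α (g.wtE a) :=
  g.derL_commute g.isHomogMap_id hα (fun _ => rfl) a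

theorem pd_wtE {ξ : L →ₗ[k] k} {i₀ : ℤ} (hξ : ∀ j x, x ∈ g.deg j → j ≠ i₀ → ξ x = 0) (a : g.S) :
    g.pd ξ (g.wtE a) = g.wtE (g.pd ξ a) + g.pd ξ a :=
  g.pd_derL hξ g.isHomogMap_id a

/-- The map `x ↦ (|x| - 1) x`. -/
def degL : L →ₗ[k] L := g.homogLift fun i => ((i - 1 : ℤ) : k) • LinearMap.id

theorem degL_apply {i : ℤ} {x : L} (hx : x ∈ g.deg i) : g.degL x = ((i - 1 : ℤ) : k) • x := by
  simp only [degL, g.homogLift_apply _ hx, LinearMap.smul_apply, LinearMap.id_apply]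

theorem isHomogMap_degL : g.IsHomogMap g.degL 0 := fun i x hx => by
  rw [g.degL_apply hx, add_zero]
  exact Submodule.smul_mem _ _ hx

/-- The derivation that multiplies the elements of degree `n` by `n`. -/
def degE : Module.End k g.S := g.derL g.degL

theorem degE_mul {i : ℤ} {x : L} (hx : x ∈ g.deg i) (a : g.S) :
    g.degE (g.ιS x * a) = ((i - 1 : ℤ) : k) • (g.ιS x * a) + g.ιS x * g.degE a := by
  rw [degE, g.derL_mul_zero g.isHomogMap_degL, g.degL_apply hx, map_smul, smul_mul_assoc]

theorem degE_derL {α : L →ₗ[k] L} {r : ℤ} (hα : g.IsHomogMap α r) (a : g.S) :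
    g.degE (g.derL α a) = g.derL α (g.degE a) + (r : k) • g.derL α a := by
  have := g.derL_comm (γ := (r : k) • α) g.isHomogMap_degL hα (fun i x hx => ?_) a
  · rw [derL_smul, zero_mul, Int.negOnePow_zero, one_smul] at this
    exact this
  · rw [g.degL_apply (hα hx), g.degL_apply hx, map_smul, zero_mul, Int.negOnePow_zero, one_smul,
      LinearMap.smul_apply, ← add_smul]
    congr 1
    push_cast
    ring

theorem pd_degE {ξ : L →ₗ[k] k} {i₀ : ℤ} (hξ : ∀ j x, x ∈ g.deg j → j ≠ i₀ → ξ x = 0) (a : g.S) :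
    g.pd ξ (g.degE a) = g.degE (g.pd ξ a) + ((i₀ - 1 : ℤ) : k) • g.pd ξ a := by
  have : ξ ∘ₗ g.degL = ((i₀ - 1 : ℤ) : k) • ξ := g.hom_ext fun i x hx => by
    by_cases h : i = i₀
    · subst h; rw [LinearMap.comp_apply, g.degL_apply hx, map_smul, LinearMap.smul_apply]
    · rw [LinearMap.comp_apply, g.degL_apply hx, map_smul, LinearMap.smul_apply, hξ i x hx h,
        smul_zero, smul_zero]
  rw [degE, g.pd_derL hξ g.isHomogMap_degL, this, pd_smul]
  rfl

theorem one_mem_degS : (1 : g.S) ∈ g.degS 0 := Submodule.subset_span ⟨[], by simp⟩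

/-- Characteristic zero lets the degree be read off as an eigenvalue. Membership in a span of
monomials becomes a linear equation, which is easy to carry through operators with a known
commutator with `degE`. -/
theorem mem_degS_iff [CharZero k] {n : ℤ} {a : g.S} : a ∈ g.degS n ↔ g.degE a = (n : k) • a := by
  have hle : ∀ n, g.degS n ≤ g.degE.eigenspace (n : k) := fun n a ha => by
    rw [Module.End.mem_eigenspace_iff]
    refine g.degS_induction (P := fun n a => g.degE a = (n : k) • a) ?_ ?_ ?_ ?_ ?_ ha
    · simp
    · simp [degE, derL_one]
    · intro n a b ha hb; simp [ha, hb]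
    · intro n c a ha; simp [ha, smul_comm c]
    · intro i n x a hx ha
      rw [g.degE_mul hx, ha, mul_smul_comm, ← add_smul, Int.cast_add]
  have htop : ⨆ n, g.degS n = ⊤ := by
    refine (Submodule.eq_top_iff').2 fun a => ?_
    induction a using g.S_induction with
    | h1 => exact Submodule.mem_iSup_of_mem 0 g.one_mem_degS
    | hadd a b ha hb => exact add_mem ha hb
    | hsmul c a ha => exact Submodule.smul_mem _ _ ha
    | hmul i x hx a ha =>
      induction ha using Submodule.iSup_induction' with
      | mem n a ha => exact Submodule.mem_iSup_of_mem _ (g.ιS_mul_mem hx ha)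
      | zero => simp
      | add a b _ _ ha hb => rw [mul_add]; exact add_mem ha hb
  rw [Submodule.eq_of_le_of_iSupIndep hle
    (g.degE.eigenspaces_iSupIndep.comp Int.cast_injective) htop n, Module.End.mem_eigenspace_iff]

/-- The elements of weight `n` that satisfy `P n` form subspaces of the eigenspaces of `wtE`.
Together they exhaust S(g[1]), so each fills its eigenspace. -/
theorem wt_induction [CharZero k] {n : ℕ} {a : g.S} (ha : g.wtE a = (n : k) • a) {P : ℕ → g.S → Prop} (h0 : ∀ n, P n 0) (h1 : P 0 1)
    (hadd : ∀ n a b, P n a → P n b → P n (a + b)) (hsmul : ∀ n (c : k) a, P n a → P n (c • a))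
    (hmul : ∀ (n : ℕ) i x a, x ∈ g.deg i → g.wtE a = (n : k) • a → P n a →
      P (n + 1) (g.ιS x * a)) : P n a := by
  let W : ℕ → Submodule k g.S := fun n =>
    { carrier := {a | g.wtE a = (n : k) • a ∧ P n a}
      zero_mem' := ⟨by simp, h0 n⟩
      add_mem' := fun ha hb => ⟨by rw [map_add, ha.1, hb.1, smul_add], hadd _ _ _ ha.2 hb.2⟩
      smul_mem' := fun c a ha => ⟨by rw [map_smul, ha.1, smul_comm], hsmul _ _ _ ha.2⟩ }
  have hle : ∀ n, W n ≤ g.wtE.eigenspace (n : k) := fun n a ha =>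
    Module.End.mem_eigenspace_iff.2 ha.1
  have htop : ⨆ n, W n = ⊤ := by
    refine (Submodule.eq_top_iff').2 fun a => ?_
    induction a using g.S_induction with
    | h1 => exact Submodule.mem_iSup_of_mem 0 ⟨by simp [wtE_one], h1⟩
    | hadd a b ha hb => exact add_mem ha hb
    | hsmul c a ha => exact Submodule.smul_mem _ _ ha
    | hmul i x hx a ha =>
      induction ha using Submodule.iSup_induction' with
      | mem n a ha =>
        refine Submodule.mem_iSup_of_mem (n + 1) ⟨?_, hmul n i x a hx ha.1 ha.2⟩
        rw [wtE_mul, ha.1, mul_smul_comm, Nat.cast_succ, add_smul, one_smul, add_comm]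
      | zero => simp
      | add a b _ _ ha hb => rw [mul_add]; exact add_mem ha hb
  have h := Submodule.eq_of_le_of_iSupIndep hle
    (g.wtE.eigenspaces_iSupIndep.comp Nat.cast_injective) htop n
  have ha' : a ∈ W n := by rw [h]; exact Module.End.mem_eigenspace_iff.2 ha
  exact ha'.2

/-- The span of the `z ⊗ b` with `b` of weight `n`. -/
def wtT (n : ℕ) : Submodule k (L ⊗[k] g.S) :=
  Submodule.span k {t | ∃ i z b, z ∈ g.deg i ∧ g.wtE b = (n : k) • b ∧ z ⊗ₜ b = t}

theorem swapMul_mem_wtT {i : ℤ} {x : L} (hx : x ∈ g.deg i) {n : ℕ} {t : L ⊗[k] g.S}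
    (ht : t ∈ g.wtT n) : g.swapMul x t ∈ g.wtT (n + 1) := by
  have : g.wtT n ≤ (g.wtT (n + 1)).comap (g.swapMul x) := by
    refine Submodule.span_le.2 ?_
    rintro _ ⟨j, z, b, hz, hb, rfl⟩
    simp only [SetLike.mem_coe, Submodule.mem_comap, swapMul_tmul _ hx, g.shiftSign_apply _ hz]
    refine Submodule.subset_span ⟨j, _, _, ?_, ?_, rfl⟩
    · rw [Units.smul_def]; exact zsmul_mem hz _
    · rw [wtE_mul, hb, mul_smul_comm, Nat.cast_succ, add_smul, one_smul, add_comm]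
  exact this ht

theorem extract_eq_zero [CharZero k] {a : g.S} (ha : g.wtE a = 0) : g.extract a = 0 := by
  refine g.wt_induction (n := 0) (by simpa using ha) (P := fun n a => n = 0 → g.extract a = 0)
    ?_ ?_ ?_ ?_ ?_ rfl
  · simp
  · simp [extract_one]
  · intro n a b ha hb h; simp [ha h, hb h]
  · intro n c a ha h; simp [ha h]
  · intro n i x a _ _ _ h; omega

theorem extract_mem_wtT [CharZero k] {n : ℕ} {a : g.S} (ha : g.wtE a = ((n + 1 : ℕ) : k) • a) :
    g.extract a ∈ g.wtT n := by
  refine g.wt_induction ha (P := fun m a => ∀ n, m = n + 1 → g.extract a ∈ g.wtT n) ?_ ?_ ?_ ?_ ?_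
    n rfl
  · simp
  · simp
  · intro n a b ha hb m h; rw [map_add]; exact add_mem (ha m h) (hb m h)
  · intro n c a ha m h; rw [map_smul]; exact Submodule.smul_mem _ c (ha m h)
  · rintro n i x a hx hn ha m h
    obtain rfl : n = m := by omega
    rw [extract_mul]
    refine add_mem (Submodule.subset_span ⟨i, x, a, hx, hn, rfl⟩) ?_
    rcases n with _ | n
    · rw [g.extract_eq_zero (by simpa using hn), map_zero]; exact zero_mem _
    · exact g.swapMul_mem_wtT hx (ha n rfl)

/-- The augmentation. -/
def aug : g.S →ₐ[k] k := g.liftS 0 (by simp)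

theorem aug_ι (x : L) : g.aug (g.ιS x) = 0 := by simp [aug, liftS_ι]

theorem aug_eq_zero [CharZero k] {n : ℕ} {a : g.S} (ha : g.wtE a = ((n + 1 : ℕ) : k) • a) :
    g.aug a = 0 := by
  refine g.wt_induction ha (P := fun m a => ∀ n, m = n + 1 → g.aug a = 0) ?_ ?_ ?_ ?_ ?_ n rfl
  · simp
  · simp
  · intro n a b ha hb m h; simp [ha m h, hb m h]
  · intro n c a ha m h; simp [ha m h]
  · intro n i x a _ _ _ m h; simp [aug_ι]

theorem eq_aug [CharZero k] {a : g.S} (ha : g.wtE a = 0) : a = g.aug a • 1 := by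
  refine g.wt_induction (n := 0) (by simpa using ha) (P := fun n a => n = 0 → a = g.aug a • 1)
    ?_ ?_ ?_ ?_ ?_ rfl
  · simp
  · simp
  · intro n a b ha hb h; rw [map_add, add_smul, ← ha h, ← hb h]
  · intro n c a ha h; rw [map_smul, smul_assoc, ← ha h]
  · intro n i x a _ _ _ h; omega

end DGLieAlgebra

/-! ### Deformation retractions and the induced homotopy on the symmetric algebra -/

namespace DGLieAlgebra

variable {k : Type u} {L : Type v} [Field k] [AddCommGroup L] [Module k L]

/-- A homogeneous deformation retraction of `g` onto the span of finitely many homogeneous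
cocycles `e j`; the projection is given by the functionals `ξ j`. -/
structure Retract (g : DGLieAlgebra k L) where
  J : Type
  [fintype : Fintype J]
  dg : J → ℤ
  e : J → L
  e_mem : ∀ j, e j ∈ g.deg (dg j)
  ξ : J → L →ₗ[k] k
  ξ_of_ne : ∀ j i x, x ∈ g.deg i → i ≠ dg j → ξ j x = 0
  ξ_e_self : ∀ j, ξ j (e j) = 1
  ξ_e_of_ne : ∀ i j, i ≠ j → ξ i (e j) = 0
  h : L →ₗ[k] L
  h_mem : g.IsHomogMap h (-1)
  h_h : ∀ x, h (h x) = 0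
  d_e : ∀ j, g.d (e j) = 0
  ξ_d : ∀ j x, ξ j (g.d x) = 0
  h_e : ∀ j, h (e j) = 0
  ξ_h : ∀ j x, ξ j (h x) = 0
  d_h : ∀ x, g.d (h x) + h (g.d x) = x - ∑ j, ξ j x • e j

attribute [instance] Retract.fintype

variable {g : DGLieAlgebra k L}

variable (g) in
theorem isHomogMap_d : g.IsHomogMap g.d 1 := fun _ _ hx => g.d_mem hx

namespace Retract

variable (D : g.Retract)

/-- A diagonal operator on the span of the `e j`, extended by zero. -/
def diagL (c : D.J → k) : L →ₗ[k] L := ∑ j, c j • (D.ξ j).smulRight (D.e j)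

theorem diagL_apply (c : D.J → k) (x : L) : D.diagL c x = ∑ j, (c j * D.ξ j x) • D.e j := by
  simp [diagL, mul_smul]

theorem ξ_diagL (c : D.J → k) (i : D.J) (x : L) : D.ξ i (D.diagL c x) = c i * D.ξ i x := by
  rw [diagL_apply, map_sum, Finset.sum_eq_single i]
  · rw [map_smul, ξ_e_self, smul_eq_mul, mul_one]
  · intro j _ hj; rw [map_smul, D.ξ_e_of_ne i j hj.symm, smul_zero]
  · simp

theorem diagL_e (c : D.J → k) (i : D.J) : D.diagL c (D.e i) = c i • D.e i := by
  rw [diagL_apply, Finset.sum_eq_single i]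
  · rw [ξ_e_self, mul_one]
  · intro j _ hj; rw [D.ξ_e_of_ne j i hj, mul_zero, zero_smul]
  · simp

theorem diagL_diagL (c c' : D.J → k) (x : L) :
    D.diagL c (D.diagL c' x) = D.diagL c' (D.diagL c x) := by
  simp only [D.diagL_apply _ (D.diagL _ _), ξ_diagL]
  exact Finset.sum_congr rfl fun j _ => by rw [mul_left_comm]

theorem isHomogMap_diagL (c : D.J → k) : g.IsHomogMap (D.diagL c) 0 := fun i x hx => by
  rw [diagL_apply, add_zero]
  refine Submodule.sum_mem _ fun j _ => ?_
  by_cases h : i = D.dg j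
  · exact Submodule.smul_mem _ _ (h ▸ D.e_mem j)
  · simp [D.ξ_of_ne j i x hx h]

theorem diagL_degL (c : D.J → k) (x : L) : D.diagL c (g.degL x) = g.degL (D.diagL c x) := by
  induction x using g.hom_induction with
  | h0 => simp
  | hadd x y hx hy => simp only [map_add, hx, hy]
  | hh i x hx =>
    have h := D.isHomogMap_diagL c hx
    rw [add_zero] at h
    rw [g.degL_apply hx, g.degL_apply h, map_smul]

/-- The projection onto the span of the `e j`. -/
def prL : L →ₗ[k] L := D.diagL fun _ => 1

theorem prL_apply (x : L) : D.prL x = ∑ j, D.ξ j x • D.e j := by simp [prL, diagL_apply]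

theorem prL_e (j : D.J) : D.prL (D.e j) = D.e j := by simp [prL, diagL_e]

theorem prL_prL (x : L) : D.prL (D.prL x) = D.prL x := by
  rw [D.prL_apply (D.prL x), D.prL_apply x]
  exact Finset.sum_congr rfl fun j _ => by rw [← prL_apply, prL, ξ_diagL, one_mul]

theorem span_eq_top : Submodule.span k (Set.range D.e ∪ {x | D.prL x = 0}) = ⊤ := by
  refine (Submodule.eq_top_iff').2 fun x => ?_
  rw [← add_sub_cancel (D.prL x) x]
  refine add_mem ?_ (Submodule.subset_span (Or.inr ?_))
  · rw [prL_apply]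
    exact Submodule.sum_mem _ fun j _ =>
      Submodule.smul_mem _ _ (Submodule.subset_span (Or.inl ⟨j, rfl⟩))
  · simp [prL_prL]

theorem isHomogMap_id_sub_prL : g.IsHomogMap (LinearMap.id - D.prL) 0 := fun _ _ hx =>
  sub_mem (g.isHomogMap_id hx) (D.isHomogMap_diagL _ hx)

/-- The derivation that counts the factors in the acyclic complement. -/
def cpE : Module.End k g.S := g.derL (LinearMap.id - D.prL)

theorem cpE_isNatDiag : D.cpE.IsNatDiag := by
  refine g.derL_isNatDiag D.isHomogMap_id_sub_prL D.span_eq_top ?_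
  rintro _ (⟨j, rfl⟩ | hx)
  · exact ⟨0, by simp [prL_e]⟩
  · exact ⟨1, by simp [show D.prL _ = 0 from hx]⟩

variable [CharZero k]

/-- The projection of `S(g[1])` onto the subalgebra generated by the `e j`. -/
def π : Module.End k g.S := D.cpE_isNatDiag.pr 0

/-- Multiplication by some `e j` preserves the number of acyclic factors and hence commutes with
`π`. Multiplication by an element of the kernel of `prL` raises that number by one, so the product
never lies in the eigenspace of 0. -/
theorem π_mul (x : L) (a : g.S) : D.π (g.ιS x * a) = g.ιS (D.prL x) * D.π a := by
  have hx : x ∈ Submodule.span k (Set.range D.e ∪ {x | D.prL x = 0}) := by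
    rw [span_eq_top]; trivial
  induction hx using Submodule.span_induction with
  | mem x hx =>
    rcases hx with ⟨j, rfl⟩ | hx
    · rw [prL_e]
      refine D.cpE_isNatDiag.fc_comm D.cpE_isNatDiag (LinearMap.mulLeft k (g.ιS (D.e j)))
        (fun a => ?_) _ a
      simp [cpE, g.derL_mul_zero D.isHomogMap_id_sub_prL, prL_e]
    · have hx : D.prL x = 0 := hx
      rw [hx, map_zero, zero_mul]
      refine LinearMap.congr_fun (D.cpE_isNatDiag.hom_ext
        (F := D.π ∘ₗ LinearMap.mulLeft k (g.ιS x)) (G := 0) fun n a ha => ?_) a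
      refine D.cpE_isNatDiag.pr_of_ne n.succ_ne_zero ?_
      rw [cpE] at ha ⊢
      rw [LinearMap.mulLeft_apply, g.derL_mul_zero D.isHomogMap_id_sub_prL, ha]
      simp [hx, add_smul, add_comm]
  | zero => simp
  | add x y _ _ hx hy => simp only [map_add, add_mul, hx, hy]
  | smul c x _ hx => simp only [map_smul, smul_mul_assoc, hx]

theorem π_one : D.π 1 = 1 := D.cpE_isNatDiag.pr_self (by simp [cpE, derL_one])

theorem π_π (a : g.S) : D.π (D.π a) = D.π a := D.cpE_isNatDiag.pr_pr 0 a

theorem cpE_derL {α : L →ₗ[k] L} {r : ℤ} (hα : g.IsHomogMap α r)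
    (h : ∀ x, D.prL (α x) = α (D.prL x)) (a : g.S) :
    D.cpE (g.derL α a) = g.derL α (D.cpE a) :=
  g.derL_commute D.isHomogMap_id_sub_prL hα (fun x => by simp [h]) a

theorem π_derL {α : L →ₗ[k] L} {r : ℤ} (hα : g.IsHomogMap α r)
    (h : ∀ x, D.prL (α x) = α (D.prL x)) (a : g.S) :
    D.π (g.derL α a) = g.derL α (D.π a) :=
  D.cpE_isNatDiag.fc_comm D.cpE_isNatDiag (g.derL α) (D.cpE_derL hα h) _ a

theorem π_wtE (a : g.S) : D.π (g.wtE a) = g.wtE (D.π a) :=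
  D.π_derL g.isHomogMap_id (fun _ => rfl) a

theorem π_degE (a : g.S) : D.π (g.degE a) = g.degE (D.π a) :=
  D.π_derL g.isHomogMap_degL (D.diagL_degL _) a

theorem prL_d (x : L) : D.prL (g.d x) = g.d (D.prL x) := by
  simp [prL_apply, ξ_d, d_e]

theorem prL_h (x : L) : D.prL (D.h x) = D.h (D.prL x) := by
  simp [prL_apply, ξ_h, h_e]

theorem dS₁_π (a : g.S) : g.dS₁ (D.π a) = 0 := by
  rw [dS₁_eq, LinearMap.neg_apply, neg_eq_zero]
  induction a using g.S_induction with
  | h1 => simp [π_one, derL_one]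
  | hadd a b ha hb => simp [ha, hb]
  | hsmul c a ha => simp [ha]
  | hmul i x hx a ha =>
    have h : D.prL x ∈ g.deg (i + 0) := D.isHomogMap_diagL (fun _ => 1) hx
    rw [add_zero] at h
    rw [π_mul, g.derL_mul g.isHomogMap_d h, ha, mul_zero, smul_zero, add_zero]
    change g.ιS (g.d (D.prL x)) * _ = 0
    simp [prL_apply, d_e]

theorem π_dS₁ (a : g.S) : D.π (g.dS₁ a) = 0 := by
  have := D.dS₁_π a
  rw [dS₁_eq, LinearMap.neg_apply] at this ⊢
  rw [map_neg, D.π_derL g.isHomogMap_d D.prL_d, this]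

/-- The contracting homotopy of `S(g[1])` for `dS₁`. -/
def hS : Module.End k g.S := -(D.cpE_isNatDiag.fc (fun n => (n : k)⁻¹) * g.derL D.h)

theorem hS_apply (a : g.S) :
    D.hS a = -D.cpE_isNatDiag.fc (fun n => (n : k)⁻¹) (g.derL D.h a) := rfl

theorem fc_derL_h (c : ℕ → k) (a : g.S) :
    D.cpE_isNatDiag.fc c (g.derL D.h a) = g.derL D.h (D.cpE_isNatDiag.fc c a) :=
  D.cpE_isNatDiag.fc_comm D.cpE_isNatDiag (g.derL D.h) (D.cpE_derL D.h_mem D.prL_h) c a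

theorem fc_derL_d (c : ℕ → k) (a : g.S) :
    D.cpE_isNatDiag.fc c (g.derL g.d a) = g.derL g.d (D.cpE_isNatDiag.fc c a) :=
  D.cpE_isNatDiag.fc_comm D.cpE_isNatDiag (g.derL g.d) (D.cpE_derL g.isHomogMap_d D.prL_d) c a

/-- The derivations extending `d` and `h` have as graded commutator the derivation extending d h + h
d = 1 - `prL`, which counts acyclic factors. Dividing by this count contracts every part on which it
is positive; the signs in `dS₁` and `hS` cancel. -/
theorem dS₁_hS (a : g.S) : g.dS₁ (D.hS a) + D.hS (g.dS₁ a) = a - D.π a := by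
  have h1 := g.derL_comm (γ := LinearMap.id - D.prL) g.isHomogMap_d D.h_mem (fun i x _ => by
    have := D.d_h x
    simp only [LinearMap.sub_apply, LinearMap.id_apply, prL_apply, ← this]
    simp [Units.smul_def]) a
  simp only [dS₁_eq, hS_apply, LinearMap.neg_apply, map_neg, neg_neg, ← fc_derL_d]
  rw [← map_add, h1]
  have h2 := D.cpE_isNatDiag.fc_fc (fun n => (n : k)⁻¹) (fun n => (n : k)) a
  rw [D.cpE_isNatDiag.fc_cast] at h2
  have h3 := D.cpE_isNatDiag.fc_add (fun n => (n : k)⁻¹ * n) (fun n => if n = 0 then 1 else 0) a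
  -- With the convention 0⁻¹ = 0, the function n⁻¹ n is the indicator of n ≠ 0; what is missing is
  -- exactly the projection `π` onto the eigenvalue 0.
  have h4 : (fun n : ℕ => (n : k)⁻¹ * n + if n = 0 then 1 else 0) = fun _ => 1 := by
    funext n
    rcases n with _ | n
    · simp
    · have : ((n + 1 : ℕ) : k) ≠ 0 := Nat.cast_ne_zero.2 n.succ_ne_zero
      simp only [inv_mul_cancel₀ this, Nat.succ_ne_zero, if_false, add_zero]
  rw [h4, D.cpE_isNatDiag.fc_one, ← h2] at h3
  rw [eq_sub_iff_add_eq]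
  refine Eq.trans ?_ h3
  simp only [mul_neg, mul_one, Int.negOnePow_neg, Int.negOnePow_one, Units.neg_smul, one_smul,
    map_add, map_neg]
  rw [neg_add_cancel_comm]
  rfl

theorem hS_hS (a : g.S) : D.hS (D.hS a) = 0 := by
  simp only [hS_apply, map_neg, neg_neg, ← fc_derL_h]
  rw [g.derL_sq (by decide) D.h_mem D.h_h, map_zero, map_zero]

theorem fc_inv_π (a : g.S) : D.cpE_isNatDiag.fc (fun n => (n : k)⁻¹) (D.π a) = 0 := by
  rw [π, Module.End.IsNatDiag.pr, D.cpE_isNatDiag.fc_fc]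
  refine D.cpE_isNatDiag.fc_eq_zero (fun n => ?_) a
  rcases n with _ | n <;> simp

theorem hS_π (a : g.S) : D.hS (D.π a) = 0 := by
  rw [hS_apply, fc_derL_h, fc_inv_π, map_zero, neg_zero]

theorem π_hS (a : g.S) : D.π (D.hS a) = 0 := by
  rw [hS_apply, fc_derL_h, map_neg, D.π_derL D.h_mem D.prL_h]
  have := D.cpE_isNatDiag.fc_comm D.cpE_isNatDiag (D.cpE_isNatDiag.fc fun n => (n : k)⁻¹)
    (fun x => D.cpE_isNatDiag.fc_self _ x) (fun n => if n = 0 then 1 else 0) a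
  rw [π, Module.End.IsNatDiag.pr, this, ← Module.End.IsNatDiag.pr, ← π, fc_inv_π, map_zero,
    neg_zero]

theorem wtE_hS (a : g.S) : g.wtE (D.hS a) = D.hS (g.wtE a) := by
  have := D.cpE_isNatDiag.fc_comm D.cpE_isNatDiag g.wtE
    (fun x => (g.wtE_derL D.isHomogMap_id_sub_prL x).symm) (fun n => (n : k)⁻¹) (g.derL D.h a)
  rw [hS_apply, hS_apply, map_neg, ← this, g.wtE_derL D.h_mem]

theorem degE_hS (a : g.S) : g.degE (D.hS a) = D.hS (g.degE a) - D.hS a := by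
  have := D.cpE_isNatDiag.fc_comm D.cpE_isNatDiag g.degE
    (fun x => g.derL_commute D.isHomogMap_id_sub_prL g.isHomogMap_degL (fun y => by
      have := D.diagL_degL (fun _ => 1) y
      simp only [LinearMap.sub_apply, LinearMap.id_apply, map_sub, sub_right_inj]
      exact this) x) (fun n => (n : k)⁻¹) (g.derL D.h a)
  rw [hS_apply, hS_apply, map_neg, ← this, g.degE_derL D.h_mem]
  simp [add_comm]

/-! ### The number operator on the subalgebra generated by the `e j` -/

/-- The product of the `e j`, for `j` in a list. -/
def word (l : List D.J) : g.S := (l.map fun j => g.ιS (D.e j)).prod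

omit [CharZero k] in
theorem word_cons (j : D.J) (l : List D.J) : D.word (j :: l) = g.ιS (D.e j) * D.word l := by
  simp [word]

theorem π_word (l : List D.J) : D.π (D.word l) = D.word l := by
  induction l with
  | nil => exact D.π_one
  | cons j l ih => rw [word_cons, π_mul, prL_e, ih]

theorem π_mem_span_word (a : g.S) : D.π a ∈ Submodule.span k (Set.range D.word) := by
  induction a using g.S_induction with
  | h1 => exact Submodule.subset_span ⟨[], by simp [word, π_one]⟩
  | hadd a b ha hb => rw [map_add]; exact add_mem ha hb
  | hsmul c a ha => rw [map_smul]; exact Submodule.smul_mem _ _ ha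
  | hmul i x hx a ha =>
    rw [π_mul, prL_apply, map_sum, Finset.sum_mul]
    refine Submodule.sum_mem _ fun j _ => ?_
    rw [map_smul, smul_mul_assoc]
    refine Submodule.smul_mem _ _ ?_
    generalize D.π a = b at ha
    induction ha using Submodule.span_induction with
    | mem x hx =>
      obtain ⟨l, rfl⟩ := hx
      exact Submodule.subset_span ⟨j :: l, D.word_cons j l⟩
    | zero => simp
    | add x y _ _ hx hy => rw [mul_add]; exact add_mem hx hy
    | smul c x _ hx => rw [mul_smul_comm]; exact Submodule.smul_mem _ _ hx

omit [CharZero k] in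
theorem word_perm {l l' : List D.J} (h : l.Perm l') : D.word l = D.word l' ∨ D.word l = -D.word l' := by
  induction h with
  | nil => exact Or.inl rfl
  | cons j _ ih => rw [word_cons, word_cons]; rcases ih with ih | ih <;> simp [ih]
  | swap i j l =>
    simp only [word_cons, ← mul_assoc, g.ιS_comm (D.e_mem j) (D.e_mem i)]
    rcases negOnePow_cases ((D.dg j - 1) * (D.dg i - 1)) with ⟨-, h⟩ | ⟨-, h⟩ <;>
      simp [h, Units.smul_def]
  | trans _ _ h1 h2 => rcases h1 with h1 | h1 <;> rcases h2 with h2 | h2 <;> simp [h1, h2]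

/-- The shift makes an even class odd in g[1]; an odd element anticommutes with itself. -/
theorem e_mul_e {j : D.J} (hj : Even (D.dg j)) : g.ιS (D.e j) * g.ιS (D.e j) = 0 := by
  have h := g.ιS_comm (D.e_mem j) (D.e_mem j)
  have h1 : Odd (D.dg j - 1) := hj.sub_odd odd_one
  rw [Int.negOnePow_odd _ (h1.mul h1)] at h
  have h2 : (2 : k) • (g.ιS (D.e j) * g.ιS (D.e j)) = 0 := by
    rw [two_smul]; nth_rw 1 [h]; simp [Units.smul_def]
  exact (smul_eq_zero.1 h2).resolve_left two_ne_zero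

/-- A repeated fermionic letter can be brought to the front twice at the cost of a sign, where its
square vanishes. -/
theorem word_eq_zero {l : List D.J} (h : ¬(l.filter fun j => Even (D.dg j)).Nodup) :
    D.word l = 0 := by
  obtain ⟨j, hj⟩ := List.exists_duplicate_iff_not_nodup.2 h
  have hev : Even (D.dg j) := by simpa using List.of_mem_filter hj.mem
  obtain ⟨l', hl'⟩ :=
    ((List.duplicate_iff_sublist.1 hj).trans List.filter_sublist).exists_perm_append
  have h0 : D.word (j :: j :: l') = 0 := by
    rw [word_cons, word_cons, ← mul_assoc, D.e_mul_e hev, zero_mul]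
  rcases D.word_perm hl' with h | h <;> simpa [h0] using h

/-- The derivation that is `1` on the bosonic generators and `-1` on the fermionic ones. -/
def kE : Module.End k g.S := g.derL (D.diagL fun j => (((D.dg j - 1).negOnePow : ℤ) : k))

/-- The set of indices of fermionic generators of `S(g[1])`. -/
def fer : Finset D.J := Finset.univ.filter fun j => Even (D.dg j)

/-- The number of bosonic factors plus the number of fermionic generators that do not occur. -/
def nE : Module.End k g.S := D.kE + (D.fer.card : k) • 1

omit [CharZero k] in
theorem nE_apply (a : g.S) : D.nE a = D.kE a + (D.fer.card : k) • a := rfl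

omit [CharZero k] in
theorem kE_word (l : List D.J) : D.kE (D.word l) =
    ((l.filter fun j => ¬Even (D.dg j)).length - (l.filter fun j => Even (D.dg j)).length : k) •
      D.word l := by
  induction l with
  | nil => simp [kE, word, derL_one]
  | cons j l ih =>
    rw [word_cons, kE, g.derL_mul_zero (D.isHomogMap_diagL _), diagL_e, ← kE, ih, map_smul,
      mul_smul_comm, smul_mul_assoc, ← add_smul]
    congr 1
    by_cases h : Even (D.dg j)
    · rw [Int.negOnePow_odd _ (h.sub_odd odd_one)]
      simp [h]
      ring
    · rw [Int.negOnePow_even _ ((Int.not_even_iff_odd.1 h).sub_odd odd_one)]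
      simp only [List.filter_cons, h, not_false_eq_true, decide_true, decide_false, if_true,
        List.length_cons, Units.val_one, Int.cast_one]
      push_cast
      ring

/-- The product of the fermionic generators. -/
def top : g.S := D.word D.fer.toList

/-- If no fermionic letter is repeated, the eigenvalue is the number of bosonic letters plus the
number of absent fermionic ones. It vanishes only when there are no bosonic letters and every
fermionic letter occurs exactly once, so the word is a rearrangement of `top`. -/
theorem word_cases (l : List D.J) : D.word l = 0 ∨ ∃ n : ℕ, D.nE (D.word l) = (n : k) • D.word l ∧
    (n = 0 → D.word l = D.top ∨ D.word l = -D.top) := by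
  by_cases hl : (l.filter fun j => Even (D.dg j)).Nodup
  swap
  · exact Or.inl (D.word_eq_zero hl)
  have hsub : (l.filter fun j => Even (D.dg j)) ⊆ D.fer.toList := fun j hj => by
    simpa [fer] using List.of_mem_filter hj
  have hsp := hl.subperm hsub
  have hle : (l.filter fun j => Even (D.dg j)).length ≤ D.fer.card := by
    simpa using hsp.length_le
  refine Or.inr ⟨(l.filter fun j => ¬Even (D.dg j)).length +
    (D.fer.card - (l.filter fun j => Even (D.dg j)).length), ?_, fun h0 => ?_⟩
  · rw [nE_apply, kE_word, ← add_smul]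
    congr 1
    push_cast [hle]
    ring
  · have h1 : (l.filter fun j => ¬Even (D.dg j)).length = 0 := by omega
    have h2 : D.fer.toList.length ≤ (l.filter fun j => Even (D.dg j)).length := by
      rw [Finset.length_toList]; omega
    have h3 : (l.filter fun j => Even (D.dg j)) = l := by
      rw [List.filter_eq_self]
      rw [List.length_eq_zero_iff, List.filter_eq_nil_iff] at h1
      simpa using h1
    rw [h3] at hsp h2
    exact D.word_perm (hsp.perm_of_length_le h2)

/-- Differentiating successively along the letters strips the word down to 1, which the augmentation
detects. -/
theorem word_ne_zero {l : List D.J} (hl : l.Nodup) : D.word l ≠ 0 := by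
  have hpd : ∀ (l : List D.J) (j : D.J), j ∉ l → g.pd (D.ξ j) (D.word l) = 0 := by
    intro l j hj
    induction l with
    | nil => exact g.pd_one _
    | cons i l ih =>
      rw [List.mem_cons, not_or] at hj
      rw [word_cons, g.pd_mul (fun i x hx h => D.ξ_of_ne j i x hx h) (D.e_mem i), ih hj.2,
        D.ξ_e_of_ne j i hj.1]
      simp [Units.smul_def]
  induction l with
  | nil =>
    intro h
    have := congrArg g.aug h
    simp [word] at this
  | cons j l ih =>
    rw [List.nodup_cons] at hl
    intro h
    have := congrArg (g.pd (D.ξ j)) h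
    rw [word_cons, g.pd_mul (fun i x hx h => D.ξ_of_ne j i x hx h) (D.e_mem j), hpd l j hl.1,
      D.ξ_e_self] at this
    exact ih hl.2 (by simpa [Units.smul_def] using this)

theorem top_ne_zero : D.top ≠ 0 := D.word_ne_zero D.fer.nodup_toList

omit [CharZero k] in
theorem kE_derL {φ : L →ₗ[k] L} (hφ : g.IsHomogMap φ 0)
    (h : ∀ c x, D.diagL c (φ x) = φ (D.diagL c x)) (a : g.S) :
    D.kE (g.derL φ a) = g.derL φ (D.kE a) :=
  g.derL_commute (D.isHomogMap_diagL _) hφ (h _) a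

omit [CharZero k] in
theorem nE_derL {φ : L →ₗ[k] L} (hφ : g.IsHomogMap φ 0)
    (h : ∀ c x, D.diagL c (φ x) = φ (D.diagL c x)) (a : g.S) :
    D.nE (g.derL φ a) = g.derL φ (D.nE a) := by
  rw [nE_apply, D.kE_derL hφ h, nE_apply, map_add, map_smul]

omit [CharZero k] in
theorem nE_wtE (a : g.S) : D.nE (g.wtE a) = g.wtE (D.nE a) :=
  D.nE_derL g.isHomogMap_id (fun _ _ => rfl) a

omit [CharZero k] in
theorem nE_degE (a : g.S) : D.nE (g.degE a) = g.degE (D.nE a) :=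
  D.nE_derL g.isHomogMap_degL D.diagL_degL a

theorem π_nE (a : g.S) : D.π (D.nE a) = D.nE (D.π a) := by
  rw [nE_apply, map_add, kE, D.π_derL (D.isHomogMap_diagL _) (fun x => D.diagL_diagL _ _ x), nE_apply,
    map_smul]
  rfl

/-- The number operator, composed with the projection `π`. -/
def nπ : Module.End k g.S := D.nE * D.π

theorem nπ_apply (a : g.S) : D.nπ a = D.nE (D.π a) := rfl

theorem nπ_π (a : g.S) : D.nπ (D.π a) = D.nπ a := by rw [nπ_apply, π_π, nπ_apply]

theorem π_nπ (a : g.S) : D.π (D.nπ a) = D.nπ a := by rw [nπ_apply, π_nE, π_π]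

/-- The operator is zero on the kernel of `π`, and the image of `π` is spanned by words, which are
eigenvectors or zero. -/
theorem nπ_isNatDiag : D.nπ.IsNatDiag := by
  refine (Submodule.eq_top_iff').2 fun a => ?_
  rw [← sub_add_cancel a (D.π a)]
  refine add_mem (Submodule.mem_iSup_of_mem 0 (Module.End.mem_eigenspace_iff.2 ?_)) ?_
  · rw [map_sub, nπ_π, sub_self]; simp
  · refine Submodule.span_le.2 ?_ (D.π_mem_span_word a)
    rintro _ ⟨l, rfl⟩
    rcases D.word_cases l with h | ⟨n, h, -⟩
    · rw [h]; exact zero_mem _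
    · exact Submodule.mem_iSup_of_mem n
        (Module.End.mem_eigenspace_iff.2 (by rw [nπ_apply, π_word, h]))

/-- The projection onto the line spanned by `top`. -/
def topPr : Module.End k g.S := D.nπ_isNatDiag.pr 0 * D.π

theorem topPr_apply (a : g.S) : D.topPr a = D.nπ_isNatDiag.pr 0 (D.π a) := rfl

theorem nE_top : D.nE D.top = 0 := by
  rw [top, nE_apply, kE_word, ← add_smul]
  have h1 : (D.fer.toList.filter fun j => Even (D.dg j)) = D.fer.toList :=
    List.filter_eq_self.2 fun j hj => by simpa [fer] using hj
  have h2 : (D.fer.toList.filter fun j => ¬Even (D.dg j)) = [] :=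
    List.filter_eq_nil_iff.2 fun j hj => by simpa [fer] using hj
  rw [h1, h2]
  simp

theorem π_top : D.π D.top = D.top := D.π_word _

theorem topPr_top : D.topPr D.top = D.top := by
  rw [topPr_apply, π_top]
  exact D.nπ_isNatDiag.pr_self (by rw [nπ_apply, π_top, nE_top]; simp)

theorem pr_zero_word (l : List D.J) : ∃ c : k, D.nπ_isNatDiag.pr 0 (D.word l) = c • D.top := by
  rcases D.word_cases l with h | ⟨n, h, h'⟩
  · exact ⟨0, by rw [h, map_zero, zero_smul]⟩
  · have hn : D.nπ (D.word l) = (n : k) • D.word l := by rw [nπ_apply, π_word, h]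
    by_cases h0 : n = 0
    · subst h0
      rw [D.nπ_isNatDiag.pr_self hn]
      rcases h' rfl with h | h
      · exact ⟨1, by rw [h, one_smul]⟩
      · exact ⟨-1, by rw [h, neg_smul, one_smul]⟩
    · exact ⟨0, by rw [D.nπ_isNatDiag.pr_of_ne h0 hn, zero_smul]⟩

/-- The kernel of `π`, on which `nπ` vanishes as well, has been discarded by the inner factor `π`.
Among the remaining words only those proportional to `top` have eigenvalue 0. -/
theorem exists_topPr_eq (a : g.S) : ∃ c : k, D.topPr a = c • D.top := by
  rw [topPr_apply]
  generalize hb : D.π a = b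
  have hb' : b ∈ Submodule.span k (Set.range D.word) := hb ▸ D.π_mem_span_word a
  clear hb
  induction hb' using Submodule.span_induction with
  | mem x hx => obtain ⟨l, rfl⟩ := hx; exact D.pr_zero_word l
  | zero => exact ⟨0, by rw [map_zero, zero_smul]⟩
  | add x y _ _ hx hy =>
    obtain ⟨c, hc⟩ := hx
    obtain ⟨c', hc'⟩ := hy
    exact ⟨c + c', by rw [map_add, hc, hc', add_smul]⟩
  | smul r x _ hx =>
    obtain ⟨c, hc⟩ := hx
    exact ⟨r * c, by rw [map_smul, hc, mul_smul]⟩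

theorem exists_topCoeff : ∃ f : g.S →ₗ[k] k, (∀ a, D.topPr a = f a • D.top) ∧ f D.top = 1 := by
  obtain ⟨f, hf⟩ := Module.Projective.exists_dual_eq_one k D.top_ne_zero
  refine ⟨f ∘ₗ D.topPr, fun a => ?_, ?_⟩
  · obtain ⟨c, hc⟩ := D.exists_topPr_eq a
    rw [LinearMap.comp_apply, hc, map_smul, hf, smul_eq_mul, mul_one]
  · rw [LinearMap.comp_apply, topPr_top, hf]

/-- The coefficient of `top`. -/
def topCoeff : g.S →ₗ[k] k := D.exists_topCoeff.choose

theorem topPr_eq (a : g.S) : D.topPr a = D.topCoeff a • D.top := D.exists_topCoeff.choose_spec.1 a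

theorem topCoeff_top : D.topCoeff D.top = 1 := D.exists_topCoeff.choose_spec.2

/-- Such a `T` commutes with the projection onto the line of `top`, so the coefficient of `top` only
sees the scalar by which `T` acts on that line. -/
theorem topCoeff_of_commute (T : Module.End k g.S) (hπ : ∀ a, D.π (T a) = T (D.π a))
    (hn : ∀ a, D.nE (T a) = T (D.nE a)) {c : k} (hT : T D.top = c • D.top) (a : g.S) :
    D.topCoeff (T a) = c * D.topCoeff a := by
  have h1 : D.topPr (T a) = T (D.topPr a) := by
    rw [topPr_apply, topPr_apply, hπ]
    exact D.nπ_isNatDiag.fc_comm D.nπ_isNatDiag T (fun x => by rw [nπ_apply, hπ, hn, nπ_apply]) _ _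
  have h2 := congrArg D.topCoeff h1
  rwa [topPr_eq, topPr_eq, map_smul, map_smul, map_smul, hT, map_smul, topCoeff_top, smul_eq_mul,
    smul_eq_mul, smul_eq_mul, mul_one, mul_one, mul_comm] at h2

theorem topCoeff_π (a : g.S) : D.topCoeff (D.π a) = D.topCoeff a := by
  rw [D.topCoeff_of_commute D.π (fun _ => rfl) (fun a => (D.π_nE a).symm) (c := 1)
    (by rw [π_top, one_smul]), one_mul]

theorem topCoeff_nE (a : g.S) : D.topCoeff (D.nE a) = 0 := by
  rw [D.topCoeff_of_commute D.nE D.π_nE (fun _ => rfl) (c := 0)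
    (by rw [nE_top, zero_smul]), zero_mul]

omit [CharZero k] in
theorem wtE_word (l : List D.J) : g.wtE (D.word l) = (l.length : k) • D.word l := by
  induction l with
  | nil => simp [word, wtE_one]
  | cons j l ih =>
    rw [word_cons, wtE_mul, ih, mul_smul_comm, List.length_cons, Nat.cast_succ, add_smul, one_smul,
      add_comm]

omit [CharZero k] in
theorem degE_word (l : List D.J) :
    g.degE (D.word l) = (((l.map fun j => D.dg j - 1).sum : ℤ) : k) • D.word l := by
  induction l with
  | nil => simp [word, degE, derL_one]
  | cons j l ih =>
    rw [word_cons, g.degE_mul (D.e_mem j), ih, mul_smul_comm, List.map_cons, List.sum_cons,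
      Int.cast_add, add_smul]

omit [CharZero k] in
theorem wtE_top : g.wtE D.top = (D.fer.card : k) • D.top := by
  rw [top, wtE_word, Finset.length_toList]

/-- The degree of `top`. -/
def topDeg : ℤ := ∑ j ∈ D.fer, (D.dg j - 1)

omit [CharZero k] in
theorem degE_top : g.degE D.top = (D.topDeg : k) • D.top := by
  rw [top, degE_word, topDeg, Finset.sum_map_toList]

theorem topCoeff_degE (a : g.S) : D.topCoeff (g.degE a) = D.topDeg * D.topCoeff a :=
  D.topCoeff_of_commute _ D.π_degE D.nE_degE D.degE_top a

end Retract

end DGLieAlgebra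

namespace DGLieAlgebra

variable {k : Type u} {L : Type v} [Field k] [AddCommGroup L] [Module k L]
variable (g : DGLieAlgebra k L)

/-! ### Compatibility of `extract` with derivations and gradings -/

/-- The derivation extending `α` is also a coderivation: it acts on the comultiplication by the
signed sum of its actions on the two tensor factors. -/
theorem extract_derL {α : L →ₗ[k] L} {r : ℤ} (hα : g.IsHomogMap α r) (a : g.S) :
    g.extract (g.derL α a) = (TensorProduct.map α LinearMap.id +
      TensorProduct.map (g.shiftSign r) (g.derL α) : L ⊗[k] g.S →ₗ[k] L ⊗[k] g.S)
        (g.extract a) := by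
  induction a using g.S_induction with
  | h1 => simp [derL_one, extract_one]
  | hadd a b ha hb => simp only [map_add, ha, hb]
  | hsmul c a ha => simp only [map_smul, ha]
  | hmul i x hx a ha =>
    have key : (TensorProduct.map α LinearMap.id +
        TensorProduct.map (g.shiftSign r) (g.derL α)) ∘ₗ g.swapMul x = g.swapMul (α x) +
        (r * (i - 1)).negOnePow • (g.swapMul x ∘ₗ (TensorProduct.map α LinearMap.id +
          TensorProduct.map (g.shiftSign r) (g.derL α))) := by
      refine g.tensor_ext fun l z hz b => ?_
      rcases negOnePow_cases i with ⟨hi, ei⟩ | ⟨hi, ei⟩ <;>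
        rcases negOnePow_cases l with ⟨hl, el⟩ | ⟨hl, el⟩ <;>
        rcases negOnePow_cases r with ⟨hr, er⟩ | ⟨hr, er⟩ <;>
        simp [swapMul_tmul _ hx, swapMul_tmul _ (hα hx), g.shiftSign_apply _ hz,
          g.shiftSign_apply _ (hα hz), g.derL_mul hα hx, Units.smul_def,
          negOnePow_mul, Int.negOnePow_add, Int.negOnePow_sub, Int.odd_sub, Int.odd_add,
          Int.even_sub, Int.even_add, hi, ei, hl, el, hr, er, TensorProduct.tmul_add,
          TensorProduct.neg_tmul, TensorProduct.tmul_neg] <;>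
        abel
    have h2 := LinearMap.congr_fun key (g.extract a)
    simp only [LinearMap.comp_apply] at h2
    simp only [extract_mul, map_add, g.derL_mul hα hx, Units.smul_def, map_zsmul, ha, h2]
    simp only [LinearMap.add_apply, LinearMap.smul_apply, LinearMap.comp_apply, map_add,
      TensorProduct.map_tmul, g.shiftSign_apply _ hx, Units.smul_def, LinearMap.id_apply,
      smul_add, TensorProduct.smul_tmul']
    abel

/-- The span of the `z ⊗ b` with `b` of weight less than `n`. -/
def filT (n : ℕ) : Submodule k (L ⊗[k] g.S) :=
  Submodule.span k {t | ∃ i z b, z ∈ g.deg i ∧ b ∈ g.wtE.fil n ∧ z ⊗ₜ b = t}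

/-- The span of the `z ⊗ b` of degree `m`. -/
def degT (m : ℤ) : Submodule k (L ⊗[k] g.S) :=
  Submodule.span k {t | ∃ i z b, z ∈ g.deg i ∧ b ∈ g.degS (m - (i - 1)) ∧ z ⊗ₜ b = t}

/-- The span of the `z ⊗ b` of degree `m` with `b` of weight `n`. -/
def biT (n : ℕ) (m : ℤ) : Submodule k (L ⊗[k] g.S) :=
  Submodule.span k {t | ∃ i z b, z ∈ g.deg i ∧ g.wtE b = (n : k) • b ∧ b ∈ g.degS (m - (i - 1)) ∧
    z ⊗ₜ b = t}

theorem swapMul_mem_degT {i : ℤ} {x : L} (hx : x ∈ g.deg i) {m : ℤ} {t : L ⊗[k] g.S}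
    (ht : t ∈ g.degT m) : g.swapMul x t ∈ g.degT (i - 1 + m) := by
  have : g.degT m ≤ (g.degT (i - 1 + m)).comap (g.swapMul x) := by
    refine Submodule.span_le.2 ?_
    rintro _ ⟨j, z, b, hz, hb, rfl⟩
    simp only [SetLike.mem_coe, Submodule.mem_comap, swapMul_tmul _ hx, g.shiftSign_apply _ hz]
    refine Submodule.subset_span ⟨j, _, _, ?_, ?_, rfl⟩
    · rw [Units.smul_def]; exact zsmul_mem hz _
    · have := g.ιS_mul_mem hx hb
      rwa [← add_sub_assoc] at this
  exact this ht

theorem extract_mem_degT {m : ℤ} {a : g.S} (ha : a ∈ g.degS m) : g.extract a ∈ g.degT m := by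
  refine (g.degS_induction (P := fun m a => a ∈ g.degS m ∧ g.extract a ∈ g.degT m)
    ?_ ?_ ?_ ?_ ?_ ha).2
  · simp
  · exact ⟨g.one_mem_degS, by simp [extract_one]⟩
  · intro n a b ha hb
    rw [map_add]
    exact ⟨add_mem ha.1 hb.1, add_mem ha.2 hb.2⟩
  · intro n c a ha
    rw [map_smul]
    exact ⟨Submodule.smul_mem _ _ ha.1, Submodule.smul_mem _ _ ha.2⟩
  · intro i n x a hx ha
    refine ⟨g.ιS_mul_mem hx ha.1, ?_⟩
    rw [extract_mul]
    exact add_mem (Submodule.subset_span ⟨i, x, a, hx, by rw [add_sub_cancel_left]; exact ha.1, rfl⟩)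
      (g.swapMul_mem_degT hx ha.2)

variable [CharZero k]

theorem extract_mem_filT {n : ℕ} {a : g.S} (ha : a ∈ g.wtE.fil (n + 1)) :
    g.extract a ∈ g.filT n := by
  have : g.wtE.fil (n + 1) ≤ (g.filT n).comap g.extract := by
    refine Module.End.fil_le fun m hm a ha => ?_
    rw [Submodule.mem_comap]
    rcases m with _ | m
    · rw [g.extract_eq_zero (by simpa using ha)]; exact zero_mem _
    · refine Submodule.span_mono ?_ (g.extract_mem_wtT ha)
      rintro _ ⟨i, z, b, hz, hb, rfl⟩
      exact ⟨i, z, b, hz, Module.End.mem_fil (by omega) hb, rfl⟩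
  exact this ha

theorem pr_mem_degS (n : ℕ) {m : ℤ} {a : g.S} (ha : a ∈ g.degS m) :
    g.wtE_isNatDiag.pr n a ∈ g.degS m := by
  rw [mem_degS_iff] at ha ⊢
  have := g.wtE_isNatDiag.fc_comm g.wtE_isNatDiag g.degE
    (fun x => g.wtE_derL g.isHomogMap_degL x) (fun m => if m = n then 1 else 0) a
  rw [Module.End.IsNatDiag.pr, ← this, ha, map_smul]

/-- Weight and degree are known separately. Projecting the second tensor factor onto weight `n`
fixes `extract a` and preserves degrees, which yields a presentation homogeneous for both. -/
theorem extract_mem_biT {n : ℕ} {m : ℤ} {a : g.S} (ha : g.wtE a = ((n + 1 : ℕ) : k) • a)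
    (hm : a ∈ g.degS m) : g.extract a ∈ g.biT n m := by
  have h1 : LinearMap.lTensor L (g.wtE_isNatDiag.pr n) (g.extract a) = g.extract a := by
    have : g.wtT n ≤ LinearMap.eqLocus (LinearMap.lTensor L (g.wtE_isNatDiag.pr n))
        LinearMap.id := by
      refine Submodule.span_le.2 ?_
      rintro _ ⟨i, z, b, hz, hb, rfl⟩
      simp [g.wtE_isNatDiag.pr_self hb]
    exact this (g.extract_mem_wtT ha)
  have h2 : g.degT m ≤ (g.biT n m).comap (LinearMap.lTensor L (g.wtE_isNatDiag.pr n)) := by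
    refine Submodule.span_le.2 ?_
    rintro _ ⟨i, z, b, hz, hb, rfl⟩
    exact Submodule.subset_span
      ⟨i, z, _, hz, g.wtE_isNatDiag.apply_pr n b, g.pr_mem_degS n hb, rfl⟩
  rw [← h1]
  exact h2 (g.extract_mem_degT hm)

/-! ### The symmetric algebra of `g` -/

omit [CharZero k] in
theorem isInternal_shift : DirectSum.IsInternal fun i => g.deg (i - 1) := by
  refine DirectSum.isInternal_submodule_of_iSupIndep_of_iSup_eq_top
    (g.isInternal.submodule_iSupIndep.comp (sub_left_injective (b := (1 : ℤ)))) ?_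
  rw [← g.isInternal.submodule_iSup_eq_top]
  exact (Equiv.subRight (1 : ℤ)).iSup_comp (g := g.deg)

/-- The abelian dg Lie algebra `g[-1]`, so that `S(g[-1][1]) = S(g)`. -/
def shiftAb : DGLieAlgebra k L where
  deg i := g.deg (i - 1)
  isInternal := g.isInternal_shift
  d := -g.d
  d_mem := fun {i x} hx => by
    have := g.d_mem hx
    rw [sub_add_cancel] at this
    rw [add_sub_cancel_right]
    exact neg_mem this
  d_d x := by simp [g.d_d]
  bracket := 0
  bracket_mem := by simp
  bracket_skew := by simp [Units.smul_def]
  jacobi := by simp [Units.smul_def]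
  leibniz := by simp [Units.smul_def]

variable {g} in
omit [CharZero k] in
theorem mem_shiftAb {i : ℤ} {x : L} (hx : x ∈ g.deg i) : x ∈ g.shiftAb.deg (i + 1) := by
  change x ∈ g.deg (i + 1 - 1)
  rwa [add_sub_cancel_right]

variable {g} in
omit [CharZero k] in
theorem isHomogMap_shiftAb {α : L →ₗ[k] L} {r : ℤ} (hα : g.IsHomogMap α r) :
    g.shiftAb.IsHomogMap α r := fun i x hx => by
  have := hα hx
  change _ ∈ g.deg (i + r - 1)
  rwa [sub_add_eq_add_sub] at this

/-- The symmetric algebra `S(g)`. -/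
abbrev Sym : Type (max u v) := g.shiftAb.S

/-- The canonical map `g → S(g)`. -/
abbrev ιSym : L →ₗ[k] g.Sym := g.shiftAb.ιS

omit [CharZero k] in
theorem ιSym_comm {i j : ℤ} {x y : L} (hx : x ∈ g.deg i) (hy : y ∈ g.deg j) :
    g.ιSym x * g.ιSym y = (i * j).negOnePow • (g.ιSym y * g.ιSym x) := by
  simpa using g.shiftAb.ιS_comm (mem_shiftAb hx) (mem_shiftAb hy)

omit [CharZero k] in
theorem shiftAb_shiftSign (n : ℤ) {i : ℤ} {x : L} (hx : x ∈ g.deg i) :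
    g.shiftAb.shiftSign n x = (n * i).negOnePow • x := by
  simpa using g.shiftAb.shiftSign_apply n (mem_shiftAb hx)

omit [CharZero k] in
theorem shiftAb_swapMul {i j : ℤ} {x y : L} (hx : x ∈ g.deg i) (hy : y ∈ g.deg j) (b : g.Sym) :
    g.shiftAb.swapMul x (y ⊗ₜ b) = (i * j).negOnePow • (y ⊗ₜ (g.ιSym x * b)) := by
  rw [g.shiftAb.swapMul_tmul (mem_shiftAb hx), add_sub_cancel_right, g.shiftAb_shiftSign i hy,
    Units.smul_def, Units.smul_def, TensorProduct.smul_tmul']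

omit [CharZero k] in
theorem ιSym_mul_mem {i n : ℤ} {x : L} {a : g.Sym} (hx : x ∈ g.deg i)
    (ha : a ∈ g.shiftAb.degS n) : g.ιSym x * a ∈ g.shiftAb.degS (n + i) := by
  have := g.shiftAb.ιS_mul_mem (mem_shiftAb hx) ha
  rwa [add_sub_cancel_right, add_comm] at this

theorem ιSym_mul_mem_fil {n : ℕ} (x : L) {a : g.Sym} (ha : a ∈ g.shiftAb.wtE.fil n) :
    g.ιSym x * a ∈ g.shiftAb.wtE.fil (n + 1) := by
  have : g.shiftAb.wtE.fil n ≤ (g.shiftAb.wtE.fil (n + 1)).comap (LinearMap.mulLeft k (g.ιSym x)) :=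
    Module.End.fil_le fun m hm a ha => Module.End.mem_fil (m := m + 1) (by omega) (by
      rw [LinearMap.mulLeft_apply, wtE_mul, ha, mul_smul_comm, Nat.cast_succ, add_smul, one_smul,
        add_comm])
  exact this ha

/-- The differential of `S(g)`. -/
abbrev dSym : Module.End k g.Sym := g.shiftAb.dS₁

omit [CharZero k] in
-- The sign put into the differential of `shiftAb` compensates the sign in `dS₁`, so that S(g)
-- carries the derivation extending `d` itself.
theorem dSym_eq : g.dSym = g.shiftAb.derL g.d := by
  change -g.shiftAb.derL (-g.d) = _
  rw [derL_neg, neg_neg]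

/-! ### Symmetrization -/

/-- For `f : S(g) → U(g)`, the map `y ⊗ s ↦ y f(s)`. -/
def mulU (f : g.Sym →ₗ[k] g.U) : L ⊗[k] g.Sym →ₗ[k] g.U :=
  TensorProduct.lift ((LinearMap.mul k g.U ∘ₗ g.ιU).compl₂ f)

omit [CharZero k] in
theorem mulU_tmul (f : g.Sym →ₗ[k] g.U) (y : L) (s : g.Sym) :
    g.mulU f (y ⊗ₜ s) = g.ιU y * f s := by simp [mulU]

/-- Averaging over permutations obeys a recursion on the first factor: n σ(y₁⋯yₙ) is the signed sum
of the products of yᵢ with σ of the remaining factors. The recursion is taken as the definition and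
solved by `exists_fixed`, its right-hand side involving only smaller weight. -/
theorem exists_symm : ∃ σ : g.Sym →ₗ[k] g.U, σ 1 = 1 ∧
    ∀ s, σ (g.shiftAb.wtE s) = g.mulU σ (g.shiftAb.extract s) := by
  -- The augmentation supplies the initial value in weight 0, where `extract` vanishes.
  let F : (g.Sym →ₗ[k] g.U) → (g.Sym →ₗ[k] g.U) := fun f =>
    g.shiftAb.aug.toLinearMap.smulRight (1 : g.U) + g.mulU f ∘ₗ g.shiftAb.extract ∘ₗ
      g.shiftAb.wtE_isNatDiag.fc fun n => (n : k)⁻¹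
  have hF : ∀ f f' : g.Sym →ₗ[k] g.U, True → True → ∀ n,
      (∀ s ∈ g.shiftAb.wtE.fil n, f s = f' s) →
      ∀ s ∈ g.shiftAb.wtE.fil (n + 1), F f s = F f' s := by
    intro f f' _ _ n hn s hs
    have h1 := g.shiftAb.extract_mem_filT
      (g.shiftAb.wtE_isNatDiag.fc_mem_fil (fun n => (n : k)⁻¹) hs)
    have h2 : g.shiftAb.filT n ≤ LinearMap.eqLocus (g.mulU f) (g.mulU f') := by
      refine Submodule.span_le.2 ?_
      rintro _ ⟨i, z, b, hz, hb, rfl⟩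
      simp [mulU_tmul, hn b hb]
    simp only [F, LinearMap.add_apply, LinearMap.comp_apply]
    rw [show g.mulU f _ = g.mulU f' _ from h2 h1]
  obtain ⟨σ, -, hσ⟩ := g.shiftAb.wtE_isNatDiag.exists_fixed F (fun _ => True) 0
    trivial (fun _ _ => trivial) hF (fun _ _ => trivial)
  have h : ∀ s, σ s = g.shiftAb.aug s • (1 : g.U) + g.mulU σ (g.shiftAb.extract
      (g.shiftAb.wtE_isNatDiag.fc (fun n => (n : k)⁻¹) s)) := fun s =>
    LinearMap.congr_fun hσ.symm s
  refine ⟨σ, ?_, fun s => ?_⟩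
  · rw [h, g.shiftAb.wtE_isNatDiag.fc_apply (n := 0) _ (by simp [wtE_one])]
    simp
  · refine g.shiftAb.wtE_isNatDiag.induction
      (P := fun s => σ (g.shiftAb.wtE s) = g.mulU σ (g.shiftAb.extract s)) (by simp)
      (fun a b ha hb => by simp only [map_add, ha, hb]) (fun n s hs => ?_) s
    rcases n with _ | n
    · rw [g.shiftAb.extract_eq_zero (by simpa using hs), hs]
      simp
    · have hn : ((n + 1 : ℕ) : k) ≠ 0 := Nat.cast_ne_zero.2 n.succ_ne_zero
      rw [hs, map_smul, h s, g.shiftAb.aug_eq_zero hs,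
        g.shiftAb.wtE_isNatDiag.fc_apply _ hs, map_smul, map_smul, zero_smul, zero_add,
        smul_smul, mul_inv_cancel₀ hn, one_smul]

/-- The symmetrization map `S(g) → U(g)`. -/
def symm : g.Sym →ₗ[k] g.U := g.exists_symm.choose

theorem symm_one : g.symm 1 = 1 := g.exists_symm.choose_spec.1

theorem symm_wtE (s : g.Sym) :
    g.symm (g.shiftAb.wtE s) = g.mulU g.symm (g.shiftAb.extract s) := g.exists_symm.choose_spec.2 s

/-- Induction on the weight: both sides satisfy the same recursion, because `dU` is a derivation of
U(g) and the differential of S(g) is compatible with `extract`. -/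
theorem symm_dSym (s : g.Sym) : g.symm (g.dSym s) = g.dU (g.symm s) := by
  have hd := isHomogMap_shiftAb g.isHomogMap_d
  refine g.shiftAb.wtE_isNatDiag.induction (P := fun s => g.symm (g.dSym s) = g.dU (g.symm s))
    (by simp) (fun a b ha hb => by simp only [map_add, ha, hb]) (fun n s hs => ?_) s
  induction n generalizing s with
  | zero =>
    obtain ⟨c, rfl⟩ : ∃ c : k, s = c • 1 := ⟨_, g.shiftAb.eq_aug (by simpa using hs)⟩
    simp [symm_one, dU_one, dSym_eq, derL_one]
  | succ n ih =>
    have hn : ((n + 1 : ℕ) : k) ≠ 0 := Nat.cast_ne_zero.2 n.succ_ne_zero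
    have h1 : g.symm (g.shiftAb.wtE (g.dSym s)) = g.dU (g.symm (g.shiftAb.wtE s)) := by
      rw [symm_wtE, symm_wtE, dSym_eq, g.shiftAb.extract_derL hd]
      have h2 : g.shiftAb.wtT n ≤ LinearMap.eqLocus (g.mulU g.symm ∘ₗ
          (TensorProduct.map g.d LinearMap.id +
          TensorProduct.map (g.shiftAb.shiftSign 1) (g.shiftAb.derL g.d)))
          (g.dU ∘ₗ g.mulU g.symm) := by
        refine Submodule.span_le.2 ?_
        rintro _ ⟨i, z, b, hz, hb, rfl⟩
        have hz' : z ∈ g.deg (i - 1) := hz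
        have := ih b hb
        rw [dSym_eq] at this
        simp [mulU_tmul, dU_mul, g.shiftAb.shiftSign_apply 1 hz, g.parity_apply hz', this]
      exact h2 (g.shiftAb.extract_mem_wtT hs)
    rw [dSym_eq, g.shiftAb.wtE_derL hd, hs] at h1
    simp only [map_smul] at h1
    rw [dSym_eq]
    exact smul_right_injective _ hn h1

theorem symm_wt {n : ℕ} {s : g.Sym} (hs : g.shiftAb.wtE s = (n : k) • s) :
    (n : k) • g.symm s = g.mulU g.symm (g.shiftAb.extract s) := by
  rw [← symm_wtE, hs, map_smul]

theorem symm_mem {m : ℤ} {s : g.Sym} (hs : s ∈ g.shiftAb.degS m) : g.symm s ∈ g.degU m := by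
  have key : ∀ (n : ℕ) (m : ℤ) (s : g.Sym), g.shiftAb.wtE s = (n : k) • s →
      s ∈ g.shiftAb.degS m → g.symm s ∈ g.degU m := by
    intro n
    induction n with
    | zero =>
      intro m s hs hm
      have h1 := g.shiftAb.eq_aug (by simpa using hs)
      rw [h1, map_smul, symm_one]
      by_cases hm0 : m = 0
      · subst hm0
        exact Submodule.smul_mem _ _ (Submodule.subset_span ⟨[], by simp⟩)
      · rw [mem_degS_iff, h1, degE, map_smul, derL_one, smul_zero, eq_comm, ← h1] at hm
        have : s = 0 := (smul_eq_zero.1 hm).resolve_left (Int.cast_ne_zero.2 hm0)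
        rw [this, map_zero, zero_smul]
        exact zero_mem _
    | succ n ih =>
      intro m s hs hm
      have hn : ((n + 1 : ℕ) : k) ≠ 0 := Nat.cast_ne_zero.2 n.succ_ne_zero
      have h1 : g.shiftAb.biT n m ≤ (g.degU m).comap (g.mulU g.symm) := by
        refine Submodule.span_le.2 ?_
        rintro _ ⟨i, z, b, hz, hb, hb', rfl⟩
        rw [SetLike.mem_coe, Submodule.mem_comap, mulU_tmul]
        have hz' : z ∈ g.deg (i - 1) := hz
        have := g.ιU_mul_mem hz' (ih _ b hb hb')
        rwa [add_sub_cancel] at this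
      have h2 := h1 (g.shiftAb.extract_mem_biT hs hm)
      rw [Submodule.mem_comap, ← g.symm_wt hs] at h2
      exact (Submodule.smul_mem_iff _ hn).1 h2
  have h : ∀ s : g.Sym, s ∈ g.shiftAb.degS m → g.symm s ∈ g.degU m := by
    intro s hs
    obtain ⟨n, hn⟩ := g.shiftAb.wtE_isNatDiag.exists_mem_fil s
    induction n generalizing s with
    | zero =>
      rw [Module.End.fil_zero, Submodule.mem_bot] at hn
      rw [hn, map_zero]; exact zero_mem _
    | succ n ih =>
      have h1 := g.shiftAb.pr_mem_degS n hs
      have h2 := ih _ (sub_mem hs h1) (g.shiftAb.wtE_isNatDiag.sub_pr_mem_fil hn)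
      have h3 := key n m _ (g.shiftAb.wtE_isNatDiag.apply_pr n s) h1
      have := add_mem h2 h3
      rwa [← map_add, sub_add_cancel] at this
  exact h s hs

/-- Left multiplication by `x` on `U(g)` is multiplication by `x` on `S(g)`, up to terms of lower
weight. -/
theorem exists_ιU_mul_symm (n : ℕ) {i : ℤ} {x : L} (hx : x ∈ g.deg i) {m : ℤ} {s : g.Sym}
    (hs : s ∈ g.shiftAb.wtE.fil n) (hm : s ∈ g.shiftAb.degS m) :
    g.ιU x * g.symm s - g.symm (g.ιSym x * s) ∈
      (g.shiftAb.wtE.fil n ⊓ g.shiftAb.degS (m + i)).map g.symm := by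
  induction n generalizing i x m s with
  | zero =>
    rw [Module.End.fil_zero, Submodule.mem_bot] at hs
    simp [hs]
  | succ n ih =>
    have hmono : (g.shiftAb.wtE.fil n ⊓ g.shiftAb.degS (m + i)).map g.symm ≤
        (g.shiftAb.wtE.fil (n + 1) ⊓ g.shiftAb.degS (m + i)).map g.symm :=
      Submodule.map_mono (inf_le_inf_right _ (g.shiftAb.wtE.fil_mono n.le_succ))
    have ih' : ∀ {i : ℤ} {x : L} {m : ℤ} {s : g.Sym}, x ∈ g.deg i → s ∈ g.shiftAb.wtE.fil n →
        s ∈ g.shiftAb.degS m → g.ιU x * g.symm s ∈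
          (g.shiftAb.wtE.fil (n + 1) ⊓ g.shiftAb.degS (m + i)).map g.symm := by
      intro i x m s hx hs hm
      obtain ⟨t, ⟨ht, ht'⟩, h⟩ := ih hx hs hm
      exact ⟨t + g.ιSym x * s, ⟨add_mem (g.shiftAb.wtE.fil_mono n.le_succ ht)
        (g.ιSym_mul_mem_fil x hs), add_mem ht' (g.ιSym_mul_mem hx hm)⟩, by
        rw [map_add, h, sub_add_cancel]⟩
    have key : ∀ s : g.Sym, g.shiftAb.wtE s = (n : k) • s → s ∈ g.shiftAb.degS m →
        g.ιU x * g.symm s - g.symm (g.ιSym x * s) ∈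
          (g.shiftAb.wtE.fil (n + 1) ⊓ g.shiftAb.degS (m + i)).map g.symm := by
      intro s hs hm
      have hn : ((n + 1 : ℕ) : k) ≠ 0 := Nat.cast_ne_zero.2 n.succ_ne_zero
      have hxs : g.shiftAb.wtE (g.ιSym x * s) = ((n + 1 : ℕ) : k) • (g.ιSym x * s) := by
        rw [wtE_mul, hs, mul_smul_comm, Nat.cast_succ, add_smul, one_smul, add_comm]
      have e1 := g.symm_wt hxs
      have e2 := congrArg (g.ιU x * ·) (g.symm_wt hs)
      simp only [mul_smul_comm] at e2
      rw [extract_mul, map_add, mulU_tmul] at e1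
      -- The recursions for the product of x and s, of weight n + 1, and for s, of weight n, are
      -- subtracted. The extra term x σ(s) in the former makes the coefficients match.
      have e3 : ((n + 1 : ℕ) : k) • (g.ιU x * g.symm s - g.symm (g.ιSym x * s)) =
          g.ιU x * g.mulU g.symm (g.shiftAb.extract s) -
            g.mulU g.symm (g.shiftAb.swapMul x (g.shiftAb.extract s)) := by
        rw [smul_sub, e1, Nat.cast_succ, add_smul, e2, one_smul]
        abel
      rw [← Submodule.smul_mem_iff _ hn, e3]
      rcases n with _ | n
      · rw [g.shiftAb.extract_eq_zero (by simpa using hs)]; simp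
      · have : g.shiftAb.biT n m ≤ ((g.shiftAb.wtE.fil (n + 1 + 1) ⊓
            g.shiftAb.degS (m + i)).map g.symm).comap (LinearMap.mulLeft k (g.ιU x) ∘ₗ
              g.mulU g.symm - g.mulU g.symm ∘ₗ g.shiftAb.swapMul x) := by
          refine Submodule.span_le.2 ?_
          rintro _ ⟨j, y, b, hy, hb, hb', rfl⟩
          have hy' : y ∈ g.deg (j - 1) := hy
          have hbf := Module.End.mem_fil n.lt_succ_self hb
          obtain ⟨t, ⟨ht, ht'⟩, h⟩ := ih hx hbf hb'
          have h1 := ih' hy' ht ht'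
          have h2 := ih' (g.bracket_mem hx hy') hbf hb'
          rw [show m - (j - 1) + i + (j - 1) = m + i by ring] at h1
          rw [show m - (j - 1) + (i + (j - 1)) = m + i by ring] at h2
          rw [h] at h1
          have h3 := congrArg (· * g.symm b) (g.ιU_comm hx hy')
          simp only [mul_assoc, add_mul, Units.smul_def, smul_mul_assoc] at h3
          -- Moving x past y in U(g) leaves an instance of the claim for the smaller element b,
          -- multiplied by y, and a bracket term. Both are controlled by the induction hypothesis.
          have h4 : g.ιU x * (g.ιU y * g.symm b) - g.mulU g.symm (g.shiftAb.swapMul x (y ⊗ₜ b)) =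
              ((i * (j - 1)).negOnePow : ℤ) • (g.ιU y * (g.ιU x * g.symm b -
                g.symm (g.ιSym x * b))) + g.ιU (g.bracket x y) * g.symm b := by
            rw [h3, g.shiftAb_swapMul hx hy', Units.smul_def, map_zsmul, mulU_tmul,
              mul_sub (g.ιU y), smul_sub]
            abel
          simp only [SetLike.mem_coe, Submodule.mem_comap, LinearMap.sub_apply,
            LinearMap.comp_apply, LinearMap.mulLeft_apply, mulU_tmul]
          rw [h4]
          exact add_mem (zsmul_mem h1 _) h2
        exact this (g.shiftAb.extract_mem_biT hs hm)
    have h1 := g.shiftAb.pr_mem_degS n hm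
    have h2 := hmono (ih hx (g.shiftAb.wtE_isNatDiag.sub_pr_mem_fil hs) (sub_mem hm h1))
    have := add_mem h2 (key _ (g.shiftAb.wtE_isNatDiag.apply_pr n s) h1)
    rwa [sub_add_sub_comm, ← mul_add, ← map_add, ← map_add, ← mul_add, sub_add_cancel] at this

/-- The image of symmetrization contains 1 and is stable under left multiplication by g, by
`exists_ιU_mul_symm`; the degree is tracked along the way. -/
theorem exists_symm_eq {m : ℤ} {u : g.U} (hu : u ∈ g.degU m) :
    ∃ s ∈ g.shiftAb.degS m, g.symm s = u := by
  refine g.degU_induction (P := fun m u => ∃ s ∈ g.shiftAb.degS m, g.symm s = u) ?_ ?_ ?_ ?_ ?_ hu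
  · exact fun n => ⟨0, zero_mem _, map_zero _⟩
  · exact ⟨1, g.shiftAb.one_mem_degS, g.symm_one⟩
  · rintro n _ _ ⟨a, ha, rfl⟩ ⟨b, hb, rfl⟩
    exact ⟨a + b, add_mem ha hb, map_add _ _ _⟩
  · rintro n c _ ⟨a, ha, rfl⟩
    exact ⟨c • a, Submodule.smul_mem _ _ ha, map_smul _ _ _⟩
  · rintro i n x _ hx ⟨a, ha, rfl⟩
    obtain ⟨N, hN⟩ := g.shiftAb.wtE_isNatDiag.exists_mem_fil a
    obtain ⟨t, ⟨-, ht⟩, h⟩ := g.exists_ιU_mul_symm N hx hN ha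
    refine ⟨t + g.ιSym x * a, ?_, by rw [map_add, h, sub_add_cancel]⟩
    rw [add_comm i n]
    exact add_mem ht (g.ιSym_mul_mem hx ha)

omit [CharZero k] in
theorem iSup_degU : ⨆ n, g.degU n = ⊤ := by
  refine (Submodule.eq_top_iff').2 fun a => ?_
  induction a using g.U_induction with
  | h1 => exact Submodule.mem_iSup_of_mem 0 (Submodule.subset_span ⟨[], by simp⟩)
  | hadd a b ha hb => exact add_mem ha hb
  | hsmul c a ha => exact Submodule.smul_mem _ _ ha
  | hmul i x hx a ha =>
    induction ha using Submodule.iSup_induction' with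
    | mem n a ha => exact Submodule.mem_iSup_of_mem _ (g.ιU_mul_mem hx ha)
    | zero => simp
    | add a b _ _ ha hb => rw [mul_add]; exact add_mem ha hb

theorem symm_surjective : Function.Surjective g.symm := by
  rw [← LinearMap.range_eq_top, ← top_le_iff, ← iSup_degU]
  refine iSup_le fun m u hu => ?_
  obtain ⟨s, -, rfl⟩ := g.exists_symm_eq hu
  exact ⟨s, rfl⟩

end DGLieAlgebra

namespace DGLieAlgebra

variable {k : Type u} {L : Type v} [Field k] [AddCommGroup L] [Module k L]
variable (g : DGLieAlgebra k L)

/-! ### Injectivity of the symmetrization map -/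

/-- The difference of `Q x` and the multiplication by `x`. -/
def corr (Q : L →ₗ[k] Module.End k g.Sym) : L →ₗ[k] Module.End k g.Sym :=
  Q - LinearMap.mul k g.Sym ∘ₗ g.ιSym

theorem corr_apply (Q : L →ₗ[k] Module.End k g.Sym) (x : L) (s : g.Sym) :
    g.corr Q x s = Q x s - g.ιSym x * s := rfl

theorem apply_eq_corr (Q : L →ₗ[k] Module.End k g.Sym) (x : L) (s : g.Sym) :
    Q x s = g.ιSym x * s + g.corr Q x s := by rw [corr_apply]; abel

/-- The defect of `Q` from being a representation, `Q [x, y] - Q x (corr y) + (±) Q y (corr x)`. -/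
def defect (Q : L →ₗ[k] Module.End k g.Sym) : L →ₗ[k] L →ₗ[k] Module.End k g.Sym :=
  g.bracket.compr₂ Q - (LinearMap.mul k (Module.End k g.Sym)).compl₁₂ Q (g.corr Q) +
    g.homogLift fun i => (LinearMap.mul k (Module.End k g.Sym)).flip.compl₁₂ (g.corr Q)
      (Q ∘ₗ g.shiftAb.shiftSign i)

theorem defect_apply (Q : L →ₗ[k] Module.End k g.Sym) {i j : ℤ} {x y : L} (hx : x ∈ g.deg i)
    (hy : y ∈ g.deg j) (s : g.Sym) :
    g.defect Q x y s = Q (g.bracket x y) s - Q x (g.corr Q y s) +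
      (i * j).negOnePow • Q y (g.corr Q x s) := by
  rcases negOnePow_cases (i * j) with ⟨-, e⟩ | ⟨-, e⟩ <;>
    simp [defect, g.homogLift_apply _ hx, g.shiftAb_shiftSign i hy, e]

theorem defect_swap (Q : L →ₗ[k] Module.End k g.Sym) {i j : ℤ} {x y : L} (hx : x ∈ g.deg i)
    (hy : y ∈ g.deg j) (s : g.Sym) :
    g.defect Q y x s = -((i * j).negOnePow • g.defect Q x y s) := by
  have h := congrArg (fun w => Q w s) (g.bracket_skew hy hx)
  rw [mul_comm j i] at h
  rw [g.defect_apply Q hx hy, g.defect_apply Q hy hx, mul_comm j i]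
  rcases negOnePow_cases (i * j) with ⟨-, e⟩ | ⟨-, e⟩ <;>
    simp [e] at h ⊢ <;> simp only [h] <;> abel

/-- `Q` respects the relations of `U(g)` on `s`. -/
def RelAt (Q : L →ₗ[k] Module.End k g.Sym) (s : g.Sym) : Prop :=
  ∀ ⦃i j : ℤ⦄ ⦃x y : L⦄, x ∈ g.deg i → y ∈ g.deg j →
    Q x (Q y s) = (i * j).negOnePow • Q y (Q x s) + Q (g.bracket x y) s

/-- Splitting `Q` into multiplication and correction turns the relation into an equation for the
correction alone. Its antisymmetrization is prescribed by `defect`, which at a given weight involves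
only corrections of smaller weight. It is the analogue of finding a primitive of a 2-form. -/
theorem relAt_iff (Q : L →ₗ[k] Module.End k g.Sym) (s : g.Sym) :
    g.RelAt Q s ↔ ∀ ⦃i j : ℤ⦄ ⦃x y : L⦄, x ∈ g.deg i → y ∈ g.deg j →
      g.corr Q x (g.ιSym y * s) - (i * j).negOnePow • g.corr Q y (g.ιSym x * s) =
        g.defect Q x y s := by
  refine forall₄_congr fun i j x y => forall₂_congr fun hx hy => ?_
  have h := congrArg (· * s) (g.ιSym_comm hx hy)
  have e1 := g.apply_eq_corr Q x (g.ιSym y * s)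
  have e2 := g.apply_eq_corr Q y (g.ιSym x * s)
  have e3 := congrArg (Q x) (g.apply_eq_corr Q y s)
  have e4 := congrArg (Q y) (g.apply_eq_corr Q x s)
  rw [map_add] at e3 e4
  rw [g.defect_apply Q hx hy, e3, e4, e1, e2]
  rcases negOnePow_cases (i * j) with ⟨-, e⟩ | ⟨-, e⟩ <;>
    simp [e, mul_assoc] at h ⊢ <;> simp only [h, ← sub_eq_zero (b := _ + _),
      ← sub_eq_zero (b := _ - _), ← sub_eq_zero (b := - _)] <;>
    refine Eq.congr_left ?_ <;> abel

/-- This is the closedness of the 2-form `defect`, the integrability condition for the equation in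
`relAt_iff`. It follows from the Jacobi identity together with the relations at `b` and at its
corrections. -/
theorem defect_jacobi (Q : L →ₗ[k] Module.End k g.Sym) {i j l : ℤ} {x y z : L} (hx : x ∈ g.deg i)
    (hy : y ∈ g.deg j) (hz : z ∈ g.deg l) {b : g.Sym} (hb : g.RelAt Q b)
    (hbx : g.RelAt Q (g.corr Q x b)) (hby : g.RelAt Q (g.corr Q y b))
    (hbz : g.RelAt Q (g.corr Q z b)) :
    (i * l).negOnePow • g.defect Q x y (g.ιSym z * b) +
      (i * j).negOnePow • g.defect Q y z (g.ιSym x * b) +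
      (j * l).negOnePow • g.defect Q z x (g.ιSym y * b) = 0 := by
  have hc : ∀ x y, g.corr Q x (g.ιSym y * b) =
      Q x (Q y b) - Q x (g.corr Q y b) - g.ιSym x * (g.ιSym y * b) := by
    intro x y
    rw [corr_apply, ← map_sub, g.apply_eq_corr Q y b, add_sub_cancel_right]
  have hi : ∀ y, g.ιSym y * b = Q y b - g.corr Q y b := by
    intro y
    rw [g.apply_eq_corr Q, add_sub_cancel_right]
  have m1 := congrArg (· * b) (g.ιSym_comm hx hy)
  have m2 := congrArg (· * b) (g.ιSym_comm hy hz)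
  have m3 := congrArg (· * b) (g.ιSym_comm hz hx)
  have r1 := hbz hx hy
  have r2 := hbx hy hz
  have r3 := hby hz hx
  have s1 := congrArg (Q z) (hb hx hy)
  have s2 := congrArg (Q x) (hb hy hz)
  have s3 := congrArg (Q y) (hb hz hx)
  have t1 := hb (g.bracket_mem hx hy) hz
  have t2 := hb (g.bracket_mem hy hz) hx
  have t3 := hb (g.bracket_mem hz hx) hy
  have q1 := congrArg (fun w => Q w b) (eq_sub_of_add_eq (g.jacobi hx hy hz).symm)
  have q2 := congrArg (fun w => Q w b) (g.bracket_skew hx (g.bracket_mem hy hz))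
  have q3 := congrArg (fun w => Q w b) (congrArg (g.bracket · y) (g.bracket_skew hz hx))
  have q4 := congrArg (fun w => Q w b) (g.bracket_skew hy (g.bracket_mem hx hz))
  simp only [g.defect_apply Q hx hy, g.defect_apply Q hy hz, g.defect_apply Q hz hx, hc]
  -- Commutative products with b are replaced by values of `Q` minus corrections, so that the
  -- relations already known become applicable.
  have hi1 := congrArg (Q (g.bracket x y)) (hi z)
  have hi2 := congrArg (Q (g.bracket y z)) (hi x)
  have hi3 := congrArg (Q (g.bracket z x)) (hi y)
  rw [map_sub] at hi1 hi2 hi3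
  rw [hi1, hi2, hi3]
  rcases negOnePow_cases i with ⟨hi, ei⟩ | ⟨hi, ei⟩ <;>
    rcases negOnePow_cases j with ⟨hj, ej⟩ | ⟨hj, ej⟩ <;>
    rcases negOnePow_cases l with ⟨hl, el⟩ | ⟨hl, el⟩ <;>
    simp [Units.smul_def, negOnePow_mul, Int.negOnePow_add, Int.odd_add, hi, ei, hj, ej, hl, el,
      mul_assoc] at m1 m2 m3 r1 r2 r3 s1 s2 s3 t1 t2 t3 q1 q2 q3 q4 ⊢ <;>
    simp only [m1, m2, m3, r1, r2, r3, s1, s2, s3, t1, t2, t3, q1, q2, q3, q4, map_neg, map_add,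
      map_sub, LinearMap.neg_apply] <;> abel

variable [CharZero k]

/-- The second condition is the homotopy formula of the Poincaré lemma, applied to `defect`. Its
right-hand side only uses corrections at smaller weight, so it is a contracting recursion for `Q`.
-/
theorem exists_rep : ∃ Q : L →ₗ[k] Module.End k g.Sym,
    (∀ n x, ∀ s ∈ g.shiftAb.wtE.fil n, g.corr Q x s ∈ g.shiftAb.wtE.fil n) ∧
    ∀ (n : ℕ) x s, g.shiftAb.wtE s = (n : k) • s → ((n + 1 : ℕ) : k) • g.corr Q x s =
      TensorProduct.lift (g.defect Q x) (g.shiftAb.extract s) := by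
  let T : (L →ₗ[k] Module.End k g.Sym) → L →ₗ[k] L ⊗[k] g.Sym →ₗ[k] g.Sym := fun Q =>
    (TensorProduct.uncurry (RingHom.id k) L g.Sym g.Sym) ∘ₗ g.defect Q
  let c : ℕ → k := fun n => ((n + 1 : ℕ) : k)⁻¹
  let F : (g.Sym →ₗ[k] L →ₗ[k] g.Sym) → (g.Sym →ₗ[k] L →ₗ[k] g.Sym) := fun f =>
    (LinearMap.mul k g.Sym ∘ₗ g.ιSym + LinearMap.lcomp k g.Sym
      (g.shiftAb.extract ∘ₗ g.shiftAb.wtE_isNatDiag.fc c) ∘ₗ T f.flip).flip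
  -- Since `defect` applies `Q` to corrections, the recursion is contracting only if corrections do
  -- not raise the filtration; this is carried along as an invariant.
  let P : (g.Sym →ₗ[k] L →ₗ[k] g.Sym) → Prop := fun f =>
    ∀ n x, ∀ s ∈ g.shiftAb.wtE.fil n, g.corr f.flip x s ∈ g.shiftAb.wtE.fil n
  have hFa : ∀ f x s, F f s x = g.ιSym x * s + TensorProduct.lift (g.defect f.flip x)
      (g.shiftAb.extract (g.shiftAb.wtE_isNatDiag.fc c s)) := fun f x s => rfl
  have h : ∃ f, P f ∧ F f = f := by
    refine g.shiftAb.wtE_isNatDiag.exists_fixed F P (LinearMap.mul k g.Sym ∘ₗ g.ιSym).flip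
      ?_ ?_ ?_ ?_
    · intro n x s hs
      simp [corr_apply]
    · intro f hPf n x s hs
      rw [corr_apply, LinearMap.flip_apply, hFa, add_sub_cancel_left]
      rcases n with _ | n
      · rw [Module.End.fil_zero, Submodule.mem_bot] at hs
        simp [hs]
      have h1 := g.shiftAb.extract_mem_filT (g.shiftAb.wtE_isNatDiag.fc_mem_fil c hs)
      have hQ : ∀ x, ∀ s ∈ g.shiftAb.wtE.fil n, f.flip x s ∈ g.shiftAb.wtE.fil (n + 1) := by
        intro x s hs
        rw [apply_eq_corr]
        exact add_mem (g.ιSym_mul_mem_fil x hs) (g.shiftAb.wtE.fil_mono n.le_succ (hPf n x s hs))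
      have h2 : g.shiftAb.filT n ≤ (g.shiftAb.wtE.fil (n + 1)).comap
          (TensorProduct.lift (g.defect f.flip x)) := by
        refine Submodule.span_le.2 ?_
        rintro _ ⟨j, y, b, hy, hb, rfl⟩
        rw [SetLike.mem_coe, Submodule.mem_comap, TensorProduct.lift.tmul]
        have hy' : y ∈ g.deg (j - 1) := hy
        induction x using g.hom_induction with
        | h0 => simp
        | hadd x x' hx hx' => rw [map_add]; exact add_mem hx hx'
        | hh i x hx =>
          rw [g.defect_apply _ hx hy', Units.smul_def]
          exact add_mem (sub_mem (hQ _ _ hb) (hQ _ _ (hPf _ _ _ hb)))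
            (zsmul_mem (hQ _ _ (hPf _ _ _ hb)) _)
      exact h2 h1
    · intro f f' hPf hPf' n hn s hs
      refine LinearMap.ext fun x => ?_
      rw [hFa, hFa]
      have h1 := g.shiftAb.extract_mem_filT (g.shiftAb.wtE_isNatDiag.fc_mem_fil c hs)
      have h3 : ∀ x, ∀ b ∈ g.shiftAb.wtE.fil n, g.corr f.flip x b = g.corr f'.flip x b := by
        intro x b hb
        simp only [corr_apply, LinearMap.flip_apply, hn b hb]
      have h2 : g.shiftAb.filT n ≤ LinearMap.eqLocus
          (TensorProduct.lift (g.defect f.flip x)) (TensorProduct.lift (g.defect f'.flip x)) := by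
        refine Submodule.span_le.2 ?_
        rintro _ ⟨j, y, b, hy, hb, rfl⟩
        rw [SetLike.mem_coe, LinearMap.mem_eqLocus, TensorProduct.lift.tmul, TensorProduct.lift.tmul]
        have hy' : y ∈ g.deg (j - 1) := hy
        induction x using g.hom_induction with
        | h0 => simp
        | hadd x x' hx hx' => simp only [map_add, LinearMap.add_apply, hx, hx']
        | hh i x hx =>
          rw [g.defect_apply _ hx hy', g.defect_apply _ hx hy', h3 x b hb, h3 y b hb]
          simp only [LinearMap.flip_apply]
          rw [hn b hb, hn _ (hPf' n x b hb), hn _ (hPf' n y b hb)]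
      rw [show TensorProduct.lift (g.defect f.flip x) _ = _ from h2 h1]
    · intro f hf n x s hs
      obtain ⟨f', hf', h⟩ := hf n
      have := hf' n x s hs
      rwa [corr_apply, LinearMap.flip_apply, ← h s hs] at this
  obtain ⟨f, hPf, hf⟩ := h
  refine ⟨f.flip, hPf, fun n x s hs => ?_⟩
  have hn : ((n + 1 : ℕ) : k) ≠ 0 := Nat.cast_ne_zero.2 n.succ_ne_zero
  have h1 := hFa f x s
  rw [hf] at h1
  rw [corr_apply, LinearMap.flip_apply, h1, add_sub_cancel_left,
    g.shiftAb.wtE_isNatDiag.fc_apply _ hs, map_smul, map_smul, smul_smul,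
    mul_inv_cancel₀ hn, one_smul]

variable {g} in
/-- The relations hold everywhere. -/
theorem relAt_of_corr {Q : L →ₗ[k] Module.End k g.Sym}
    (hQ : ∀ n x, ∀ s ∈ g.shiftAb.wtE.fil n, g.corr Q x s ∈ g.shiftAb.wtE.fil n)
    (hQ' : ∀ (n : ℕ) x s, g.shiftAb.wtE s = (n : k) • s → ((n + 1 : ℕ) : k) • g.corr Q x s =
      TensorProduct.lift (g.defect Q x) (g.shiftAb.extract s)) (s : g.Sym) : g.RelAt Q s := by
  obtain ⟨n, hn⟩ := g.shiftAb.wtE_isNatDiag.exists_mem_fil s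
  induction n generalizing s with
  | zero =>
    rw [Module.End.fil_zero, Submodule.mem_bot] at hn
    subst hn
    intro i j x y hx hy
    simp
  | succ n ih =>
    have hadd : ∀ s t, g.RelAt Q s → g.RelAt Q t → g.RelAt Q (s + t) := by
      intro s t hs ht i j x y hx hy
      simp only [map_add, hs hx hy, ht hx hy, smul_add]
      abel
    have key : ∀ s, g.shiftAb.wtE s = (n : k) • s → g.RelAt Q s := by
      intro s hs
      rw [relAt_iff]
      intro i j x y hx hy
      have hm : ∀ x, g.shiftAb.wtE (g.ιSym x * s) = ((n + 1 : ℕ) : k) • (g.ιSym x * s) := by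
        intro x
        rw [wtE_mul, hs, mul_smul_comm, Nat.cast_succ, add_smul, one_smul, add_comm]
      have hn : ((n + 1 + 1 : ℕ) : k) ≠ 0 := Nat.cast_ne_zero.2 n.succ.succ_ne_zero
      have e1 := hQ' (n + 1) x _ (hm y)
      have e2 := hQ' (n + 1) y _ (hm x)
      rw [extract_mul, map_add, TensorProduct.lift.tmul] at e1 e2
      -- Closedness, summed over the factors z of s: the cyclic identity trades the two sums for the
      -- value of `defect` at x, y on the sum of the products z b, which is `wtE s`.
      have e3 : TensorProduct.lift (g.defect Q x) (g.shiftAb.swapMul y (g.shiftAb.extract s)) -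
          (i * j).negOnePow • TensorProduct.lift (g.defect Q y)
            (g.shiftAb.swapMul x (g.shiftAb.extract s)) = g.defect Q x y (g.shiftAb.wtE s) := by
        rcases n with _ | n
        · rw [g.shiftAb.extract_eq_zero (by simpa using hs), hs]; simp [Units.smul_def]
        have : g.shiftAb.wtT n ≤ LinearMap.eqLocus
            (TensorProduct.lift (g.defect Q x) ∘ₗ g.shiftAb.swapMul y - (i * j).negOnePow •
              (TensorProduct.lift (g.defect Q y) ∘ₗ g.shiftAb.swapMul x))
            (g.defect Q x y ∘ₗ TensorProduct.lift (LinearMap.mul k g.Sym ∘ₗ g.ιSym)) := by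
          refine Submodule.span_le.2 ?_
          rintro _ ⟨l, z, b, hz, hb, rfl⟩
          have hz' : z ∈ g.deg (l - 1) := hz
          have hb' := Module.End.mem_fil n.lt_succ_self hb
          have h1 := g.defect_jacobi Q hx hy hz' (ih _ hb') (ih _ (hQ _ x _ hb'))
            (ih _ (hQ _ y _ hb')) (ih _ (hQ _ z _ hb'))
          rw [g.defect_swap Q hx hz'] at h1
          simp only [SetLike.mem_coe, LinearMap.mem_eqLocus, LinearMap.sub_apply,
            LinearMap.smul_apply, LinearMap.comp_apply, g.shiftAb_swapMul hx hz',
            g.shiftAb_swapMul hy hz', TensorProduct.lift.tmul, Units.smul_def, map_zsmul,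
            LinearMap.mul_apply']
          generalize l - 1 = l' at *
          rcases negOnePow_cases i with ⟨hi, ei⟩ | ⟨hi, ei⟩ <;>
            rcases negOnePow_cases j with ⟨hj, ej⟩ | ⟨hj, ej⟩ <;>
            rcases negOnePow_cases l' with ⟨hl, el⟩ | ⟨hl, el⟩ <;>
            simp [Units.smul_def, negOnePow_mul, hi, ei, hj, ej, hl, el] at h1 ⊢ <;>
            first
            | linear_combination (norm := abel1) h1
            | linear_combination (norm := abel1) -h1
        exact this (g.shiftAb.extract_mem_wtT hs)
      have e4 := g.defect_swap Q hx hy s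
      rw [hs, map_smul] at e3
      refine smul_right_injective _ hn (?_ : ((n + 1 + 1 : ℕ) : k) • _ = ((n + 1 + 1 : ℕ) : k) • _)
      -- Of the n + 2 copies, two come from extracting y and x themselves, and n from closedness on
      -- the factors of s.
      have e5 : ((n + 1 + 1 : ℕ) : k) • g.defect Q x y s = g.defect Q x y s + g.defect Q x y s +
          (n : k) • g.defect Q x y s := by
        push_cast
        simp only [add_smul, one_smul]
        abel
      rw [smul_sub, Units.smul_def, smul_comm, e1, e2, e4, e5, ← e3]
      rcases negOnePow_cases (i * j) with ⟨-, e⟩ | ⟨-, e⟩ <;>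
        simp [e] <;> abel
    have := hadd _ _ (ih _ (g.shiftAb.wtE_isNatDiag.sub_pr_mem_fil hn))
      (key _ (g.shiftAb.wtE_isNatDiag.apply_pr n s))
    rwa [sub_add_cancel] at this

/-- Letting σ(s) act on 1 through the representation of `exists_rep` returns s up to smaller weight,
so a kernel element lies in every step of the filtration below its own and hence vanishes. -/
theorem symm_injective : Function.Injective g.symm := by
  obtain ⟨Q, hQ, hQ'⟩ := g.exists_rep
  let ρ : g.U →ₐ[k] Module.End k g.Sym := g.liftU Q fun {i j x y} hx hy => LinearMap.ext fun s => by
    have := relAt_of_corr hQ hQ' s hx hy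
    rcases negOnePow_cases (i * j) with ⟨-, e⟩ | ⟨-, e⟩ <;> simpa [e] using this
  have hρ : ∀ n, ∀ s ∈ g.shiftAb.wtE.fil (n + 1), ρ (g.symm s) 1 - s ∈ g.shiftAb.wtE.fil n := by
    intro n
    induction n with
    | zero =>
      have : g.shiftAb.wtE.fil (0 + 1) ≤ (g.shiftAb.wtE.fil 0).comap
          (LinearMap.applyₗ (1 : g.Sym) ∘ₗ ρ.toLinearMap ∘ₗ g.symm - LinearMap.id) := by
        refine Module.End.fil_le fun m hm s hs => ?_
        obtain rfl : m = 0 := by omega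
        obtain ⟨c, rfl⟩ : ∃ c : k, s = c • 1 := ⟨_, g.shiftAb.eq_aug (by simpa using hs)⟩
        simp [symm_one]
      exact fun s hs => this hs
    | succ n ih =>
      have : g.shiftAb.wtE.fil (n + 1 + 1) ≤ (g.shiftAb.wtE.fil (n + 1)).comap
          (LinearMap.applyₗ (1 : g.Sym) ∘ₗ ρ.toLinearMap ∘ₗ g.symm - LinearMap.id) := by
        refine Module.End.fil_le fun m hm s hs => ?_
        rw [Submodule.mem_comap]
        change ρ (g.symm s) 1 - s ∈ _
        by_cases hmn : m < n + 1
        · exact g.shiftAb.wtE.fil_mono n.le_succ (ih s (Module.End.mem_fil hmn hs))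
        obtain rfl : m = n + 1 := by omega
        have hn : ((n + 1 : ℕ) : k) ≠ 0 := Nat.cast_ne_zero.2 n.succ_ne_zero
        have h1 := g.symm_wt hs
        rw [← Submodule.smul_mem_iff _ hn, smul_sub, ← LinearMap.smul_apply, ← map_smul, h1, ← hs]
        have h2 : g.shiftAb.wtT n ≤ (g.shiftAb.wtE.fil (n + 1)).comap
            (LinearMap.applyₗ (1 : g.Sym) ∘ₗ ρ.toLinearMap ∘ₗ g.mulU g.symm -
              TensorProduct.lift (LinearMap.mul k g.Sym ∘ₗ g.ιSym)) := by
          refine Submodule.span_le.2 ?_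
          rintro _ ⟨l, z, b, hz, hb, rfl⟩
          have hb' := Module.End.mem_fil n.lt_succ_self hb
          have h3 := ih b hb'
          have h4 := g.shiftAb.wtE.fil_mono n.le_succ h3
          have h5 := g.ιSym_mul_mem_fil z h3
          have h6 := hQ (n + 1) z _ (add_mem h4 hb')
          rw [sub_add_cancel, corr_apply] at h6
          have h7 := add_mem h6 h5
          rw [mul_sub, sub_add_sub_cancel] at h7
          simpa [mulU_tmul, ρ, liftU_ι] using h7
        exact h2 (g.shiftAb.extract_mem_wtT hs)
      exact fun s hs => this hs
  rw [injective_iff_map_eq_zero]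
  intro s hs
  obtain ⟨n, hn⟩ := g.shiftAb.wtE_isNatDiag.exists_mem_fil s
  induction n with
  | zero => rwa [Module.End.fil_zero, Submodule.mem_bot] at hn
  | succ n ih =>
    have := hρ n s hn
    rw [hs, map_zero, LinearMap.zero_apply, zero_sub, neg_mem_iff] at this
    exact ih this

/-- The symmetrization isomorphism. -/
def symmEquiv : g.Sym ≃ₗ[k] g.U :=
  LinearEquiv.ofBijective g.symm ⟨g.symm_injective, g.symm_surjective⟩

end DGLieAlgebra

namespace DGLieAlgebra

variable {k : Type u} {L : Type v} [Field k] [AddCommGroup L] [Module k L]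
variable (g : DGLieAlgebra k L)

/-! ### Existence of deformation retractions -/

theorem exists_section (i : ℤ) : ∃ s : L →ₗ[k] L, (∀ x, s x ∈ g.deg (i - 1)) ∧
    ∀ x ∈ g.coboundaries i, g.d (s x) = x := by
  let δ : g.deg (i - 1) →ₗ[k] g.coboundaries i :=
    (g.d ∘ₗ (g.deg (i - 1)).subtype).codRestrict _ fun x => ⟨x, x.2, rfl⟩
  obtain ⟨t, ht⟩ := δ.exists_rightInverse_of_surjective (LinearMap.range_eq_top.2 (by
    rintro ⟨_, x, hx, rfl⟩; exact ⟨⟨x, hx⟩, rfl⟩))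
  obtain ⟨s, hs⟩ := LinearMap.exists_extend t
  refine ⟨(g.deg (i - 1)).subtype ∘ₗ s, fun x => (s x).2, fun x hx => ?_⟩
  have h1 := LinearMap.congr_fun hs ⟨x, hx⟩
  have h2 := congrArg Subtype.val (LinearMap.congr_fun ht ⟨x, hx⟩)
  change s x = t ⟨x, hx⟩ at h1
  change g.d (t ⟨x, hx⟩) = x at h2
  rw [← h1] at h2
  exact h2

theorem exists_homotopy : ∃ h : L →ₗ[k] L, g.IsHomogMap h (-1) ∧ (∀ x, h (h x) = 0) ∧
    (∀ x, g.d (h (g.d x)) = g.d x) ∧ ∀ x, h (g.d (h x)) = h x := by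
  choose s hs hs' using g.exists_section
  let S : L →ₗ[k] L := g.homogLift s
  have hS : g.IsHomogMap S (-1) := fun i x hx => by
    rw [g.homogLift_apply _ hx, ← sub_eq_add_neg]; exact hs i x
  have hdSd : ∀ x, g.d (S (g.d x)) = g.d x := fun x => by
    induction x using g.hom_induction with
    | h0 => simp
    | hadd x y hx hy => simp only [map_add, hx, hy]
    | hh i x hx =>
      rw [g.homogLift_apply _ (g.d_mem hx)]
      exact hs' _ _ ⟨x, by rwa [add_sub_cancel_right], rfl⟩
  -- From d S d = d, this choice gains T d T = T.
  let T : L →ₗ[k] L := S ∘ₗ g.d ∘ₗ S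
  have hT : ∀ x, T x = S (g.d (S x)) := fun _ => rfl
  have hTm : g.IsHomogMap T (-1) := fun i x hx => by
    have := hS (g.d_mem (hS hx))
    rwa [neg_add_cancel_right] at this
  have hdTd : ∀ x, g.d (T (g.d x)) = g.d x := fun x => by rw [hT, hdSd, hdSd]
  have hTdT : ∀ x, T (g.d (T x)) = T x := fun x => by simp only [hT, hdSd]
  -- Passing from T to T - T²d makes the square vanish and keeps the other two identities.
  refine ⟨T ∘ₗ (LinearMap.id - T ∘ₗ g.d), fun i x hx => ?_, fun x => ?_, fun x => ?_, fun x => ?_⟩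
  · refine hTm (sub_mem hx ?_)
    have := hTm (g.d_mem hx)
    rwa [add_neg_cancel_right] at this
  · simp [hTdT]
  · simp [g.d_d, hdTd]
  · simp [g.d_d, hTdT]

/-- The summands embed as independent subspaces of a finite-dimensional space, so only finitely many
of them are nonzero. -/
theorem finite_H (hg : g.IsProper) : (∀ i, FiniteDimensional k (g.H i)) ∧
    ∃ s : Finset ℤ, ∀ i, i ∉ s → Subsingleton (g.H i) := by
  have : FiniteDimensional k (⨁ i : ℤ, g.H i) := hg
  have hinj : ∀ i, Function.Injective (DirectSum.lof k ℤ g.H i) := fun i =>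
    DirectSum.of_injective i
  refine ⟨fun i => FiniteDimensional.of_injective _ (hinj i), ?_⟩
  let W : ℤ → Submodule k (⨁ i : ℤ, g.H i) := fun i => LinearMap.range (DirectSum.lof k ℤ g.H i)
  have hW : iSupIndep W := fun i => by
    rw [Submodule.disjoint_def]
    rintro _ ⟨a, rfl⟩ ha
    have hle : (⨆ (j) (_ : j ≠ i), W j) ≤ LinearMap.ker (DirectSum.component k ℤ g.H i) := by
      refine iSup₂_le fun j hj => ?_
      rintro _ ⟨c, rfl⟩
      rw [LinearMap.mem_ker, DirectSum.component.of, dif_neg hj]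
    have h0 := hle ha
    rw [LinearMap.mem_ker, DirectSum.component.lof_self] at h0
    rw [h0, map_zero]
  have hfin := WellFoundedGT.finite_ne_bot_of_iSupIndep hW
  refine ⟨hfin.toFinset, fun i hi => ?_⟩
  have h0 : W i = ⊥ := by simpa using hi
  refine ⟨fun a b => hinj i ?_⟩
  have : ∀ a, DirectSum.lof k ℤ g.H i a = 0 := fun a => by
    rw [← Submodule.mem_bot k, ← h0]; exact ⟨a, rfl⟩
  rw [this, this]

/-- For a homotopy with the side conditions, p = 1 - d h - h d is a projection onto cocycles. It
kills coboundaries and maps the cohomology in degree i isomorphically onto `W i`. Bases of these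
finitely many images give the `e j`. -/
theorem exists_retract (hg : g.IsProper) : ∃ D : g.Retract,
    ∑ j, (if Even (D.dg j) then 1 - D.dg j else D.dg j) = g.totalDegree := by
  obtain ⟨hfd, s, hs⟩ := g.finite_H hg
  obtain ⟨h, h_mem, h_h, dhd, hdh⟩ := g.exists_homotopy
  let p : L →ₗ[k] L := LinearMap.id - g.d ∘ₗ h - h ∘ₗ g.d
  have hp : ∀ x, p x = x - g.d (h x) - h (g.d x) := fun _ => rfl
  have p_mem : ∀ {i x}, x ∈ g.deg i → p x ∈ g.deg i := fun {i x} hx => by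
    have h1 := g.d_mem (h_mem hx)
    have h2 := h_mem (g.d_mem hx)
    rw [neg_add_cancel_right] at h1
    rw [add_neg_cancel_right] at h2
    exact sub_mem (sub_mem hx h1) h2
  have p_d : ∀ x, p (g.d x) = 0 := fun x => by rw [hp, dhd, g.d_d]; simp
  have p_h : ∀ x, p (h x) = 0 := fun x => by rw [hp, hdh, h_h]; simp
  have d_p : ∀ x, g.d (p x) = 0 := fun x => by rw [hp, map_sub, map_sub, dhd, g.d_d]; simp
  have h_p : ∀ x, h (p x) = 0 := fun x => by rw [hp, map_sub, map_sub, hdh, h_h]; simp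
  have p_p : ∀ x, p (p x) = p x := fun x => by rw [hp (p x), d_p, h_p]; simp
  let W : ℤ → Submodule k L := fun i => (g.deg i).map p
  have hWd : ∀ i, ∀ x ∈ W i, x ∈ g.deg i := by
    rintro i _ ⟨x, hx, rfl⟩; exact p_mem hx
  have hWp : ∀ i, ∀ x ∈ W i, p x = x := by
    rintro i _ ⟨x, hx, rfl⟩; exact p_p x
  have hWH : ∀ i, Nonempty (g.H i ≃ₗ[k] W i) := by
    intro i
    let φ : g.cocycles i →ₗ[k] W i :=
      (p ∘ₗ (g.cocycles i).subtype).codRestrict _ fun x => ⟨x, x.2.1, rfl⟩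
    have hφ : (g.coboundaries i).submoduleOf (g.cocycles i) = LinearMap.ker φ := by
      ext x
      rw [LinearMap.mem_ker, ← Subtype.val_inj]
      change _ ↔ p x = 0
      rw [Submodule.submoduleOf, Submodule.mem_comap]
      constructor
      · rintro ⟨y, hy, hyx⟩
        rw [← p_d y]
        exact congrArg p hyx.symm
      · intro hx
        refine ⟨h x, h_mem x.2.1, ?_⟩
        have h0 : g.d (x : L) = 0 := x.2.2
        rw [hp, h0, map_zero, sub_zero, sub_eq_zero] at hx
        exact hx.symm
    have hφs : Function.Surjective φ := by
      rintro ⟨_, x, hx, rfl⟩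
      exact ⟨⟨p x, p_mem hx, d_p x⟩, Subtype.ext (p_p x)⟩
    exact ⟨(Submodule.quotEquivOfEq _ _ hφ).trans (φ.quotKerEquivOfSurjective hφs)⟩
  have hWf : ∀ i, FiniteDimensional k (W i) := fun i => (hWH i).some.finiteDimensional
  have hrank : ∀ i, Module.finrank k (g.H i) = Module.finrank k (W i) := fun i =>
    (hWH i).some.finrank_eq
  have hW0 : ∀ i, i ∉ s → ∀ x ∈ W i, x = 0 := by
    intro i hi x hx
    have := hs i hi
    have : Subsingleton (W i) := (hWH i).some.symm.toEquiv.subsingleton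
    exact congrArg Subtype.val (Subsingleton.elim (⟨x, hx⟩ : W i) 0)
  let b : ∀ i, Module.Basis (Fin (Module.finrank k (W i))) k (W i) := fun i => Module.finBasis k (W i)
  have hext : ∀ i (a : Fin (Module.finrank k (W i))), ∃ φ : L →ₗ[k] k,
      ∀ x (hx : x ∈ W i), φ x = (b i).coord a ⟨x, hx⟩ := by
    intro i a
    obtain ⟨φ, hφ⟩ := LinearMap.exists_extend ((b i).coord a)
    exact ⟨φ, fun x hx => LinearMap.congr_fun hφ ⟨x, hx⟩⟩
  choose φ hφ using hext
  -- The coordinate functionals are precomposed with p, so that they vanish on the images of d and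
  -- h, and are cut off outside degree i.
  let ξ : ∀ i, Fin (Module.finrank k (W i)) → L →ₗ[k] k := fun i a =>
    g.homogLift fun j => if j = i then φ i a ∘ₗ p else 0
  have hξ : ∀ i a x, x ∈ g.deg i → ξ i a x = φ i a (p x) := fun i a x hx => by
    simp only [ξ, g.homogLift_apply _ hx, if_true, LinearMap.comp_apply]
  have hξ0 : ∀ i a j x, x ∈ g.deg j → j ≠ i → ξ i a x = 0 := fun i a j x hx hj => by
    simp only [ξ, g.homogLift_apply _ hx, if_neg hj, LinearMap.zero_apply]
  have hξp : ∀ i a {r : ℤ} (α : L →ₗ[k] L), g.IsHomogMap α r → (∀ x, p (α x) = 0) → ∀ x,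
      ξ i a (α x) = 0 := by
    intro i a r α hα h x
    induction x using g.hom_induction with
    | h0 => simp
    | hadd x y hx hy => simp only [map_add, hx, hy, add_zero]
    | hh j x hx =>
      by_cases hj : j + r = i
      · rw [hξ i a _ (hj ▸ hα hx), h, map_zero]
      · exact hξ0 i a _ _ (hα hx) hj
  let e : ∀ i, Fin (Module.finrank k (W i)) → L := fun i a => b i a
  have heW : ∀ i a, e i a ∈ W i := fun i a => (b i a).2
  have hξe : ∀ i a c, ξ i a (e i c) = if c = a then 1 else 0 := fun i a c => by
    rw [hξ i a _ (hWd _ _ (heW i c)), hWp _ _ (heW i c), hφ i a _ (heW i c)]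
    simp [e, Finsupp.single_apply]
  let D : g.Retract :=
    { J := Σ i : s, Fin (Module.finrank k (W i))
      dg := fun j => j.1
      e := fun j => e j.1 j.2
      e_mem := fun j => hWd _ _ (heW _ _)
      ξ := fun j => ξ j.1 j.2
      ξ_of_ne := fun j i x hx hi => hξ0 _ _ i x hx hi
      ξ_e_self := fun j => by rw [hξe, if_pos rfl]
      ξ_e_of_ne := by
        rintro ⟨i, a⟩ ⟨j, c⟩ hij
        by_cases h : i = j
        · subst h
          rw [hξe, if_neg fun h => hij (congrArg (Sigma.mk i) h.symm)]
        · exact hξ0 _ _ _ _ (hWd _ _ (heW _ _)) fun h' => h (Subtype.ext h'.symm)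
      h := h
      h_mem := h_mem
      h_h := h_h
      d_e := fun j => by rw [← hWp _ _ (heW _ _), d_p]
      ξ_d := fun j => hξp _ _ g.d g.isHomogMap_d p_d
      h_e := fun j => by rw [← hWp _ _ (heW _ _), h_p]
      ξ_h := fun j => hξp _ _ h h_mem p_h
      d_h := fun x => by
        have key : p x = ∑ j : Σ i : s, Fin (Module.finrank k (W i)), ξ j.1 j.2 x • e j.1 j.2 := by
          rw [Fintype.sum_sigma]
          induction x using g.hom_induction with
          | h0 => simp
          | hadd x y hx hy => simp only [map_add, hx, hy, add_smul, Finset.sum_add_distrib]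
          | hh i x hx =>
            have hpx : p x ∈ W i := ⟨x, hx, rfl⟩
            have h1 : ∀ j : s, (j : ℤ) ≠ i → ∑ a, ξ j a x • e j a = 0 := fun j hj =>
              Finset.sum_eq_zero fun a _ => by rw [hξ0 _ _ i x hx hj.symm, zero_smul]
            by_cases hi : i ∈ s
            · rw [Finset.sum_eq_single ⟨i, hi⟩ (fun j _ hj => h1 j fun h => hj (Subtype.ext h))
                (by simp)]
              have h2 := congrArg Subtype.val ((b i).sum_repr ⟨p x, hpx⟩)
              rw [AddSubmonoidClass.coe_finsetSum] at h2
              change _ = p x at h2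
              rw [← h2]
              refine Finset.sum_congr rfl fun a _ => ?_
              rw [hξ i a x hx, hφ i a _ hpx]
              rfl
            · rw [hW0 i hi _ hpx]
              exact (Finset.sum_eq_zero fun j _ => h1 j fun h => hi (h ▸ j.2)).symm
        rw [← key, hp]; abel }
  refine ⟨D, ?_⟩
  change ∑ j : Σ i : s, Fin (Module.finrank k (W i)),
    (if Even (j.1 : ℤ) then 1 - (j.1 : ℤ) else (j.1 : ℤ)) = _
  rw [Fintype.sum_sigma, totalDegree, finsum_eq_sum_of_support_subset (s := s)]
  · rw [← Finset.sum_coe_sort s]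
    refine Finset.sum_congr rfl fun i _ => ?_
    rw [hrank]
    simp only [Finset.sum_const, Finset.card_univ, Fintype.card_fin, nsmul_eq_mul]
  · intro i hi
    by_contra his
    have := hs i his
    exact hi (by simp [Module.finrank_zero_of_subsingleton])

variable {g}

/-- The retraction of `g[-1]` given by a retraction of `g`. -/
def Retract.shift (D : g.Retract) : g.shiftAb.Retract where
  J := D.J
  dg j := D.dg j + 1
  e := D.e
  e_mem j := mem_shiftAb (D.e_mem j)
  ξ := D.ξ
  ξ_of_ne j i x hx hi := D.ξ_of_ne j (i - 1) x hx fun h => hi (by rw [← h, sub_add_cancel])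
  ξ_e_self := D.ξ_e_self
  ξ_e_of_ne := D.ξ_e_of_ne
  h := -D.h
  h_mem i x hx := by simpa using neg_mem (isHomogMap_shiftAb D.h_mem hx)
  h_h x := by simp [D.h_h]
  d_e j := by simp [shiftAb, D.d_e]
  ξ_d j x := by simp [shiftAb, D.ξ_d]
  h_e j := by simp [D.h_e]
  ξ_h j x := by simp [D.ξ_h]
  d_h x := by simpa [shiftAb] using D.d_h x

end DGLieAlgebra

namespace DGLieAlgebra

variable {k : Type u} {L : Type v} [Field k] [CharZero k] [AddCommGroup L] [Module k L]
variable (g : DGLieAlgebra k L)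

/-! ### Cochains with values in the symmetric algebra -/

/-- The cochains with values in `S(g)`. -/
abbrev SHom : Type (max u v) := g.S →ₗ[k] g.Sym

/-- The convolution of cochains of degree `n` with the cochain `x[1] ↦ Q x`. -/
def tw (Q : L →ₗ[k] Module.End k g.Sym) (n : ℤ) : Module.End k g.SHom where
  toFun f := g.contract ((Q ∘ₗ g.shiftSign n).compl₂ f)
  map_add' f f' := by rw [← map_add]; congr 1; ext; simp
  map_smul' c f := by rw [RingHom.id_apply, ← map_smul]; congr 1; ext; simp

omit [CharZero k] in
theorem tw_apply (Q : L →ₗ[k] Module.End k g.Sym) (n : ℤ) (f : g.SHom) (a : g.S) :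
    g.tw Q n f a = TensorProduct.lift ((Q ∘ₗ g.shiftSign n).compl₂ f) (g.extract a) := rfl

omit [CharZero k] in
theorem tw_sub (Q Q' : L →ₗ[k] Module.End k g.Sym) (n : ℤ) : g.tw (Q - Q') n = g.tw Q n - g.tw Q' n := by
  refine LinearMap.ext fun f => ?_
  change g.contract _ = g.contract _ - g.contract _
  rw [← map_sub]
  congr 1

/-- Left multiplication on `U(g)`, transported to `S(g)`. -/
def symmMul : L →ₗ[k] Module.End k g.Sym :=
  g.symmEquiv.symm.conj.toLinearMap ∘ₗ LinearMap.mul k g.U ∘ₗ g.ιU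

theorem symm_symmMul (x : L) (s : g.Sym) : g.symm (g.symmMul x s) = g.ιU x * g.symm s :=
  g.symmEquiv.apply_symm_apply _

/-- The isomorphism between the cochains with values in `S(g)` and in `U(g)`. -/
def homEquiv : g.SHom ≃ₗ[k] g.Hom := LinearEquiv.congrRight g.symmEquiv

theorem homEquiv_apply (f : g.SHom) (a : g.S) : g.homEquiv f a = g.symm (f a) := rfl

/-- The differential of the Chevalley-Eilenberg complex, on cochains with values in `S(g)`. -/
def dX (n : ℤ) : Module.End k g.SHom :=
  g.homEquiv.symm.toLinearMap ∘ₗ g.dCE n ∘ₗ g.homEquiv.toLinearMap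

theorem homEquiv_dX (n : ℤ) (f : g.SHom) : g.homEquiv (g.dX n f) = g.dCE n (g.homEquiv f) :=
  g.homEquiv.apply_symm_apply _

theorem dX_dX (n : ℤ) (f : g.SHom) : g.dX (n + 1) (g.dX n f) = 0 := by
  refine g.homEquiv.injective ?_
  rw [homEquiv_dX, homEquiv_dX, dCE_dCE, map_zero]

/-- The part of the differential that preserves the weight. -/
def dLin (n : ℤ) : Module.End k g.SHom :=
  LinearMap.compRight k g.dSym - n.negOnePow • LinearMap.lcomp k g.Sym g.dS₁

omit [CharZero k] in
theorem dLin_apply (n : ℤ) (f : g.SHom) (a : g.S) :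
    g.dLin n f a = g.dSym (f a) - n.negOnePow • f (g.dS₁ a) := rfl

/-- The part of the differential that raises the weight. -/
def dUp (n : ℤ) : Module.End k g.SHom :=
  g.tw g.symmMul n - n.negOnePow • LinearMap.lcomp k g.Sym g.dS₂

theorem dUp_apply (n : ℤ) (f : g.SHom) (a : g.S) :
    g.dUp n f a = g.tw g.symmMul n f a - n.negOnePow • f (g.dS₂ a) := rfl

/-- Symmetrization is a chain map, so the differential of U(g) contributes only the linear
differential of S(g). The noncommutativity sits entirely in `symmMul`, inside `dUp`. -/
theorem dX_eq (n : ℤ) (f : g.SHom) : g.dX n f = g.dLin n f + g.dUp n f := by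
  refine g.homEquiv.injective (LinearMap.ext fun a => ?_)
  have h : g.symm ∘ₗ TensorProduct.lift ((g.symmMul ∘ₗ g.shiftSign n).compl₂ f) =
      TensorProduct.lift ((LinearMap.mul k g.U ∘ₗ g.ιU ∘ₗ g.shiftSign n).compl₂ (g.homEquiv f)) := by
    refine TensorProduct.ext' fun x b => ?_
    simp [symm_symmMul, homEquiv_apply]
  have h1 : g.twist n (g.homEquiv f) a = g.symm (g.tw g.symmMul n f a) :=
    (LinearMap.congr_fun h (g.extract a)).symm
  change _ = g.symm (g.dLin n f a + g.dUp n f a)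
  have h2 := g.homEquiv_apply f
  rw [homEquiv_dX, dCE_apply, h1, h2, h2, dLin_apply, dUp_apply, ← symm_dSym, dS,
    LinearMap.add_apply]
  simp only [map_add, map_sub, Units.smul_def, map_zsmul, smul_add]
  abel

/-! ### Degrees -/

/-- The `S(g)`-valued cochains of degree `n`. -/
def cochX (n : ℤ) : Submodule k g.SHom where
  carrier := {f | ∀ a, g.shiftAb.degE (f a) = f (g.degE a) + (n : k) • f a}
  zero_mem' := by simp
  add_mem' := fun hf hf' a => by
    simp only [LinearMap.add_apply, map_add, hf a, hf' a, smul_add]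
    abel
  smul_mem' := fun c f hf a => by
    simp only [LinearMap.smul_apply, map_smul, hf a, smul_add, smul_comm c]

theorem iSup_degS : ⨆ n, g.degS n = ⊤ := by
  refine (Submodule.eq_top_iff').2 fun a => ?_
  induction a using g.S_induction with
  | h1 => exact Submodule.mem_iSup_of_mem 0 g.one_mem_degS
  | hadd a b ha hb => exact add_mem ha hb
  | hsmul c a ha => exact Submodule.smul_mem _ _ ha
  | hmul i x hx a ha =>
    induction ha using Submodule.iSup_induction' with
    | mem n a ha => exact Submodule.mem_iSup_of_mem _ (g.ιS_mul_mem hx ha)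
    | zero => simp
    | add a b _ _ ha hb => rw [mul_add]; exact add_mem ha hb

theorem mem_degS_of_symm {m : ℤ} {s : g.Sym} (hs : g.symm s ∈ g.degU m) : s ∈ g.shiftAb.degS m := by
  obtain ⟨t, ht, h⟩ := g.exists_symm_eq hs
  rwa [← g.symm_injective h]

theorem homEquiv_mem_cochains {n : ℤ} {f : g.SHom} : g.homEquiv f ∈ g.cochains n ↔ f ∈ g.cochX n := by
  constructor
  · intro hf a
    have ha : a ∈ ⨆ n, g.degS n := by rw [iSup_degS]; trivial
    induction ha using Submodule.iSup_induction' with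
    | mem i a ha =>
      have h : g.shiftAb.degE (f a) = _ :=
        g.shiftAb.mem_degS_iff.1 (g.mem_degS_of_symm (hf i a ha))
      change _ = ((i + n : ℤ) : k) • f a at h
      rw [h, g.mem_degS_iff.1 ha, map_smul, ← add_smul, Int.cast_add]
    | zero => simp
    | add a b _ _ ha hb => simp only [map_add, ha, hb, smul_add]; abel
  · intro hf i a ha
    refine g.symm_mem (g.shiftAb.mem_degS_iff.2 ?_)
    change g.shiftAb.degE (f a) = _ • f a
    rw [hf, g.mem_degS_iff.1 ha, map_smul, ← add_smul, Int.cast_add]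

theorem dX_mem {n : ℤ} {f : g.SHom} (hf : f ∈ g.cochX n) : g.dX n f ∈ g.cochX (n + 1) := by
  rw [← homEquiv_mem_cochains] at hf ⊢
  rw [homEquiv_dX]
  exact g.dCE_mem hf

theorem degE_dS₁ (a : g.S) : g.degE (g.dS₁ a) = g.dS₁ (g.degE a) + g.dS₁ a := by
  rw [dS₁_eq, LinearMap.neg_apply, map_neg, g.degE_derL g.isHomogMap_d]
  simp
  abel

theorem dLin_mem {n : ℤ} {f : g.SHom} (hf : f ∈ g.cochX n) : g.dLin n f ∈ g.cochX (n + 1) := by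
  intro a
  have h1 := g.shiftAb.degE_dS₁ (f a)
  have h2 := hf (g.dS₁ a)
  rw [g.degE_dS₁, map_add] at h2
  simp only [dLin_apply, map_sub, Units.smul_def, map_zsmul, h1, h2, hf a, map_add, map_smul,
    smul_add, smul_sub, Int.cast_add, Int.cast_one, add_smul, one_smul, smul_comm (n : k)]
  abel

theorem dUp_mem {n : ℤ} {f : g.SHom} (hf : f ∈ g.cochX n) : g.dUp n f ∈ g.cochX (n + 1) := by
  have := sub_mem (g.dX_mem hf) (g.dLin_mem hf)
  rwa [dX_eq, add_sub_cancel_left] at this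

/-! ### Weights -/

/-- The component of weight `p` of a cochain. -/
def wtX (p : ℕ) : Module.End k g.SHom := LinearMap.lcomp k g.Sym (g.wtE_isNatDiag.pr p)

theorem wtX_apply (p : ℕ) (f : g.SHom) (a : g.S) : g.wtX p f a = f (g.wtE_isNatDiag.pr p a) := rfl

theorem extract_pr (p : ℕ) (a : g.S) : g.extract (g.wtE_isNatDiag.pr (p + 1) a) =
    LinearMap.lTensor L (g.wtE_isNatDiag.pr p) (g.extract a) := by
  refine LinearMap.congr_fun (g.wtE_isNatDiag.hom_ext (F := g.extract ∘ₗ g.wtE_isNatDiag.pr (p + 1))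
    (G := LinearMap.lTensor L (g.wtE_isNatDiag.pr p) ∘ₗ g.extract) fun n a ha => ?_) a
  simp only [LinearMap.comp_apply]
  rcases n with _ | n
  · rw [g.wtE_isNatDiag.pr_of_ne (by omega) ha, map_zero,
      g.extract_eq_zero (a := a) (by simpa using ha), map_zero]
  · have h1 : g.wtT n ≤ LinearMap.eqLocus (LinearMap.lTensor L (g.wtE_isNatDiag.pr p))
        (if n = p then LinearMap.id else 0) := by
      refine Submodule.span_le.2 ?_
      rintro _ ⟨i, z, b, hz, hb, rfl⟩
      by_cases h : n = p
      · subst h; simp [g.wtE_isNatDiag.pr_self hb]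
      · simp [g.wtE_isNatDiag.pr_of_ne h hb, h]
    have h2 : LinearMap.lTensor L (g.wtE_isNatDiag.pr p) (g.extract a) =
      (if n = p then LinearMap.id else 0 : L ⊗[k] g.S →ₗ[k] L ⊗[k] g.S) (g.extract a) :=
      h1 (g.extract_mem_wtT ha)
    rw [h2]
    by_cases h : n = p
    · subst h; simp [g.wtE_isNatDiag.pr_self ha]
    · rw [g.wtE_isNatDiag.pr_of_ne (by omega) ha, if_neg h]; simp

theorem extract_pr_zero (a : g.S) : g.extract (g.wtE_isNatDiag.pr 0 a) = 0 :=
  g.extract_eq_zero (by simpa using g.wtE_isNatDiag.apply_pr 0 a)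

theorem contract_pr {N : Type*} [AddCommGroup N] [Module k N] (φ : L →ₗ[k] g.S →ₗ[k] N)
    (p : ℕ) (a : g.S) :
    g.contract φ (g.wtE_isNatDiag.pr (p + 1) a) = g.contract (φ.compl₂ (g.wtE_isNatDiag.pr p)) a := by
  rw [contract_apply, contract_apply, extract_pr]
  have : TensorProduct.lift φ ∘ₗ LinearMap.lTensor L (g.wtE_isNatDiag.pr p) =
      TensorProduct.lift (φ.compl₂ (g.wtE_isNatDiag.pr p)) := TensorProduct.ext' fun x b => by simp
  exact LinearMap.congr_fun this _

theorem contract_pr_zero {N : Type*} [AddCommGroup N] [Module k N] (φ : L →ₗ[k] g.S →ₗ[k] N)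
    (a : g.S) : g.contract φ (g.wtE_isNatDiag.pr 0 a) = 0 := by
  rw [contract_apply, extract_pr_zero, map_zero]

theorem derL_pr {α : L →ₗ[k] L} {r : ℤ} (hα : g.IsHomogMap α r) (p : ℕ) (a : g.S) :
    g.derL α (g.wtE_isNatDiag.pr p a) = g.wtE_isNatDiag.pr p (g.derL α a) :=
  (g.wtE_isNatDiag.fc_comm g.wtE_isNatDiag (g.derL α) (g.wtE_derL hα) _ a).symm

theorem adS_pr (x : L) (p : ℕ) (a : g.S) :
    g.adS x (g.wtE_isNatDiag.pr p a) = g.wtE_isNatDiag.pr p (g.adS x a) := by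
  induction x using g.hom_induction with
  | h0 => simp
  | hadd x y hx hy => simp only [map_add, LinearMap.add_apply, hx, hy]
  | hh i x hx =>
    refine g.derL_pr (α := g.bracket (g.parity x)) (r := i) (fun j y hy => ?_) p a
    rw [g.parity_apply hx, Units.smul_def, map_zsmul, LinearMap.smul_apply, add_comm]
    exact zsmul_mem (g.bracket_mem hx hy) _

theorem dS₂_pr (p : ℕ) (a : g.S) :
    g.dS₂ (g.wtE_isNatDiag.pr (p + 1) a) = g.wtE_isNatDiag.pr p (g.dS₂ a) := by
  have h : g.adS.compl₂ (g.wtE_isNatDiag.pr p) = g.adS.compr₂ (g.wtE_isNatDiag.pr p) := by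
    ext x a; exact g.adS_pr x p a
  have h2 : TensorProduct.lift (g.adS.compr₂ (g.wtE_isNatDiag.pr p)) =
      g.wtE_isNatDiag.pr p ∘ₗ TensorProduct.lift g.adS := TensorProduct.ext' fun x b => by simp
  rw [dS₂, LinearMap.smul_apply, LinearMap.smul_apply, map_smul, contract_pr, h, contract_apply, h2]
  rfl

theorem dS₂_pr_zero (a : g.S) : g.dS₂ (g.wtE_isNatDiag.pr 0 a) = 0 := by
  rw [dS₂, LinearMap.smul_apply, contract_pr_zero, smul_zero]

theorem wtX_tw (Q : L →ₗ[k] Module.End k g.Sym) (n : ℤ) (p : ℕ) (f : g.SHom) :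
    g.wtX (p + 1) (g.tw Q n f) = g.tw Q n (g.wtX p f) :=
  LinearMap.ext fun a => g.contract_pr _ p a

theorem wtX_zero_tw (Q : L →ₗ[k] Module.End k g.Sym) (n : ℤ) (f : g.SHom) :
    g.wtX 0 (g.tw Q n f) = 0 :=
  LinearMap.ext fun a => g.contract_pr_zero _ a

theorem wtX_dUp (n : ℤ) (p : ℕ) (f : g.SHom) : g.wtX (p + 1) (g.dUp n f) = g.dUp n (g.wtX p f) := by
  refine LinearMap.ext fun a => ?_
  have := LinearMap.congr_fun (g.wtX_tw g.symmMul n p f) a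
  rw [wtX_apply] at this
  rw [wtX_apply, dUp_apply, dUp_apply, this, dS₂_pr, wtX_apply]

theorem wtX_zero_dUp (n : ℤ) (f : g.SHom) : g.wtX 0 (g.dUp n f) = 0 := by
  refine LinearMap.ext fun a => ?_
  have := LinearMap.congr_fun (g.wtX_zero_tw g.symmMul n f) a
  rw [wtX_apply] at this
  rw [wtX_apply, dUp_apply, this, dS₂_pr_zero]
  simp [Units.smul_def]

theorem wtX_dLin (n : ℤ) (p : ℕ) (f : g.SHom) : g.wtX p (g.dLin n f) = g.dLin n (g.wtX p f) := by
  refine LinearMap.ext fun a => ?_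
  rw [wtX_apply, dLin_apply, dLin_apply, wtX_apply, wtX_apply, dS₁_eq, LinearMap.neg_apply,
    LinearMap.neg_apply, g.derL_pr g.isHomogMap_d, map_neg, map_neg, map_neg]

/-! ### The range of a cochain -/

/-- The cochains with values of weight less than `q`. -/
def filX (q : ℕ) : Submodule k g.SHom where
  carrier := {f | ∀ a, f a ∈ g.shiftAb.wtE.fil q}
  zero_mem' := fun _ => zero_mem _
  add_mem' := fun hf hf' a => add_mem (hf a) (hf' a)
  smul_mem' := fun c _ hf a => Submodule.smul_mem _ c (hf a)

theorem fil_le_span (q : ℕ) : g.wtE.fil q ≤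
    Submodule.span k {a | a ∈ g.wtE.fil q ∧ ∃ m, a ∈ g.degS m} := by
  refine Module.End.fil_le fun n hn a ha => ?_
  refine g.wt_induction ha (P := fun n a => ∀ q, n < q →
    a ∈ Submodule.span k {a | a ∈ g.wtE.fil q ∧ ∃ m, a ∈ g.degS m}) ?_ ?_ ?_ ?_ ?_ q hn
  · exact fun _ _ _ => zero_mem _
  · exact fun q hq => Submodule.subset_span ⟨Module.End.mem_fil hq (by simp [wtE_one]), 0, g.one_mem_degS⟩
  · exact fun n a b ha hb q hq => add_mem (ha q hq) (hb q hq)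
  · exact fun n c a ha q hq => Submodule.smul_mem _ _ (ha q hq)
  · intro n i x a hx _ ha q hq
    obtain ⟨q, rfl⟩ : ∃ r, q = r + 1 := ⟨q - 1, by omega⟩
    have h := ha q (by omega)
    have hle : Submodule.span k {a | a ∈ g.wtE.fil q ∧ ∃ m, a ∈ g.degS m} ≤
        (Submodule.span k {a | a ∈ g.wtE.fil (q + 1) ∧ ∃ m, a ∈ g.degS m}).comap
          (LinearMap.mulLeft k (g.ιS x)) := by
      refine Submodule.span_le.2 ?_
      rintro a ⟨ha, m, hm⟩
      refine Submodule.subset_span ⟨?_, _, g.ιS_mul_mem hx hm⟩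
      have h2 : g.wtE.fil q ≤ (g.wtE.fil (q + 1)).comap (LinearMap.mulLeft k (g.ιS x)) :=
        Module.End.fil_le fun m hm a ha => Module.End.mem_fil (m := m + 1) (by omega) (by
          rw [LinearMap.mulLeft_apply, wtE_mul, ha, mul_smul_comm, Nat.cast_succ, add_smul, one_smul,
            add_comm])
      exact h2 ha
    exact hle h

/-- This is `exists_ιU_mul_symm` transported to S(g). That lemma needs homogeneous elements, and
these span each filtration step by `fil_le_span`. -/
theorem corr_symmMul_mem (q : ℕ) (x : L) {s : g.Sym} (hs : s ∈ g.shiftAb.wtE.fil q) :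
    g.corr g.symmMul x s ∈ g.shiftAb.wtE.fil q := by
  have hle : Submodule.span k {a | a ∈ g.shiftAb.wtE.fil q ∧ ∃ m, a ∈ g.shiftAb.degS m} ≤
      (g.shiftAb.wtE.fil q).comap (g.corr g.symmMul x) := by
    refine Submodule.span_le.2 ?_
    rintro a ⟨ha, m, hm⟩
    rw [SetLike.mem_coe, Submodule.mem_comap]
    induction x using g.hom_induction with
    | h0 => simp
    | hadd x y hx hy => simp only [map_add, LinearMap.add_apply]; exact add_mem hx hy
    | hh i x hx =>
      obtain ⟨t, ⟨ht, -⟩, h⟩ := g.exists_ιU_mul_symm q hx ha hm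
      rw [← symm_symmMul, ← map_sub] at h
      rwa [corr_apply, ← g.symm_injective h]
  exact hle (g.shiftAb.fil_le_span q hs)

/-- The convolution with the canonical cochain `x[1] ↦ x` for the commutative product. -/
def kap (n : ℤ) : Module.End k g.SHom := g.tw (LinearMap.mul k g.Sym ∘ₗ g.ιSym) n

/-- Multiplication inside `kap` may raise the filtration of the values by one, whereas the
correction to it preserves the filtration and `dS₂` acts on the argument only. Thus `kap` is the
leading term of `dUp`. -/
theorem dUp_sub_kap_mem {q : ℕ} {n : ℤ} {f : g.SHom} (hf : f ∈ g.filX q) :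
    g.dUp n f - g.kap n f ∈ g.filX q := by
  have h1 : g.dUp n f - g.kap n f = g.tw (g.corr g.symmMul) n f -
      n.negOnePow • LinearMap.lcomp k g.Sym g.dS₂ f := by
    rw [corr, tw_sub, dUp, kap, LinearMap.sub_apply, LinearMap.sub_apply, LinearMap.smul_apply]
    abel
  rw [h1]
  intro a
  rw [LinearMap.sub_apply, LinearMap.smul_apply, Units.smul_def]
  refine sub_mem ?_ (zsmul_mem (hf _) _)
  rw [tw_apply]
  have h2 : LinearMap.range (TensorProduct.lift ((g.corr g.symmMul ∘ₗ g.shiftSign n).compl₂ f)) ≤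
      g.shiftAb.wtE.fil q := by
    rw [LinearMap.range_eq_map, ← TensorProduct.span_tmul_eq_top, Submodule.map_span,
      Submodule.span_le]
    rintro _ ⟨_, ⟨x, b, rfl⟩, rfl⟩
    simpa using g.corr_symmMul_mem q _ (hf b)
  exact h2 ⟨_, rfl⟩

end DGLieAlgebra

namespace DGLieAlgebra.Retract

variable {k : Type u} {L : Type v} [Field k] [CharZero k] [AddCommGroup L] [Module k L]
variable {g : DGLieAlgebra k L} (D : g.Retract)

/-! ### The homotopy for the linear part of the differential -/

/-- The projection of the cochains onto those that live on the cohomology. -/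
def PX : Module.End k g.SHom :=
  LinearMap.compRight k D.shift.π ∘ₗ LinearMap.lcomp k g.Sym D.π

theorem PX_apply (f : g.SHom) (a : g.S) : D.PX f a = D.shift.π (f (D.π a)) := rfl

/-- The contracting homotopy for the linear part of the differential. -/
def hX (n : ℤ) : Module.End k g.SHom :=
  n.negOnePow • LinearMap.lcomp k g.Sym D.hS +
    LinearMap.compRight k D.shift.hS ∘ₗ LinearMap.lcomp k g.Sym D.π

theorem hX_apply (n : ℤ) (f : g.SHom) (a : g.S) :
    D.hX n f a = n.negOnePow • f (D.hS a) + D.shift.hS (f (D.π a)) := rfl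

theorem PX_PX (f : g.SHom) : D.PX (D.PX f) = D.PX f :=
  LinearMap.ext fun a => by simp only [PX_apply, π_π]

theorem PX_hX (n : ℤ) (f : g.SHom) : D.PX (D.hX n f) = 0 :=
  LinearMap.ext fun a => by
    simp [PX_apply, hX_apply, π_π, hS_π, π_hS, Units.smul_def]

theorem hX_PX (n : ℤ) (f : g.SHom) : D.hX n (D.PX f) = 0 :=
  LinearMap.ext fun a => by
    simp [PX_apply, hX_apply, π_π, hS_π, π_hS, Units.smul_def]

theorem PX_dLin (n : ℤ) (f : g.SHom) : D.PX (g.dLin n f) = 0 :=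
  LinearMap.ext fun a => by
    simp [PX_apply, dLin_apply, dS₁_π, π_dS₁, Units.smul_def]

theorem dLin_PX (n : ℤ) (f : g.SHom) : g.dLin n (D.PX f) = 0 :=
  LinearMap.ext fun a => by
    simp [PX_apply, dLin_apply, dS₁_π, π_dS₁, Units.smul_def]

theorem hX_hX (n : ℤ) (f : g.SHom) : D.hX (n - 1) (D.hX n f) = 0 :=
  LinearMap.ext fun a => by
    rcases negOnePow_cases n with ⟨hn, en⟩ | ⟨hn, en⟩ <;>
    simp [hX_apply, hS_π, π_hS, hS_hS, Units.smul_def, Int.negOnePow_sub, en]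

/-- The standard homotopy for a Hom complex: contract the argument first, then the values of what
already factors through `π`. The signs make the cross terms cancel. -/
theorem dLin_hX (n : ℤ) (f : g.SHom) :
    g.dLin (n - 1) (D.hX n f) + D.hX (n + 1) (g.dLin n f) = f - D.PX f :=
  LinearMap.ext fun a => by
    have h1 := congrArg f (D.dS₁_hS a)
    have h2 := D.shift.dS₁_hS (f (D.π a))
    simp only [map_add, map_sub] at h1
    simp only [LinearMap.add_apply, LinearMap.sub_apply, hX_apply, dLin_apply, PX_apply]
    have h3 := eq_sub_of_add_eq h1
    have h4 := eq_sub_of_add_eq h2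
    rcases negOnePow_cases n with ⟨hn, en⟩ | ⟨hn, en⟩ <;>
    simp [π_dS₁, dS₁_π, Units.smul_def, Int.negOnePow_sub, Int.negOnePow_add, en, h3, h4] <;> abel

theorem hX_mem {n : ℤ} {f : g.SHom} (hf : f ∈ g.cochX n) : D.hX n f ∈ g.cochX (n - 1) := by
  intro a
  have h1 := hf (D.hS a)
  have h2 := D.shift.degE_hS (f (D.π a))
  have h3 := hf (D.π a)
  rw [degE_hS] at h1
  rw [h3] at h2
  simp only [hX_apply, map_add, Units.smul_def, map_zsmul, h1, h2, map_sub, map_smul, smul_add,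
    smul_sub, Int.cast_sub, Int.cast_one, sub_smul, one_smul, smul_comm (n : k), π_degE]
  abel

theorem PX_mem {n : ℤ} {f : g.SHom} (hf : f ∈ g.cochX n) : D.PX f ∈ g.cochX n := by
  intro a
  rw [PX_apply, PX_apply, ← π_degE, hf, π_degE, map_add, map_smul]

theorem π_pr (p : ℕ) (a : g.S) :
    D.π (g.wtE_isNatDiag.pr p a) = g.wtE_isNatDiag.pr p (D.π a) :=
  (g.wtE_isNatDiag.fc_comm g.wtE_isNatDiag D.π (fun x => (D.π_wtE x).symm) _ a).symm

theorem hS_pr (p : ℕ) (a : g.S) :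
    D.hS (g.wtE_isNatDiag.pr p a) = g.wtE_isNatDiag.pr p (D.hS a) :=
  (g.wtE_isNatDiag.fc_comm g.wtE_isNatDiag D.hS D.wtE_hS _ a).symm

theorem wtX_PX (p : ℕ) (f : g.SHom) : g.wtX p (D.PX f) = D.PX (g.wtX p f) :=
  LinearMap.ext fun a => by simp only [wtX_apply, PX_apply, π_pr]

theorem wtX_hX (n : ℤ) (p : ℕ) (f : g.SHom) : g.wtX p (D.hX n f) = D.hX n (g.wtX p f) :=
  LinearMap.ext fun a => by simp only [wtX_apply, hX_apply, π_pr, hS_pr]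

theorem PX_filX {q : ℕ} {f : g.SHom} (hf : f ∈ g.filX q) : D.PX f ∈ g.filX q := by
  intro a
  have : g.shiftAb.wtE.fil q ≤ (g.shiftAb.wtE.fil q).comap D.shift.π :=
    Module.End.fil_le fun m hm b hb => Module.End.mem_fil hm (by
      rw [← π_wtE, hb, map_smul])
  exact this (hf _)

/-! ### The contraction with the canonical element -/

theorem shift_ξ_of_ne (j : D.J) : ∀ i x, x ∈ g.shiftAb.deg i → i ≠ D.dg j + 1 → D.ξ j x = 0 :=
  D.shift.ξ_of_ne j

/-- The contraction `f ↦ ∑ⱼ ± ∂ⱼ ∘ f ∘ eⱼ[1]`. -/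
def tX (n : ℤ) : Module.End k g.SHom :=
  ∑ j, ((n + 1) * (D.dg j - 1)).negOnePow • (LinearMap.compRight k (g.shiftAb.pd (D.ξ j)) ∘ₗ
    LinearMap.lcomp k g.Sym (LinearMap.mulLeft k (g.ιS (D.e j))))

theorem tX_apply (n : ℤ) (f : g.SHom) (a : g.S) : D.tX n f a = ∑ j,
    ((n + 1) * (D.dg j - 1)).negOnePow • g.shiftAb.pd (D.ξ j) (f (g.ιS (D.e j) * a)) := by
  simp only [tX, LinearMap.sum_apply, LinearMap.smul_apply]
  rfl

/-- The double sum is antisymmetric in its two indices, since ∂ⱼ on S(g) and eⱼ[1] have opposite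
parities. It therefore equals its negative. -/
theorem tX_tX (n : ℤ) (f : g.SHom) : D.tX (n - 1) (D.tX n f) = 0 := by
  refine LinearMap.ext fun a => ?_
  let T : D.J → D.J → g.Sym := fun i j => ((n - 1 + 1) * (D.dg i - 1)).negOnePow •
    ((n + 1) * (D.dg j - 1)).negOnePow • g.shiftAb.pd (D.ξ i) (g.shiftAb.pd (D.ξ j)
      (f (g.ιS (D.e j) * (g.ιS (D.e i) * a))))
  have h1 : D.tX (n - 1) (D.tX n f) a = ∑ i, ∑ j, T i j := by
    simp only [tX_apply, map_sum, Finset.smul_sum, T, Units.smul_def, map_zsmul]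
  have hT : ∀ i j, T j i = -T i j := by
    intro i j
    have h2 := g.shiftAb.pd_pd (D.shift_ξ_of_ne j) (D.shift_ξ_of_ne i)
      (f (g.ιS (D.e i) * (g.ιS (D.e j) * a)))
    have h3 := congrArg (fun s => f (s * a)) (g.ιS_comm (D.e_mem i) (D.e_mem j))
    simp only [T]
    rw [h2]
    simp only [← mul_assoc]
    rcases negOnePow_cases n with ⟨hn, en⟩ | ⟨hn, en⟩ <;>
      rcases negOnePow_cases (D.dg i) with ⟨hi, ei⟩ | ⟨hi, ei⟩ <;>
      rcases negOnePow_cases (D.dg j) with ⟨hj, ej⟩ | ⟨hj, ej⟩ <;>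
      simp [Units.smul_def, negOnePow_mul, Int.negOnePow_add, Int.negOnePow_sub, Int.odd_sub,
        Int.odd_add, Int.even_sub, Int.even_add, hi, ei, hj, ej, hn, en] at h3 ⊢ <;>
      simp only [h3, map_neg, neg_neg]
  rw [h1, LinearMap.zero_apply]
  have h4 : ∑ i, ∑ j, T i j = -∑ i, ∑ j, T i j := by
    nth_rw 1 [Finset.sum_comm]
    rw [← Finset.sum_neg_distrib]
    refine Finset.sum_congr rfl fun i _ => ?_
    rw [← Finset.sum_neg_distrib]
    exact Finset.sum_congr rfl fun j _ => hT i j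
  have h5 : (2 : k) • ∑ i, ∑ j, T i j = 0 := by rw [two_smul]; nth_rw 1 [h4]; simp
  exact (smul_eq_zero.1 h5).resolve_left two_ne_zero

theorem tX_tX' (n : ℤ) (f : g.SHom) : D.tX n (D.tX (n + 1) f) = 0 := by
  have := D.tX_tX (n + 1) f
  rwa [add_sub_cancel_right] at this

theorem pd_shift_π (j : D.J) (s : g.Sym) :
    g.shiftAb.pd (D.ξ j) (D.shift.π s) = D.shift.π (g.shiftAb.pd (D.ξ j) s) := by
  refine (D.shift.cpE_isNatDiag.fc_comm D.shift.cpE_isNatDiag (g.shiftAb.pd (D.ξ j))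
    (fun s => ?_) _ s).symm
  rw [cpE, g.shiftAb.pd_derL (D.shift_ξ_of_ne j) D.shift.isHomogMap_id_sub_prL]
  have : D.ξ j ∘ₗ (LinearMap.id - D.shift.prL) = 0 := LinearMap.ext fun x => by
    have := D.shift.ξ_diagL (fun _ => 1) j x
    rw [one_mul] at this
    simp only [LinearMap.comp_apply, LinearMap.sub_apply, LinearMap.id_apply, map_sub,
      LinearMap.zero_apply, sub_eq_zero]
    exact this.symm
  rw [this, pd_zero, LinearMap.zero_apply, add_zero]

theorem tX_PX (n : ℤ) (f : g.SHom) : D.tX n (D.PX f) = D.PX (D.tX n f) :=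
  LinearMap.ext fun a => by
    simp only [tX_apply, PX_apply, map_sum, Units.smul_def, map_zsmul, pd_shift_π, π_mul, prL_e]

theorem mul_pr (x : L) (p : ℕ) (a : g.S) :
    g.ιS x * g.wtE_isNatDiag.pr p a = g.wtE_isNatDiag.pr (p + 1) (g.ιS x * a) :=
  (g.wtE_isNatDiag.fc_comm_shift g.wtE_isNatDiag (LinearMap.mulLeft k (g.ιS x)) (τ := (· + 1))
    (fun n y hy _ => ⟨by rw [LinearMap.mulLeft_apply, wtE_mul, hy, mul_smul_comm, Nat.cast_succ,
      add_smul, one_smul, add_comm], by simp⟩) a).symm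

theorem pr_zero_mul (x : L) (a : g.S) : g.wtE_isNatDiag.pr 0 (g.ιS x * a) = 0 := by
  have := LinearMap.congr_fun (g.wtE_isNatDiag.hom_ext
    (F := g.wtE_isNatDiag.pr 0 ∘ₗ LinearMap.mulLeft k (g.ιS x)) (G := 0) fun n y hy => ?_) a
  · exact this
  · refine g.wtE_isNatDiag.pr_of_ne (m := n + 1) (by omega) ?_
    rw [LinearMap.mulLeft_apply, wtE_mul, hy, mul_smul_comm, Nat.cast_succ, add_smul, one_smul,
      add_comm]

theorem wtX_tX (n : ℤ) (p : ℕ) (f : g.SHom) : g.wtX p (D.tX n f) = D.tX n (g.wtX (p + 1) f) :=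
  LinearMap.ext fun a => by simp only [wtX_apply, tX_apply, mul_pr]

theorem tX_wtX_zero (n : ℤ) (f : g.SHom) : D.tX n (g.wtX 0 f) = 0 :=
  LinearMap.ext fun a => by simp [wtX_apply, tX_apply, pr_zero_mul, Units.smul_def]

theorem tX_mem (m : ℤ) {n : ℤ} {f : g.SHom} (hf : f ∈ g.cochX n) : D.tX m f ∈ g.cochX (n - 1) := by
  intro a
  rw [D.tX_apply m f a, D.tX_apply m f, map_sum, Finset.smul_sum, ← Finset.sum_add_distrib]
  refine Finset.sum_congr rfl fun j _ => ?_
  have h1 := g.shiftAb.pd_degE (D.shift_ξ_of_ne j) (f (g.ιS (D.e j) * a))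
  rw [hf, g.degE_mul (D.e_mem j)] at h1
  have h2 := eq_sub_of_add_eq h1.symm
  simp only [Units.smul_def, map_zsmul, h2, map_add, map_smul, smul_sub, smul_add]
  simp only [← Int.cast_smul_eq_zsmul k, smul_smul, Int.cast_sub, Int.cast_add, Int.cast_one]
  module

theorem pd_mem_fil (j : D.J) {q : ℕ} {s : g.Sym} (hs : s ∈ g.shiftAb.wtE.fil (q + 1)) :
    g.shiftAb.pd (D.ξ j) s ∈ g.shiftAb.wtE.fil q := by
  have : g.shiftAb.wtE.fil (q + 1) ≤ (g.shiftAb.wtE.fil q).comap (g.shiftAb.pd (D.ξ j)) := by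
    refine Module.End.fil_le fun m hm b hb => ?_
    rw [Submodule.mem_comap]
    rcases m with _ | m
    · rw [g.shiftAb.eq_aug (a := b) (by simpa using hb), map_smul, pd_one, smul_zero]
      exact zero_mem _
    · refine Module.End.mem_fil (m := m) (by omega) ?_
      have := g.shiftAb.pd_wtE (D.shift_ξ_of_ne j) b
      rw [hb, map_smul, Nat.cast_succ, add_smul, one_smul, add_left_inj] at this
      exact this.symm
  exact this hs

theorem tX_filX (n : ℤ) {q : ℕ} {f : g.SHom} (hf : f ∈ g.filX (q + 1)) : D.tX n f ∈ g.filX q := by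
  intro a
  rw [tX_apply]
  refine Submodule.sum_mem _ fun j _ => ?_
  rw [Units.smul_def]
  exact zsmul_mem (D.pd_mem_fil j (hf _)) _

/-- The number operator on cochains. -/
def nX : Module.End k g.SHom :=
  LinearMap.compRight k D.shift.nE + LinearMap.lcomp k g.Sym D.nE

theorem nX_apply (f : g.SHom) (a : g.S) : D.nX f a = D.shift.nE (f a) + f (D.nE a) := rfl

omit [CharZero k] in
-- Each index is fermionic on exactly one of the two sides. This lets the constant in `tX_kap` be
-- distributed over the two number operators, making their eigenvalues natural numbers.
theorem card_fer : (D.fer.card : k) + D.shift.fer.card = Fintype.card D.J := by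
  have h1 : D.fer.card + D.shift.fer.card = Fintype.card D.J := by
    rw [fer, fer, Finset.card_filter, Finset.card_filter, Fintype.card_eq_sum_ones]
    change _ + ∑ j : D.J, (if Even (D.dg j + 1) then 1 else 0) = _
    rw [← Finset.sum_add_distrib]
    refine Finset.sum_congr rfl fun j _ => ?_
    by_cases h : Even (D.dg j) <;> simp [h, Int.even_add_one]
  rw [← h1, Nat.cast_add]

/-- In `kap` applied at eⱼ[1] a, either eⱼ is extracted, and ∂ⱼ of eⱼ f(a) gives f(a) and an Euler
derivation of the value; or some x is extracted from a. In the latter case ∂ⱼ hits x, giving an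
Euler derivation of the argument, or passes it, giving the term subtracted at the end. -/
theorem pd_kap (n : ℤ) (f : g.SHom) (j : D.J) (a : g.S) :
    ((n + 1 + 1) * (D.dg j - 1)).negOnePow •
        g.shiftAb.pd (D.ξ j) (g.kap n f (g.ιS (D.e j) * a)) =
      f a + (D.dg j).negOnePow • g.shiftAb.derL ((D.ξ j).smulRight (D.e j)) (f a) +
      (D.dg j - 1).negOnePow • f (g.derL ((D.ξ j).smulRight (D.e j)) a) -
      g.kap (n - 1) (((n + 1) * (D.dg j - 1)).negOnePow •
        (g.shiftAb.pd (D.ξ j) ∘ₗ f ∘ₗ LinearMap.mulLeft k (g.ιS (D.e j)))) a := by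
  let φ := ((LinearMap.mul k g.Sym ∘ₗ g.ιSym) ∘ₗ g.shiftSign n).compl₂ f
  have he := mem_shiftAb (D.e_mem j)
  have key : ((n + 1 + 1) * (D.dg j - 1)).negOnePow •
      (g.shiftAb.pd (D.ξ j) ∘ₗ TensorProduct.lift φ ∘ₗ g.swapMul (D.e j)) =
      (D.dg j - 1).negOnePow • (f ∘ₗ TensorProduct.lift
        (LinearMap.mul k g.S ∘ₗ g.ιS ∘ₗ (D.ξ j).smulRight (D.e j))) -
      TensorProduct.lift (((LinearMap.mul k g.Sym ∘ₗ g.ιSym) ∘ₗ g.shiftSign (n - 1)).compl₂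
        (((n + 1) * (D.dg j - 1)).negOnePow •
        (g.shiftAb.pd (D.ξ j) ∘ₗ f ∘ₗ LinearMap.mulLeft k (g.ιS (D.e j))))) := by
    refine g.tensor_ext fun l z hz b => ?_
    have hpd := g.shiftAb.pd_mul (D.shift_ξ_of_ne j) (mem_shiftAb hz) (f (g.ιS (D.e j) * b))
    by_cases hl : l = D.dg j
    · subst hl
      rcases negOnePow_cases n with ⟨hn, en⟩ | ⟨hn, en⟩ <;>
        rcases negOnePow_cases (D.dg j) with ⟨hj, ej⟩ | ⟨hj, ej⟩ <;>
        simp [φ, swapMul_tmul _ (D.e_mem j), g.shiftSign_apply _ hz, Units.smul_def, negOnePow_mul,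
          Int.negOnePow_add, Int.negOnePow_sub, Int.odd_sub, Int.odd_add, Int.even_sub,
          Int.even_add, hj, ej, hn, en] at hpd ⊢ <;>
        simp [hpd] <;> abel
    · have h0 := D.ξ_of_ne j l z hz hl
      rcases negOnePow_cases n with ⟨hn, en⟩ | ⟨hn, en⟩ <;>
        rcases negOnePow_cases (D.dg j) with ⟨hj, ej⟩ | ⟨hj, ej⟩ <;>
        rcases negOnePow_cases l with ⟨hl, el⟩ | ⟨hl, el⟩ <;>
        simp [φ, swapMul_tmul _ (D.e_mem j), g.shiftSign_apply _ hz, Units.smul_def, negOnePow_mul,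
          Int.negOnePow_add, Int.negOnePow_sub, Int.odd_sub, Int.odd_add, Int.even_sub,
          Int.even_add, hj, ej, hn, en, hl, el, h0] at hpd ⊢ <;>
        simp [hpd]
  have h1 := LinearMap.congr_fun key (g.extract a)
  have h2 : g.kap n f (g.ιS (D.e j) * a) = (n * (D.dg j - 1)).negOnePow • (g.ιSym (D.e j) * f a) +
      TensorProduct.lift φ (g.swapMul (D.e j) (g.extract a)) := by
    rw [kap, tw_apply, extract_mul, map_add, TensorProduct.lift.tmul, LinearMap.compl₂_apply,
      LinearMap.comp_apply, g.shiftSign_apply _ (D.e_mem j), Units.smul_def, map_zsmul,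
      Units.smul_def]
    rfl
  have h3 := g.shiftAb.pd_mul (D.shift_ξ_of_ne j) he (f a)
  rw [D.ξ_e_self, one_smul, ιS_mul_pd] at h3
  have h4 : ((n + 1 + 1) * (D.dg j - 1)).negOnePow • (n * (D.dg j - 1)).negOnePow •
      (f a + ((D.dg j + 1 - 1) * (D.dg j + 1 - 1)).negOnePow •
        g.shiftAb.derL ((D.ξ j).smulRight (D.e j)) (f a)) =
      f a + (D.dg j).negOnePow • g.shiftAb.derL ((D.ξ j).smulRight (D.e j)) (f a) := by
    rcases negOnePow_cases n with ⟨hn, en⟩ | ⟨hn, en⟩ <;>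
      rcases negOnePow_cases (D.dg j) with ⟨hj, ej⟩ | ⟨hj, ej⟩ <;>
      simp [negOnePow_mul, Int.negOnePow_add, Int.negOnePow_sub, Int.odd_sub, Int.odd_add,
        hj, ej, hn, en]
  rw [← h4, ← h3, add_sub_assoc, h2, map_add, smul_add, Units.smul_def (n * _).negOnePow,
    map_zsmul]
  congr 1

/-- The Koszul analogue of Cartan's homotopy formula, obtained by summing `pd_kap` over the dual
bases. The Euler terms assemble into `kE` on both sides and the copies of f(a) into the constants of
`nE`. -/
theorem tX_kap (n : ℤ) (f : g.SHom) :
    D.tX (n + 1) (g.kap n f) + g.kap (n - 1) (D.tX n f) = D.nX f := by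
  refine LinearMap.ext fun a => ?_
  have h1 : g.kap (n - 1) (D.tX n f) a = ∑ j, g.kap (n - 1) (((n + 1) * (D.dg j - 1)).negOnePow •
        (g.shiftAb.pd (D.ξ j) ∘ₗ f ∘ₗ LinearMap.mulLeft k (g.ιS (D.e j)))) a := by
    have : D.tX n f = ∑ j, ((n + 1) * (D.dg j - 1)).negOnePow •
        (g.shiftAb.pd (D.ξ j) ∘ₗ f ∘ₗ LinearMap.mulLeft k (g.ιS (D.e j))) := by
      simp only [tX, LinearMap.sum_apply]
      rfl
    rw [this, map_sum, LinearMap.sum_apply]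
  have hz : ∀ (u : ℤˣ) (x : g.Sym), ((u : ℤ) : k) • x = u • x := fun u x => by
    rw [Int.cast_smul_eq_zsmul, Units.smul_def]
  have hz' : ∀ (u : ℤˣ) (x : g.S), ((u : ℤ) : k) • x = u • x := fun u x => by
    rw [Int.cast_smul_eq_zsmul, Units.smul_def]
  have h2 : D.shift.kE (f a) = ∑ j,
      (D.dg j).negOnePow • g.shiftAb.derL ((D.ξ j).smulRight (D.e j)) (f a) := by
    rw [kE, diagL, derL_sum, LinearMap.sum_apply]
    refine Finset.sum_congr rfl fun j _ => ?_
    rw [derL_smul, LinearMap.smul_apply, hz]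
    change (D.dg j + 1 - 1).negOnePow • _ = _
    rw [add_sub_cancel_right]
    rfl
  have h3 : f (D.kE a) = ∑ j, (D.dg j - 1).negOnePow • f (g.derL ((D.ξ j).smulRight (D.e j)) a) := by
    rw [kE, diagL, derL_sum, LinearMap.sum_apply, map_sum]
    refine Finset.sum_congr rfl fun j _ => ?_
    rw [derL_smul, LinearMap.smul_apply, map_smul, hz]
  rw [LinearMap.add_apply, tX_apply]
  simp only [D.pd_kap n f]
  rw [Finset.sum_sub_distrib, h1, sub_add_cancel, Finset.sum_add_distrib, Finset.sum_add_distrib,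
    ← h2, ← h3, nX_apply, nE_apply, nE_apply, map_add, map_smul, Finset.sum_const,
    Finset.card_univ, ← Nat.cast_smul_eq_nsmul k, ← D.card_fer]
  module

end DGLieAlgebra.Retract

/-! ### Inverting the number operator and solving the leading-order equations on the cohomology -/

namespace DGLieAlgebra

variable {k : Type u} {L : Type v} [Field k] [CharZero k] [AddCommGroup L] [Module k L]
variable {g : DGLieAlgebra k L}

theorem kap_mem {n : ℤ} {f : g.SHom} (hf : f ∈ g.cochX n) : g.kap n f ∈ g.cochX (n + 1) := by
  let φ := ((LinearMap.mul k g.Sym ∘ₗ g.ιSym) ∘ₗ g.shiftSign n).compl₂ f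
  have key : g.shiftAb.degE ∘ₗ TensorProduct.lift φ =
      TensorProduct.lift φ ∘ₗ (TensorProduct.map g.degL LinearMap.id +
        TensorProduct.map (g.shiftSign 0) g.degE) + ((n + 1 : ℤ) : k) • TensorProduct.lift φ := by
    refine g.tensor_ext fun l z hz b => ?_
    have h1 := g.shiftAb.degE_mul (mem_shiftAb hz) (f b)
    rw [hf b, add_sub_cancel_right, mul_add, mul_smul_comm] at h1
    simp only [φ, LinearMap.comp_apply, LinearMap.add_apply, LinearMap.smul_apply,
      TensorProduct.lift.tmul, TensorProduct.map_tmul, LinearMap.compl₂_apply, map_add,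
      g.shiftSign_apply _ hz, g.degL_apply hz, zero_mul, Int.negOnePow_zero, one_smul,
      LinearMap.id_apply, Units.smul_def, map_smul, map_zsmul, LinearMap.mul_apply', h1,
      map_sub, LinearMap.sub_apply,
      Int.cast_one, Int.cast_add, smul_add, add_smul, smul_mul_assoc, sub_mul, mul_smul_comm]
    simp only [← Int.cast_smul_eq_zsmul k, smul_smul, Int.cast_sub, Int.cast_one]
    module
  intro a
  have h := LinearMap.congr_fun key (g.extract a)
  have e : g.extract (g.degE a) = (TensorProduct.map g.degL LinearMap.id +
      TensorProduct.map (g.shiftSign 0) g.degE : L ⊗[k] g.S →ₗ[k] L ⊗[k] g.S) (g.extract a) := g.extract_derL g.isHomogMap_degL a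
  rw [LinearMap.comp_apply, LinearMap.add_apply, LinearMap.comp_apply, ← e] at h
  exact h

theorem eq_zero_of_mem_filX {f : g.SHom} (hf : f ∈ g.filX 0) : f = 0 :=
  LinearMap.ext fun a => by
    have := hf a
    rwa [Module.End.fil_zero, Submodule.mem_bot] at this

namespace Retract

variable (D : g.Retract)

/-! ### The number operator -/

/-- On the image of `PX` the operators `nE` may be replaced by `nπ`, which are diagonalizable with
natural eigenvalues on the whole symmetric algebras. -/
theorem nX_eq {f : g.SHom} (hf : D.PX f = f) (a : g.S) :
    D.nX f a = D.shift.nπ (f a) + f (D.nπ a) := by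
  have h1 : D.shift.π (f a) = f a := by rw [← hf, PX_apply, π_π]
  have h2 : ∀ b, f (D.π b) = f b := fun b => by rw [← hf, PX_apply, π_π, PX_apply]
  rw [nX_apply, nπ_apply, nπ_apply, h1, ← π_nE, h2]

/-- A generalized inverse of the number operator. -/
def nInv (f : g.SHom) : g.SHom := D.nπ_isNatDiag.lift fun r =>
  D.shift.nπ_isNatDiag.fc (fun s => ((s : k) + r)⁻¹) ∘ₗ f

theorem nInv_apply (f : g.SHom) {r : ℕ} {a : g.S} (ha : D.nπ a = (r : k) • a) :
    D.nInv f a = D.shift.nπ_isNatDiag.fc (fun s => ((s : k) + r)⁻¹) (f a) :=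
  D.nπ_isNatDiag.lift_apply _ ha

theorem nInv_zero : D.nInv 0 = 0 := D.nπ_isNatDiag.hom_ext fun r a ha => by
  rw [nInv_apply D _ ha]; simp

theorem PX_nInv {f : g.SHom} (hf : D.PX f = f) : D.PX (D.nInv f) = D.nInv f :=
  D.nπ_isNatDiag.hom_ext fun r a ha => by
    have h1 : ∀ b, D.shift.π (f b) = f b := fun b => by rw [← hf, PX_apply, π_π]
    have h2 : f (D.π a) = f a := by rw [← hf, PX_apply, π_π, PX_apply]
    have h3 : D.nπ (D.π a) = (r : k) • D.π a := by rw [nπ_π, ← π_nπ, ha, map_smul]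
    rw [PX_apply, nInv_apply D _ h3, nInv_apply D _ ha, h2]
    have := D.shift.nπ_isNatDiag.fc_comm D.shift.nπ_isNatDiag D.shift.π
      (fun x => by rw [nπ_π, π_nπ]) (fun s => ((s : k) + r)⁻¹) (f a)
    rw [← this, h1]

/-- The coefficient of the top form in the value at the top form. -/
def psi : g.SHom →ₗ[k] k := D.shift.topCoeff ∘ₗ LinearMap.applyₗ D.top

theorem psi_apply (f : g.SHom) : D.psi f = D.shift.topCoeff (f D.top) := rfl

/-- The cochain that projects onto the top form. -/
def wX : g.SHom := D.topCoeff.smulRight D.shift.top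

theorem wX_apply (a : g.S) : D.wX a = D.topCoeff a • D.shift.top := rfl

/-- Because 0⁻¹ = 0, the coefficient is 1 except at r = s = 0, where it is 0. The lost component is
the one from the line of `top` to the line of the other top form. -/
theorem fc_eq_sub {f : g.SHom} (hf : D.PX f = f) {r : ℕ} {a : g.S} (ha : D.nπ a = (r : k) • a) :
    D.shift.nπ_isNatDiag.fc (fun s => ((s : k) + r)⁻¹ * ((s : k) + r)) (f a) =
      f a - D.psi f • D.wX a := by
  rcases r with _ | r
  · have h1 : D.shift.π (f a) = f a := by rw [← hf, PX_apply, π_π]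
    have h2 : f (D.π a) = f a := by rw [← hf, PX_apply, π_π, PX_apply]
    have h3 : D.nπ (D.π a) = ((0 : ℕ) : k) • D.π a := by rw [nπ_π, ← π_nπ, ha, map_smul]
    have h4 : D.π a = D.topCoeff a • D.top := by
      rw [← topPr_eq, topPr_apply, D.nπ_isNatDiag.pr_self h3]
    have h5 : D.shift.nπ_isNatDiag.pr 0 (f a) = D.psi f • D.wX a := by
      have := D.shift.topPr_eq (f a)
      rw [topPr_apply, h1] at this
      rw [this, psi_apply, wX_apply, ← h2, h4, map_smul, map_smul, smul_smul, smul_eq_mul, mul_comm]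
    rw [← h5, eq_sub_iff_add_eq, Module.End.IsNatDiag.pr, D.shift.nπ_isNatDiag.fc_add]
    have : (fun s : ℕ => ((s : k) + (0 : ℕ))⁻¹ * ((s : k) + (0 : ℕ)) + if s = 0 then 1 else 0) =
        fun _ => 1 := by
      funext s
      rcases s with _ | s
      · simp
      · have : ((s + 1 : ℕ) : k) ≠ 0 := Nat.cast_ne_zero.2 s.succ_ne_zero
        rw [Nat.cast_zero, add_zero, inv_mul_cancel₀ this, if_neg s.succ_ne_zero, add_zero]
    rw [this, D.shift.nπ_isNatDiag.fc_one]
  · have hr : ((r + 1 : ℕ) : k) ≠ 0 := Nat.cast_ne_zero.2 r.succ_ne_zero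
    have h1 : D.topCoeff a = 0 := by
      have := D.topCoeff_nE (D.π a)
      rw [← nπ_apply, ha, map_smul, smul_eq_mul] at this
      exact (mul_eq_zero.1 this).resolve_left hr
    have : (fun s : ℕ => ((s : k) + (r + 1 : ℕ))⁻¹ * ((s : k) + (r + 1 : ℕ))) = fun _ => 1 := by
      funext s
      rw [← Nat.cast_add]
      exact inv_mul_cancel₀ (Nat.cast_ne_zero.2 (by omega))
    rw [this, D.shift.nπ_isNatDiag.fc_one, wX_apply, h1, zero_smul, smul_zero, sub_zero]

theorem nX_nInv {f : g.SHom} (hf : D.PX f = f) : D.nX (D.nInv f) = f - D.psi f • D.wX :=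
  D.nπ_isNatDiag.hom_ext fun r a ha => by
    rw [D.nX_eq (D.PX_nInv hf), ha, map_smul, nInv_apply D _ ha, LinearMap.sub_apply,
      LinearMap.smul_apply, ← D.fc_eq_sub hf ha, D.shift.nπ_isNatDiag.fc_self]
    have h1 : D.shift.nπ (f a) = D.shift.nπ_isNatDiag.fc (fun s => (s : k)) (f a) :=
      (D.shift.nπ_isNatDiag.fc_cast _).symm
    have h2 : ∀ x, (r : k) • x = D.shift.nπ_isNatDiag.fc (fun _ => (r : k)) x := fun x => by
      refine LinearMap.congr_fun (D.shift.nπ_isNatDiag.hom_ext (F := (r : k) • LinearMap.id)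
        (G := D.shift.nπ_isNatDiag.fc fun _ => (r : k)) fun s y hy => ?_) x
      rw [D.shift.nπ_isNatDiag.fc_apply _ hy]; rfl
    rw [h1, h2, D.shift.nπ_isNatDiag.fc_fc, D.shift.nπ_isNatDiag.fc_fc,
      D.shift.nπ_isNatDiag.fc_add]
    congr 2
    funext s
    ring

theorem nInv_nX {f : g.SHom} (hf : D.PX f = f) : D.nInv (D.nX f) = f - D.psi f • D.wX :=
  D.nπ_isNatDiag.hom_ext fun r a ha => by
    rw [nInv_apply D _ ha, D.nX_eq hf, ha, map_smul, LinearMap.sub_apply,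
      LinearMap.smul_apply, ← D.fc_eq_sub hf ha]
    have h1 := D.nX_nInv hf
    have h2 := LinearMap.congr_fun h1 a
    rw [D.nX_eq (D.PX_nInv hf), ha, map_smul, nInv_apply D _ ha, LinearMap.sub_apply,
      LinearMap.smul_apply, ← D.fc_eq_sub hf ha, D.shift.nπ_isNatDiag.fc_self] at h2
    rw [map_add, map_smul, h2]

theorem nInv_mem {n : ℤ} {f : g.SHom} (hf : f ∈ g.cochX n) : D.nInv f ∈ g.cochX n := by
  intro a
  refine LinearMap.congr_fun (D.nπ_isNatDiag.hom_ext (F := g.shiftAb.degE ∘ₗ D.nInv f)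
    (G := D.nInv f ∘ₗ g.degE + (n : k) • D.nInv f) fun r a ha => ?_) a
  have h1 : D.nπ (g.degE a) = (r : k) • g.degE a := by
    rw [nπ_apply, π_degE, nE_degE, ← nπ_apply, ha, map_smul]
  have h2 := D.shift.nπ_isNatDiag.fc_comm D.shift.nπ_isNatDiag g.shiftAb.degE
    (fun x => by rw [nπ_apply, π_degE, nE_degE, ← nπ_apply]) (fun s => ((s : k) + r)⁻¹) (f a)
  simp only [LinearMap.comp_apply, LinearMap.add_apply, LinearMap.smul_apply, nInv_apply D _ ha,
    nInv_apply D _ h1]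
  rw [← h2, hf a, map_add, map_smul]

theorem wtX_nInv (p : ℕ) (f : g.SHom) : g.wtX p (D.nInv f) = D.nInv (g.wtX p f) :=
  D.nπ_isNatDiag.hom_ext fun r a ha => by
    have h1 : D.nπ (g.wtE_isNatDiag.pr p a) = (r : k) • g.wtE_isNatDiag.pr p a := by
      rw [← map_smul, ← ha]
      exact (g.wtE_isNatDiag.fc_comm g.wtE_isNatDiag D.nπ (fun x => by
        rw [nπ_apply, nπ_apply, π_wtE, nE_wtE]) _ a).symm
    rw [wtX_apply, nInv_apply D _ h1, nInv_apply D _ ha, wtX_apply]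

theorem nInv_filX {q : ℕ} {f : g.SHom} (hf : f ∈ g.filX q) : D.nInv f ∈ g.filX q := by
  intro a
  refine D.nπ_isNatDiag.induction (P := fun a => D.nInv f a ∈ g.shiftAb.wtE.fil q) (by simp)
    (fun a b ha hb => by rw [map_add]; exact add_mem ha hb) (fun r a ha => ?_) a
  have h : g.shiftAb.wtE.fil q ≤ (g.shiftAb.wtE.fil q).comap
      (D.shift.nπ_isNatDiag.fc fun s => ((s : k) + r)⁻¹) :=
    Module.End.fil_le fun m hm b hb => Module.End.mem_fil hm (by
      rw [← map_smul, ← hb]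
      exact (D.shift.nπ_isNatDiag.fc_comm D.shift.nπ_isNatDiag g.shiftAb.wtE
        (fun x => by rw [nπ_apply, π_wtE, nE_wtE, ← nπ_apply]) _ b).symm)
  rw [nInv_apply D _ ha]
  exact h (hf a)

/-! ### The top form -/

theorem psi_nX (f : g.SHom) : D.psi (D.nX f) = 0 := by
  rw [psi_apply, nX_apply, nE_top, map_zero, add_zero, topCoeff_nE]

theorem psi_PX (f : g.SHom) : D.psi (D.PX f) = D.psi f := by
  rw [psi_apply, PX_apply, topCoeff_π, π_top, psi_apply]

/-- The degree of the top cochain. -/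
def degX : ℤ := D.shift.topDeg - D.topDeg

omit [CharZero k] in
theorem degX_eq : D.degX = ∑ j, (if Even (D.dg j) then 1 - D.dg j else D.dg j) := by
  rw [degX, topDeg, topDeg, fer, fer, Finset.sum_filter, Finset.sum_filter]
  change ∑ j : D.J, (if Even (D.dg j + 1) then D.dg j + 1 - 1 else 0) - _ = _
  rw [← Finset.sum_sub_distrib]
  refine Finset.sum_congr rfl fun j _ => ?_
  by_cases h : Even (D.dg j)
  · rw [if_pos h, if_neg (by rwa [Int.even_add_one, not_not]), if_pos h]
    ring
  · rw [if_neg h, if_pos (by rwa [Int.even_add_one]), if_neg h]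
    ring

/-- The coefficient pairs two homogeneous top forms, whose degrees differ by `degX`. -/
theorem psi_eq_zero {n : ℤ} (hn : n ≠ D.degX) {f : g.SHom} (hf : f ∈ g.cochX n) : D.psi f = 0 := by
  have h := congrArg D.shift.topCoeff (hf D.top)
  rw [topCoeff_degE, degE_top, map_smul, map_add, map_smul, map_smul, ← psi_apply, smul_eq_mul,
    smul_eq_mul, ← add_mul] at h
  have h1 : ((D.degX - n : ℤ) : k) * D.psi f = 0 := by
    rw [degX]
    push_cast
    linear_combination h
  exact (mul_eq_zero.1 h1).resolve_left (Int.cast_ne_zero.2 (sub_ne_zero.2 hn.symm))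

theorem psi_wX : D.psi D.wX = 1 := by
  rw [psi_apply, wX_apply, topCoeff_top, one_smul, topCoeff_top]

theorem PX_wX : D.PX D.wX = D.wX := LinearMap.ext fun a => by
  rw [PX_apply, wX_apply, topCoeff_π, map_smul, π_top, wX_apply]

theorem nX_wX : D.nX D.wX = 0 := LinearMap.ext fun a => by
  rw [nX_apply, wX_apply, wX_apply, topCoeff_nE, map_smul, nE_top]; simp

theorem wX_mem : D.wX ∈ g.cochX D.degX := by
  intro a
  rw [wX_apply, wX_apply, topCoeff_degE, map_smul, degE_top, degX]
  push_cast
  module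

theorem nX_tX (n : ℤ) (f : g.SHom) : D.nX (D.tX n f) = D.tX n (g.kap (n - 1) (D.tX n f)) := by
  have h1 := D.tX_kap (n - 1) (D.tX n f)
  rw [tX_tX, map_zero, add_zero, sub_add_cancel] at h1
  exact h1.symm

theorem tX_nX (n : ℤ) (f : g.SHom) : D.tX n (D.nX f) = D.nX (D.tX n f) := by
  rw [← D.tX_kap n f, map_add, tX_tX', zero_add, nX_tX]

theorem PX_nX (f : g.SHom) : D.PX (D.nX f) = D.nX (D.PX f) := LinearMap.ext fun a => by
  rw [PX_apply, nX_apply, nX_apply, map_add, PX_apply, PX_apply, D.shift.π_nE, D.π_nE]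

/-- The contraction commutes with `nX`, so the result is again annihilated by it and must be a
multiple of `wX`. It lies one degree lower, so the multiple is zero. -/
theorem tX_wX (n : ℤ) : D.tX n D.wX = 0 := by
  have h1 : D.PX (D.tX n D.wX) = D.tX n D.wX := by rw [← tX_PX, PX_wX]
  have h2 := D.nInv_nX h1
  rw [← tX_nX, nX_wX, map_zero, nInv_zero, D.psi_eq_zero (by omega) (D.tX_mem n D.wX_mem), zero_smul,
    sub_zero] at h2
  exact h2.symm

/-- On the cohomology f lies in the image of `nX` up to a multiple of `wX`. The former is killed by
`psi` after commuting `tX` past `nX`, the latter by `tX`. -/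
theorem psi_tX (n : ℤ) (f : g.SHom) : D.psi (D.tX n f) = 0 := by
  rw [← psi_PX, ← tX_PX]
  have h := eq_sub_iff_add_eq.1 (D.nX_nInv (D.PX_PX f))
  rw [← h, map_add, map_smul, tX_wX, smul_zero, add_zero, tX_nX, psi_nX]

theorem psi_hX (n : ℤ) (f : g.SHom) : D.psi (D.hX n f) = 0 := by
  rw [← psi_PX, PX_hX, map_zero]

theorem psi_wtX (p : ℕ) (f : g.SHom) : D.psi (g.wtX p f) = if p = D.fer.card then D.psi f else 0 := by
  rw [psi_apply, wtX_apply]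
  split_ifs with h
  · subst h; rw [g.wtE_isNatDiag.pr_self D.wtE_top, psi_apply]
  · rw [g.wtE_isNatDiag.pr_of_ne (Ne.symm h) D.wtE_top, map_zero, map_zero]

/-! ### Solving for the leading terms -/

/-- Such a map is determined by its values on the words of length `p` in finitely many letters. This
finiteness makes the two filtration inductions below terminate. -/
theorem exists_mem_filX {p : ℕ} {f : g.SHom} (hf : D.PX f = f) (hp : g.wtX p f = f) :
    ∃ q, f ∈ g.filX q := by
  have hfin : Finite {l : List D.J // l.length = p} := List.finite_length_eq D.J p
  choose q hq using fun l : {l : List D.J // l.length = p} =>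
    g.shiftAb.wtE_isNatDiag.exists_mem_fil (f (D.word l))
  obtain ⟨Q, hQ⟩ := (Set.finite_range q).bddAbove
  refine ⟨Q, fun a => ?_⟩
  have h1 : f a = g.wtX p f (D.π a) := by rw [hp]; rw [← hf, PX_apply, PX_apply, π_π]
  rw [h1]
  have h2 : Submodule.span k (Set.range D.word) ≤ (g.shiftAb.wtE.fil Q).comap (g.wtX p f) := by
    refine Submodule.span_le.2 ?_
    rintro _ ⟨l, rfl⟩
    rw [SetLike.mem_coe, Submodule.mem_comap, wtX_apply]
    by_cases hl : l.length = p
    · rw [g.wtE_isNatDiag.pr_self (by rw [wtE_word, hl])]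
      exact g.shiftAb.wtE.fil_mono (hQ ⟨⟨l, hl⟩, rfl⟩) (hq ⟨l, hl⟩)
    · rw [g.wtE_isNatDiag.pr_of_ne hl (D.wtE_word l), map_zero]
      exact zero_mem _
  exact h2 (D.π_mem_span_word a)

/-- To leading order `dUp` is `kap`, and `tX kap tX = tX nX`, which `nInv` inverts up to the
multiple of `wX` that `tX` kills. The remaining error has smaller filtration, so finitely many
corrections suffice. -/
theorem exists_tX_eq {p : ℕ} {n : ℤ} {c : g.SHom} (hP : D.PX c = c) (hp : g.wtX (p + 1) c = c)
    (hn : c ∈ g.cochX n) : ∃ b, D.PX b = b ∧ g.wtX (p + 1) b = b ∧ b ∈ g.cochX n ∧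
      D.tX n (D.PX (g.dUp (n - 1) (D.tX n b))) = D.tX n c := by
  obtain ⟨q, hq⟩ := D.exists_mem_filX hP hp
  induction q generalizing c with
  | zero => exact ⟨0, by simp, by simp, zero_mem _, by rw [eq_zero_of_mem_filX hq]; simp⟩
  | succ q ih =>
    have hb := D.PX_nInv hP
    have hbn := D.nInv_mem hn
    have hbp : g.wtX (p + 1) (D.nInv c) = D.nInv c := by rw [wtX_nInv, hp]
    have ht : g.wtX p (D.tX n (D.nInv c)) = D.tX n (D.nInv c) := by rw [wtX_tX, hbp]
    have htn := D.tX_mem n hbn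
    let r := g.dUp (n - 1) (D.tX n (D.nInv c)) - g.kap (n - 1) (D.tX n (D.nInv c))
    have hr : r ∈ g.cochX n := by
      have := sub_mem (g.dUp_mem htn) (kap_mem htn)
      rwa [sub_add_cancel] at this
    have hrp : g.wtX (p + 1) r = r := by
      rw [map_sub, wtX_dUp, kap, wtX_tw, ht]
      rfl
    -- The contraction lowers the filtration by one and `dUp - kap` does not raise it, so the error
    -- falls under the induction hypothesis.
    obtain ⟨b, h1, h2, h3, h4⟩ := ih (c := -D.PX r) (by rw [map_neg, PX_PX])
      (by rw [map_neg, wtX_PX, hrp]) (neg_mem (D.PX_mem hr))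
      (neg_mem (D.PX_filX (g.dUp_sub_kap_mem (D.tX_filX n (D.nInv_filX hq)))))
    refine ⟨D.nInv c + b, by rw [map_add, hb, h1], by rw [map_add, hbp, h2], add_mem hbn h3, ?_⟩
    have h5 : g.dUp (n - 1) (D.tX n (D.nInv c)) = r + g.kap (n - 1) (D.tX n (D.nInv c)) :=
      (sub_add_cancel _ _).symm
    have h6 : D.tX n (D.PX (g.kap (n - 1) (D.tX n (D.nInv c)))) = D.tX n c := by
      rw [tX_PX, ← nX_tX, ← tX_nX, D.nX_nInv hP, map_sub, map_smul, tX_wX, smul_zero, sub_zero,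
        ← tX_PX, hP]
    rw [map_add (D.tX n), map_add (g.dUp _), map_add D.PX, map_add (D.tX n), h4, h5, map_add D.PX,
      map_add (D.tX n), h6, map_neg]
    abel

/-- Under these conditions the homotopy formula expresses `nX m` through `dUp - kap` followed by
`tX`, which lowers the filtration. With `psi m = 0`, applying `nInv` recovers m, so m sinks through
a finite filtration. -/
theorem eq_zero_of_tX_eq_zero {p : ℕ} {n : ℤ} {m : g.SHom} (hP : D.PX m = m) (hp : g.wtX p m = m)
    (ht : D.tX n m = 0) (ht' : D.tX (n + 1) (D.PX (g.dUp n m)) = 0) (hψ : D.psi m = 0) : m = 0 := by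
  obtain ⟨q, hq⟩ := D.exists_mem_filX hP hp
  have h1 : D.tX (n + 1) (D.PX (g.kap n m)) = D.nX m := by
    have := D.tX_kap n m
    rw [ht, map_zero, add_zero] at this
    rw [tX_PX, this, PX_nX, hP]
  have h2 : D.nX m = -D.tX (n + 1) (D.PX (g.dUp n m - g.kap n m)) := by
    rw [map_sub, map_sub, ht', h1, zero_sub, neg_neg]
  have h3 := D.nInv_nX hP
  rw [hψ, zero_smul, sub_zero] at h3
  induction q with
  | zero => exact eq_zero_of_mem_filX hq
  | succ q ih =>
    refine ih ?_
    rw [← h3, h2]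
    exact D.nInv_filX (neg_mem (D.tX_filX _ (D.PX_filX (g.dUp_sub_kap_mem hq))))

end Retract

end DGLieAlgebra

namespace DGLieAlgebra

variable {k : Type u} {L : Type v} [Field k] [CharZero k] [AddCommGroup L] [Module k L]
variable {g : DGLieAlgebra k L}

/-! ### Weight components of cochains -/

theorem wtX_wtX (p : ℕ) (f : g.SHom) : g.wtX p (g.wtX p f) = g.wtX p f :=
  LinearMap.ext fun a => by rw [wtX_apply, wtX_apply, g.wtE_isNatDiag.pr_pr, wtX_apply]

theorem ext_wtX {f f' : g.SHom} (h : ∀ p, g.wtX p f = g.wtX p f') : f = f' :=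
  g.wtE_isNatDiag.hom_ext_pr fun p a => LinearMap.congr_fun (h p) a

/-- Completeness for the weight: S(g[1]) is the direct sum of its weight parts, so a linear map out
of it is an arbitrary family of components. -/
theorem exists_wtX_eq (y : ℕ → g.SHom) (hy : ∀ p, g.wtX p (y p) = y p) :
    ∃ f, ∀ p, g.wtX p f = y p :=
  ⟨g.wtE_isNatDiag.lift y, fun p => LinearMap.ext fun a => by
    rw [wtX_apply, g.wtE_isNatDiag.lift_pr, ← wtX_apply, hy]⟩

theorem wtX_mem (p : ℕ) {n : ℤ} {f : g.SHom} (hf : f ∈ g.cochX n) : g.wtX p f ∈ g.cochX n := by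
  intro a
  have h := hf (g.wtE_isNatDiag.pr p a)
  have e : g.degE (g.wtE_isNatDiag.pr p a) = _ := g.derL_pr g.isHomogMap_degL p a
  rwa [e] at h

theorem mem_cochX_of_wtX {n : ℤ} {f : g.SHom} (h : ∀ p, g.wtX p f ∈ g.cochX n) : f ∈ g.cochX n := by
  intro a
  refine LinearMap.congr_fun (g.wtE_isNatDiag.hom_ext_pr (F := g.shiftAb.degE ∘ₗ f)
    (G := f ∘ₗ g.degE + (n : k) • f) fun p a => ?_) a
  have h1 := h p (g.wtE_isNatDiag.pr p a)
  have e : g.degE (g.wtE_isNatDiag.pr p a) = _ := g.derL_pr g.isHomogMap_degL p a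
  rw [wtX_apply, wtX_apply, e, g.wtE_isNatDiag.pr_pr, g.wtE_isNatDiag.pr_pr] at h1
  rw [LinearMap.comp_apply, LinearMap.add_apply, LinearMap.comp_apply, e]
  exact h1

namespace Retract

variable (D : g.Retract)

/-! ### Contraction of the complex of cochains -/

theorem hX_dLin_hX (n : ℤ) (f : g.SHom) : D.hX n (g.dLin (n - 1) (D.hX n f)) = D.hX n f := by
  have h1 := D.hX_hX (n + 1) (g.dLin n f)
  rw [add_sub_cancel_right] at h1
  rw [eq_sub_of_add_eq (D.dLin_hX n f), map_sub, map_sub, hX_PX, h1, sub_zero, sub_zero]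

/-- The solution is `hX c` plus some `tX b` on the cohomology. The first summand settles the
condition on `dLin`; the second is invisible to `dLin` and `hX`, and is free to settle the condition
on `dUp` one weight higher through `exists_tX_eq`. -/
theorem exists_step {n : ℤ} {a : g.SHom} (ha : a ∈ g.cochX n) (p : ℕ) {c : g.SHom}
    (hc : c ∈ g.cochX n) (hp : g.wtX p c = c) : ∃ y ∈ g.cochX (n - 1), g.wtX p y = y ∧
      D.hX (n - 1) y = 0 ∧ D.tX (n - 1) (D.PX y) = 0 ∧ D.psi y = 0 ∧
      D.hX n (g.dLin (n - 1) y) = D.hX n c ∧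
      D.tX n (D.PX (g.dUp (n - 1) y)) = D.tX n (D.PX (g.wtX (p + 1) a)) := by
  have hh := D.hX_mem hc
  have hd := g.dUp_mem hh
  rw [sub_add_cancel] at hd
  obtain ⟨b, h1, h2, h3, h4⟩ := D.exists_tX_eq (p := p) (n := n)
    (c := D.PX (g.wtX (p + 1) a - g.dUp (n - 1) (D.hX n c))) (D.PX_PX _)
    (by rw [wtX_PX, map_sub, wtX_wtX, wtX_dUp, wtX_hX, hp])
    (D.PX_mem (sub_mem (wtX_mem _ ha) hd))
  have h5 : D.PX (D.tX n b) = D.tX n b := by rw [← tX_PX, h1]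
  refine ⟨D.hX n c + D.tX n b, add_mem hh (D.tX_mem n h3), ?_, ?_, ?_, ?_, ?_, ?_⟩
  · rw [map_add, wtX_hX, hp, wtX_tX, h2]
  · rw [map_add, hX_hX, ← h5, hX_PX, zero_add]
  · rw [map_add, PX_hX, zero_add, h5, tX_tX]
  · rw [map_add, psi_hX, psi_tX, zero_add]
  · rw [map_add, map_add, hX_dLin_hX, ← h5, dLin_PX, map_zero, add_zero]
  · rw [map_add, map_add, map_add, h4, map_sub, map_sub]
    abel

/-- Existence of a gauge-fixed correction, built weight by weight with `exists_step`. At each weight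
the effective right-hand side is the component of `a` minus what `dUp` brings up from the preceding
weight. -/
theorem exists_correction {n : ℤ} {a : g.SHom} (ha : a ∈ g.cochX n) :
    ∃ y ∈ g.cochX (n - 1), D.hX (n - 1) y = 0 ∧ D.tX (n - 1) (D.PX y) = 0 ∧ D.psi y = 0 ∧
      D.hX n (g.dX (n - 1) y) = D.hX n a ∧ D.tX n (D.PX (g.dX (n - 1) y)) = D.tX n (D.PX a) := by
  -- The hypotheses on c are moved behind the existential, so that the choice is a total function
  -- and can be used in a recursion before its inputs are known to be admissible.
  have h : ∀ (p : ℕ) (c : g.SHom), ∃ y, c ∈ g.cochX n → g.wtX p c = c →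
      y ∈ g.cochX (n - 1) ∧ g.wtX p y = y ∧
      D.hX (n - 1) y = 0 ∧ D.tX (n - 1) (D.PX y) = 0 ∧ D.psi y = 0 ∧
      D.hX n (g.dLin (n - 1) y) = D.hX n c ∧
      D.tX n (D.PX (g.dUp (n - 1) y)) = D.tX n (D.PX (g.wtX (p + 1) a)) := fun p c => by
    by_cases hc : c ∈ g.cochX n ∧ g.wtX p c = c
    · obtain ⟨y, hy⟩ := D.exists_step ha p hc.1 hc.2
      exact ⟨y, fun _ _ => hy⟩
    · exact ⟨0, fun h1 h2 => (hc ⟨h1, h2⟩).elim⟩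
  choose Y hY using h
  let B : ℕ → g.SHom := fun p => Nat.rec (g.wtX 0 a)
    (fun p c => g.wtX (p + 1) a - g.dUp (n - 1) (Y p c)) p
  have hB : ∀ p, B p ∈ g.cochX n ∧ g.wtX p (B p) = B p := fun p => by
    induction p with
    | zero => exact ⟨wtX_mem _ ha, wtX_wtX _ _⟩
    | succ p ih =>
      have hy := hY p (B p) ih.1 ih.2
      have hd := g.dUp_mem hy.1
      rw [sub_add_cancel] at hd
      change g.wtX (p + 1) a - g.dUp (n - 1) (Y p (B p)) ∈ _ ∧
        g.wtX (p + 1) (g.wtX (p + 1) a - g.dUp (n - 1) (Y p (B p))) =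
          g.wtX (p + 1) a - g.dUp (n - 1) (Y p (B p))
      exact ⟨sub_mem (wtX_mem _ ha) hd, by rw [map_sub, wtX_wtX, wtX_dUp, hy.2.1]⟩
  have hy := fun p => hY p (B p) (hB p).1 (hB p).2
  obtain ⟨y, e⟩ := exists_wtX_eq (fun p => Y p (B p)) fun p => (hy p).2.1
  refine ⟨y, mem_cochX_of_wtX fun p => by rw [e]; exact (hy p).1,
    ext_wtX fun p => by rw [wtX_hX, e, (hy p).2.2.1, map_zero], ext_wtX fun p => ?_, ?_,
    ext_wtX fun p => ?_, ext_wtX fun p => ?_⟩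
  · rw [wtX_tX, wtX_PX, e, (hy _).2.2.2.1, map_zero]
  -- Only the component whose weight is that of `top` contributes to `psi`.
  · have := D.psi_wtX D.fer.card y
    rwa [if_pos rfl, e, (hy _).2.2.2.2.1, eq_comm] at this
  · rw [wtX_hX, wtX_hX, dX_eq, map_add, map_add, wtX_dLin, e, (hy p).2.2.2.2.2.1]
    rcases p with _ | p
    · rw [wtX_zero_dUp, map_zero, add_zero]
      rfl
    · rw [wtX_dUp, e, ← map_add]
      exact congrArg (D.hX n) (sub_add_cancel (g.wtX (p + 1) a) _)
  · rw [wtX_tX, wtX_tX, wtX_PX, wtX_PX, dX_eq, map_add, wtX_dLin, map_add, PX_dLin, zero_add,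
      wtX_dUp, e, (hy p).2.2.2.2.2.2]

/-- Uniqueness in the gauge, by induction on the weight. If all smaller components vanish, nothing
arrives through `dUp`, so the two `hX` conditions put the component on the cohomology. There the
`tX` conditions and `psi x = 0` make `eq_zero_of_tX_eq_zero` applicable. -/
theorem eq_zero_of_hX_tX {n : ℤ} {x : g.SHom} (hh : D.hX n x = 0) (ht : D.tX n (D.PX x) = 0)
    (hh' : D.hX (n + 1) (g.dX n x) = 0) (ht' : D.tX (n + 1) (D.PX (g.dX n x)) = 0)
    (hψ : D.psi x = 0) : x = 0 := by
  refine ext_wtX fun p => ?_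
  rw [map_zero]
  induction p using Nat.strong_induction_on with
  | _ p ih =>
    have h1 : D.hX (n + 1) (g.dLin n (g.wtX p x)) = 0 := by
      have := congrArg (g.wtX p) hh'
      rw [map_zero, wtX_hX, dX_eq, map_add, wtX_dLin] at this
      rcases p with _ | p
      · rwa [wtX_zero_dUp, add_zero] at this
      · rwa [wtX_dUp, ih p p.lt_succ_self, map_zero, add_zero] at this
    have h2 : D.PX (g.wtX p x) = g.wtX p x := by
      have := D.dLin_hX n (g.wtX p x)
      rw [h1, ← wtX_hX, hh, map_zero, map_zero, add_zero, eq_comm, sub_eq_zero] at this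
      exact this.symm
    refine D.eq_zero_of_tX_eq_zero h2 (wtX_wtX p x) ?_ ?_ ?_ (n := n)
    · rw [← h2]
      rcases p with _ | p
      · rw [← wtX_PX, tX_wtX_zero]
      · rw [← wtX_PX, ← wtX_tX, ht, map_zero]
    · have := congrArg (g.wtX p) ht'
      rwa [map_zero, wtX_tX, wtX_PX, dX_eq, map_add, wtX_dLin, map_add, PX_dLin, zero_add,
        wtX_dUp] at this
    · rw [psi_wtX, hψ, ite_self]

/-! ### Cohomology of the complex of cochains -/

theorem exists_sub_eq {n : ℤ} {x : g.SHom} (hx : x ∈ g.cochX n) : ∃ y ∈ g.cochX (n - 1),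
    D.hX (n - 1) y = 0 ∧ D.tX (n - 1) (D.PX y) = 0 ∧ D.psi y = 0 ∧
    D.hX n (x - g.dX (n - 1) y) = 0 ∧ D.tX n (D.PX (x - g.dX (n - 1) y)) = 0 := by
  obtain ⟨y, h1, h2, h3, h4, h5, h6⟩ := D.exists_correction hx
  exact ⟨y, h1, h2, h3, h4, by rw [map_sub, h5, sub_self], by rw [map_sub, map_sub, h6, sub_self]⟩

theorem dX_sub_dX (n : ℤ) (x y : g.SHom) : g.dX n (x - g.dX (n - 1) y) = g.dX n x := by
  have := g.dX_dX (n - 1) y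
  rw [sub_add_cancel] at this
  rw [map_sub, this, sub_zero]

/-- After gauge fixing, the cocycle has zero differential and, for degree reasons, zero `psi`;
uniqueness forces it to vanish. -/
theorem exists_dX_eq {n : ℤ} (hn : n ≠ D.degX) {x : g.SHom} (hx : x ∈ g.cochX n)
    (hd : g.dX n x = 0) : ∃ y ∈ g.cochX (n - 1), g.dX (n - 1) y = x := by
  obtain ⟨y, h1, -, -, -, h5, h6⟩ := D.exists_sub_eq hx
  have h7 := g.dX_mem h1
  rw [sub_add_cancel] at h7
  refine ⟨y, h1, (sub_eq_zero.1 (D.eq_zero_of_hX_tX h5 h6 ?_ ?_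
    (D.psi_eq_zero hn (sub_mem hx h7)))).symm⟩ <;> rw [dX_sub_dX, hd] <;> simp

/-- The leading cochain `wX` is corrected by a gauge-fixed y with `psi y = 0` that makes the
differential of `wX - y` gauge-fixed. This differential is closed and lies in degree `degX + 1`,
where `psi` vanishes, so it is zero. -/
theorem exists_cocycle : ∃ x ∈ g.cochX D.degX, g.dX D.degX x = 0 ∧ D.psi x = 1 ∧
    D.hX D.degX x = 0 ∧ D.tX D.degX (D.PX x) = 0 := by
  obtain ⟨y, h1, h2, h3, h4, h5, h6⟩ := D.exists_sub_eq (g.dX_mem D.wX_mem)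
  rw [add_sub_cancel_right] at h1 h2 h3 h5 h6
  have e : g.dX D.degX D.wX - g.dX D.degX y = g.dX D.degX (D.wX - y) := (map_sub _ _ _).symm
  rw [e] at h5 h6
  have hm := g.dX_mem (sub_mem D.wX_mem h1)
  refine ⟨D.wX - y, sub_mem D.wX_mem h1, ?_, by rw [map_sub, psi_wX, h4, sub_zero], ?_, ?_⟩
  · refine D.eq_zero_of_hX_tX h5 h6 ?_ ?_ (D.psi_eq_zero (by omega) hm) <;> rw [dX_dX] <;> simp
  · rw [map_sub, h2, ← PX_wX, hX_PX, sub_zero]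
  · rw [map_sub, map_sub, h3, PX_wX, tX_wX, sub_zero]

/-- The primitive may itself be gauge-fixed without changing its differential. It has degree `degX -
1`, where `psi` vanishes, so uniqueness kills the primitive and with it x. -/
theorem eq_zero_of_eq_dX {x z : g.SHom} (hh : D.hX D.degX x = 0)
    (ht : D.tX D.degX (D.PX x) = 0) (hz : z ∈ g.cochX (D.degX - 1))
    (hzx : g.dX (D.degX - 1) z = x) : x = 0 := by
  obtain ⟨y, h1, -, -, -, h5, h6⟩ := D.exists_sub_eq hz
  have h7 := g.dX_mem h1
  rw [sub_add_cancel] at h7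
  have h8 : g.dX (D.degX - 1) (z - g.dX (D.degX - 1 - 1) y) = x := by rw [dX_sub_dX, hzx]
  rw [← h8, D.eq_zero_of_hX_tX h5 h6 (by rw [h8, sub_add_cancel, hh])
    (by rw [h8, sub_add_cancel, ht]) (D.psi_eq_zero (by omega) (sub_mem hz h7)), map_zero]

/-- The gauge-fixed cocycle with `psi` equal to 1 generates: it is not exact by `eq_zero_of_eq_dX`,
and a gauge-fixed cocycle v differs from `psi v` times it by something to which uniqueness applies.
-/
theorem exists_generator : ∃ x ∈ g.cochX D.degX, g.dX D.degX x = 0 ∧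
    (∀ z ∈ g.cochX (D.degX - 1), g.dX (D.degX - 1) z ≠ x) ∧
    ∀ u ∈ g.cochX D.degX, g.dX D.degX u = 0 →
      ∃ c : k, ∃ y ∈ g.cochX (D.degX - 1), g.dX (D.degX - 1) y = u - c • x := by
  obtain ⟨x, h1, h2, h3, h4, h5⟩ := D.exists_cocycle
  refine ⟨x, h1, h2, fun z hz e => ?_, fun u hu hd => ?_⟩
  · rw [D.eq_zero_of_eq_dX h4 h5 hz e, map_zero] at h3
    exact zero_ne_one h3
  · obtain ⟨y, k1, -, -, -, k5, k6⟩ := D.exists_sub_eq hu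
    let v := u - g.dX (D.degX - 1) y
    have hv : g.dX D.degX (v - D.psi v • x) = 0 := by
      rw [map_sub, map_smul, h2, dX_sub_dX, hd, smul_zero, sub_zero]
    have h6 : v - D.psi v • x = 0 := by
      refine D.eq_zero_of_hX_tX (n := D.degX) ?_ ?_ ?_ ?_ ?_
      · rw [map_sub, map_smul, h4, k5, smul_zero, sub_zero]
      · rw [map_sub, map_sub, map_smul, map_smul, h5, k6, smul_zero, sub_zero]
      · rw [hv, map_zero]
      · rw [hv, map_zero, map_zero]
      · rw [map_sub, map_smul, h3, smul_eq_mul, mul_one, sub_self]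
    exact ⟨D.psi v, y, k1, by rw [← sub_eq_zero.1 h6]; simp [v]⟩

theorem subsingleton_HCE {n : ℤ} (hn : n ≠ D.degX) : Subsingleton (g.HCE n) := by
  rw [Submodule.Quotient.subsingleton_iff, eq_top_iff]
  rintro ⟨f, hf, hd⟩ -
  obtain ⟨x, rfl⟩ := g.homEquiv.surjective f
  replace hd : g.dCE n (g.homEquiv x) = 0 := hd
  rw [← homEquiv_dX, LinearEquiv.map_eq_zero_iff] at hd
  obtain ⟨y, hy, e⟩ := D.exists_dX_eq hn ((g.homEquiv_mem_cochains).1 hf) hd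
  exact ⟨g.homEquiv y, (g.homEquiv_mem_cochains).2 hy, by rw [← homEquiv_dX, e]; rfl⟩

theorem finrank_HCE : Module.finrank k (g.HCE D.degX) = 1 := by
  obtain ⟨x, h1, h2, h3, h4⟩ := D.exists_generator
  rw [finrank_eq_one_iff']
  refine ⟨Submodule.Quotient.mk ⟨g.homEquiv x, (g.homEquiv_mem_cochains).2 h1, by
    change g.dCE D.degX (g.homEquiv x) = 0
    rw [← homEquiv_dX, h2, map_zero]⟩, fun h => ?_, fun w => ?_⟩
  · rw [Submodule.Quotient.mk_eq_zero] at h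
    obtain ⟨f, hf, e⟩ := h
    obtain ⟨z, rfl⟩ := g.homEquiv.surjective f
    rw [← homEquiv_dX] at e
    exact h3 z ((g.homEquiv_mem_cochains).1 hf) (g.homEquiv.injective e)
  · obtain ⟨⟨f, hf, hd⟩, rfl⟩ := Submodule.Quotient.mk_surjective _ w
    obtain ⟨u, rfl⟩ := g.homEquiv.surjective f
    replace hd : g.dCE D.degX (g.homEquiv u) = 0 := hd
    rw [← homEquiv_dX, LinearEquiv.map_eq_zero_iff] at hd
    obtain ⟨c, y, hy, e⟩ := h4 u ((g.homEquiv_mem_cochains).1 hf) hd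
    refine ⟨c, ?_⟩
    rw [← Submodule.Quotient.mk_smul, eq_comm, Submodule.Quotient.eq]
    refine ⟨g.homEquiv y, (g.homEquiv_mem_cochains).2 hy, ?_⟩
    rw [← homEquiv_dX, e, map_sub, map_smul]
    rfl

end Retract

end DGLieAlgebra

/-! ### Conclusion -/

theorem mainTheorem2 {k : Type u} {L : Type v} [Field k] [CharZero k] [AddCommGroup L] [Module k L]
    (g : DGLieAlgebra k L) (hg : g.IsProper) :
    Module.finrank k (g.HCE g.totalDegree) = 1 ∧
      ∀ n : ℤ, n ≠ g.totalDegree → Subsingleton (g.HCE n) := by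
  obtain ⟨D, hD⟩ := g.exists_retract hg
  rw [← D.degX_eq] at hD
  rw [← hD]
  exact ⟨D.finrank_HCE, fun n hn => D.subsingleton_HCE hn⟩

end
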